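/- **Notation.** Let $\widehat T(\xi)=\int e^{-ix\cdot\xi}T(x)\,dx$ be the Fourier transform on $\mathcal S'(\mathbb R^d)$ (complex-valued tempered distributions). For $r\ge 0$ let $$PM^r=\{T\in\mathcal S'(\mathbb R^d):\ \widehat T\in L^1_{loc},\ \|T\|_{PM^r}:=\operatorname{ess\,sup}_{\xi}|\xi|^r|\widehat T(\xi)|<\infty\},$$ with $|\cdot|$ the Euclidean norm for vector-valued $\widehat T$. For $p,r>0$, $K^{p,r}_\infty$ is the space of norm-continuous maps $v:\,]0,\infty[\,\to PM^{r+2/p}$ with $\|v\|_{K^{p,r}_\infty}:=\sup_{t>0}t^{1/p}\|v(t)\|_{PM^{r+2/p}}<\infty$, and $X_\infty=(K^{p,d-1}_\infty\cap K^{p,d}_\infty)\times (K^{p,d-1}_\infty)^d$ with norm $\|(a,u)\|_{X_\infty}=\max\{\|a\|_{K^{p,d-1}_\infty},\|a\|_{K^{p,d}_\infty}\}+\|u\|_{K^{p,d-1}_\infty}$. Multiplication of $\widehat T$ by $|\xi|$, resp. $e^{\sigma|\xi|}$, is denoted $|D|$, resp. $e^{\sigma|D|}$. For $T\in PM^r$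 with $r<d$, $\operatorname{rad}(T)=\sup\{\sigma>0:\ e^{\sigma|D|}T\in PM^r\}\in[0,\infty]$; the radius of $(a,u)$ is the minimum of the radii of $a,u_1,\dots,u_d$. For $(a(t),u(t))$ below it is taken with $r=d-1+\frac2p$. **The system.** Let $\mu>0$, $\mu+\nu>0$, $\kappa>0$, $\alpha>0$, and consider $$\partial_t a+\operatorname{div}u=f,\qquad \partial_t u-\mu\Delta u-(\mu+\nu)\nabla\operatorname{div}u+\alpha\nabla a-\kappa\nabla\Delta a=g,\qquad (a,u)|_{t=0}=(a_0,u_0),$$ where $f=-u\cdot\nabla a$ and $$g_k=-\sum_j u_j\partial_ju_k+\mu\sum_j\partial_ja\,\partial_ju_k+(\mu+\nu)\sum_j\partial_ja\,\partial_ku_j+\tfrac{\kappa}{2}\,\partial_k\big(|\nabla a|^2\big),\qquad |\nabla a|^2:=\sum_j(\partial_ja)^2,$$ products being defined by $\widehat{vw}=(2\pi)^{-d}\,\widehat v\star\widehat w$. Let $A(\xi)$ be the symbol of the linear part, so that the linear system reads $\partial_t(\widehat a,\widehat u)+A(\xi)(\widehat a,\widehat u)=0$, and let $W(t)=e^{-tA(D)}$.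 A solution means a mild solution: for all $t>0$, $$(a,u)(t)=W(t)(a_0,u_0)+\int_0^tW(t-s)(f,g)(s)\,ds,$$ the identity being understood on the Fourier side, for a.e. $\xi$. **Theorem.** There is $c_0>0$, depending only on $\mu,\nu,\kappa,\alpha$, such that: 1. $c_0$ is a decay rate of the linear system: for every $d\ge2$ there is $C>0$ such that, for all $t\ge0$, all $\xi\in\mathbb R^d$ and all $(a,u)\in\mathbb C^{1+d}$, the vector $(b,v)=e^{-tA(\xi)}(a,u)$ satisfies $|(b,|\xi|b,v)|\le C e^{-c_0t|\xi|^2}|(a,|\xi|a,u)|$. 2. For every $d\ge2$ and every $p>2$ with $d-3+\frac4p>0$ there are $\rho>0$ and $R>0$ such that: (i) (global existence) for all $(a_0,u_0)\in(PM^{d-1}\cap PM^d)\times (PM^{d-1})^d$ with $\|(a_0,|D|a_0,u_0)\|_{PM^{d-1}}\le\rho$ there is a unique solution $(a,u)\in X_\infty$ with $\|(a,u)\|_{X_\infty}\le R$; (ii) (analyticity) if moreover $\|(a_0,|D|a_0,u_0)\|_{PM^{d-1}}\le\dfrac{\rho}{2e^{2c_0}}$, then for every $t>0$ this solution satisfies: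 $a(t)$ and all components of $u(t)$ are real analytic functions on $\mathbb R^d$, and $$\operatorname{rad}(a(t),u(t))\ge c_0\sqrt t .$$ -/

import Mathlib

open MeasureTheory Filter Topology
open scoped SchwartzMap FourierTransform ENNReal Matrix

noncomputable section

namespace NSK

/-- The physical (and frequency) space `ℝ^d` with its Euclidean norm. -/
abbrev Space (d : ℕ) : Type := EuclideanSpace ℝ (Fin d)

/-! ### Fourier densities and pseudo-measure spaces -/

/-- `φ` is a locally integrable function representing the Fourier transform of `T`, with the
convention `T̂(ξ) = ∫ e^{-i x·ξ} T(x) dx`. Mathlib's `𝓕` uses `e^{-2πi x·ξ}`, whence the dilation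
by `2π`. -/
def IsFourierDensity {d : ℕ} (T : 𝓢'(Space d, ℂ)) (φ : Space d → ℂ) : Prop :=
  LocallyIntegrable φ volume ∧
    ∀ ψ : 𝓢(Space d, ℂ),
      Integrable (fun ξ => ψ ξ * φ ((2 * Real.pi) • ξ)) volume ∧
        (𝓕 T) ψ = ∫ ξ, ψ ξ * φ ((2 * Real.pi) • ξ)

open scoped Classical in
/-- The function `T̂` (unique up to null sets) when the Fourier transform of `T` is a function. -/
def hat {d : ℕ} (T : 𝓢'(Space d, ℂ)) : Space d → ℂ :=
  if h : ∃ φ, IsFourierDensity T φ then h.choose else 0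

/-- `û = (û₁, …, û_d)` for a vector field `u`. -/
def hatVec {d : ℕ} (u : Fin d → 𝓢'(Space d, ℂ)) (ξ : Space d) : EuclideanSpace ℂ (Fin d) :=
  WithLp.toLp 2 (fun k => hat (u k) ξ)

/-- `sup_ξ |ξ|^r |φ(ξ)|` (essential supremum), with values in `[0, ∞]`. -/
def pmNorm {d : ℕ} {F : Type} [NormedAddCommGroup F] (r : ℝ) (φ : Space d → F) : ℝ≥0∞ :=
  eLpNorm (fun ξ => ‖ξ‖ ^ r * ‖φ ξ‖) ⊤ volume

/-- `T ∈ PM^r(ℝ^d)`. -/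
def MemPM {d : ℕ} (r : ℝ) (T : 𝓢'(Space d, ℂ)) : Prop :=
  (∃ φ, IsFourierDensity T φ) ∧ pmNorm r (hat T) < ⊤

/-! ### Kato spaces on `]0, ∞[` and the space `X_∞` -/

/-- `sup_{t > 0} t^{1/p} ‖φ(t)‖_{PM^{r + 2/p}}`, for the Fourier side `φ` of a path. -/
def katoNorm {d : ℕ} {F : Type} [NormedAddCommGroup F] (p r : ℝ) (φ : ℝ → Space d → F) : ℝ≥0∞ :=
  ⨆ t ∈ Set.Ioi (0 : ℝ), ENNReal.ofReal (t ^ (1 / p)) * pmNorm (r + 2 / p) (φ t)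

/-- `v ∈ K^{p,r}_∞`: the path is norm continuous from `]0, ∞[` to `PM^{r + 2/p}`, and its
weighted norm is finite. The values of `v` at `t ≤ 0` are irrelevant. -/
def MemKato {d : ℕ} (p r : ℝ) (v : ℝ → 𝓢'(Space d, ℂ)) : Prop :=
  (∀ t, 0 < t → MemPM (r + 2 / p) (v t)) ∧
    (∀ t₀, 0 < t₀ →
      Tendsto (fun t => pmNorm (r + 2 / p) (hat (v t - v t₀))) (𝓝 t₀) (𝓝 0)) ∧
    katoNorm p r (fun t => hat (v t)) < ⊤

/-- `(a, u) ∈ X_∞ = (K^{p,d-1}_∞ ∩ K^{p,d}_∞) × (K^{p,d-1}_∞)^d`. -/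
def MemX {d : ℕ} (p : ℝ) (a : ℝ → 𝓢'(Space d, ℂ)) (u : ℝ → Fin d → 𝓢'(Space d, ℂ)) : Prop :=
  MemKato p ((d : ℝ) - 1) a ∧ MemKato p (d : ℝ) a ∧
    ∀ k, MemKato p ((d : ℝ) - 1) (fun t => u t k)

/-- `‖(a, u)‖_{X_∞}`. -/
def xNorm {d : ℕ} (p : ℝ) (a : ℝ → 𝓢'(Space d, ℂ)) (u : ℝ → Fin d → 𝓢'(Space d, ℂ)) : ℝ≥0∞ :=
  max (katoNorm p ((d : ℝ) - 1) (fun t => hat (a t))) (katoNorm p (d : ℝ) (fun t => hat (a t))) +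
    katoNorm p ((d : ℝ) - 1) (fun t => hatVec (u t))

/-! ### Initial data -/

/-- The column `(â, û₁, …, û_d)(ξ)`. -/
def hatPair {d : ℕ} (a : 𝓢'(Space d, ℂ)) (u : Fin d → 𝓢'(Space d, ℂ)) (ξ : Space d) :
    Unit ⊕ Fin d → ℂ :=
  Sum.elim (fun _ => hat a ξ) (fun k => hat (u k) ξ)

/-- The Euclidean norm of `(w₀, |ξ| w₀, w₁, …, w_d)`. -/
def tripleNorm {d : ℕ} (ξ : Space d) (w : Unit ⊕ Fin d → ℂ) : ℝ :=
  Real.sqrt (‖w (Sum.inl ())‖ ^ 2 + (‖ξ‖ * ‖w (Sum.inl ())‖) ^ 2 +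
    ∑ k, ‖w (Sum.inr k)‖ ^ 2)

/-- `(a₀, u₀) ∈ (PM^{d-1} ∩ PM^d) × (PM^{d-1})^d`. -/
def IsData {d : ℕ} (a₀ : 𝓢'(Space d, ℂ)) (u₀ : Fin d → 𝓢'(Space d, ℂ)) : Prop :=
  MemPM ((d : ℝ) - 1) a₀ ∧ MemPM (d : ℝ) a₀ ∧ ∀ k, MemPM ((d : ℝ) - 1) (u₀ k)

/-- `‖(a₀, |D|a₀, u₀)‖_{PM^{d-1}}`. -/
def dataNorm {d : ℕ} (a₀ : 𝓢'(Space d, ℂ)) (u₀ : Fin d → 𝓢'(Space d, ℂ)) : ℝ≥0∞ :=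
  pmNorm ((d : ℝ) - 1) (fun ξ => tripleNorm ξ (hatPair a₀ u₀ ξ))

/-! ### The linear semigroup -/

/-- The symbol `A(ξ)` of the linearized system: on the Fourier side the linearized system reads
`∂ₜ(â, û) + A(ξ)(â, û) = 0`. -/
def symbol {d : ℕ} (μ ν κ α : ℝ) (ξ : Space d) : Matrix (Unit ⊕ Fin d) (Unit ⊕ Fin d) ℂ :=
  Matrix.fromBlocks 0
    (Matrix.of fun _ k => Complex.I * (ξ k : ℂ))
    (Matrix.of fun k _ => Complex.I * ((α * ξ k + κ * ξ k * ‖ξ‖ ^ 2 : ℝ) : ℂ))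
    (Matrix.of fun j k =>
      (((if j = k then μ * ‖ξ‖ ^ 2 else 0) + (μ + ν) * ξ j * ξ k : ℝ) : ℂ))

/-- The Fourier multiplier `exp(-t A(ξ))` of the semigroup `W(t)` of the linearized system. -/
def semigroup {d : ℕ} (μ ν κ α t : ℝ) (ξ : Space d) : Matrix (Unit ⊕ Fin d) (Unit ⊕ Fin d) ℂ :=
  NormedSpace.exp (((-t : ℝ) : ℂ) • symbol μ ν κ α ξ)

/-- `c` is an exponential rate in the pointwise parabolic estimate of the linear semigroup. -/
def IsDecayRate (d : ℕ) (μ ν κ α c : ℝ) : Prop :=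
  ∃ C : ℝ, 0 < C ∧ ∀ t : ℝ, 0 ≤ t → ∀ (ξ : Space d) (w : Unit ⊕ Fin d → ℂ),
    tripleNorm ξ (semigroup μ ν κ α t ξ *ᵥ w) ≤
      C * Real.exp (-c * t * ‖ξ‖ ^ 2) * tripleNorm ξ w

/-! ### The nonlinear terms, on the Fourier side -/

/-- The Fourier transform of a product: `(2π)^{-d} (φ ⋆ ψ)(ξ)`. -/
def prodHat {d : ℕ} (φ ψ : Space d → ℂ) (ξ : Space d) : ℂ :=
  (((2 * Real.pi) ^ d : ℝ) : ℂ)⁻¹ * ∫ η, φ (ξ - η) * ψ η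

/-- The Fourier transform of `∂_j`. -/
def dHat {d : ℕ} (j : Fin d) (φ : Space d → ℂ) (ξ : Space d) : ℂ :=
  Complex.I * (ξ j : ℂ) * φ ξ

/-- `f(u, a) = - u·∇a`. -/
def fHat {d : ℕ} (a : 𝓢'(Space d, ℂ)) (u : Fin d → 𝓢'(Space d, ℂ)) (ξ : Space d) : ℂ :=
  -∑ j, prodHat (hat (u j)) (dHat j (hat a)) ξ

/-- The `k`-th component of `g₁ = - u·∇u`. -/
def g₁Hat {d : ℕ} (u : Fin d → 𝓢'(Space d, ℂ)) (k : Fin d) (ξ : Space d) : ℂ :=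
  -∑ j, prodHat (hat (u j)) (dHat j (hat (u k))) ξ

/-- The `k`-th component of `g₂ = μ ∇a·∇u + (μ+ν) ∇a·Du`, that is of
`μ ∑_j ∂_j a ∂_j u_k + (μ+ν) ∑_j ∂_j a ∂_k u_j`. -/
def g₂Hat {d : ℕ} (μ ν : ℝ) (a : 𝓢'(Space d, ℂ)) (u : Fin d → 𝓢'(Space d, ℂ)) (k : Fin d)
    (ξ : Space d) : ℂ :=
  (μ : ℂ) * ∑ j, prodHat (dHat j (hat a)) (dHat j (hat (u k))) ξ +
    ((μ + ν : ℝ) : ℂ) * ∑ j, prodHat (dHat j (hat a)) (dHat k (hat (u j))) ξ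

/-- The `k`-th component of `g₃ = (κ/2) ∇(∇a·∇a)`. -/
def g₃Hat {d : ℕ} (κ : ℝ) (a : 𝓢'(Space d, ℂ)) (k : Fin d) (ξ : Space d) : ℂ :=
  ((κ / 2 : ℝ) : ℂ) * dHat k (fun ζ => ∑ j, prodHat (dHat j (hat a)) (dHat j (hat a)) ζ) ξ

/-- The column `(f, g₁ + g₂ + g₃)`, on the Fourier side. -/
def nonlinHat {d : ℕ} (μ ν κ : ℝ) (a : 𝓢'(Space d, ℂ)) (u : Fin d → 𝓢'(Space d, ℂ))
    (ξ : Space d) : Unit ⊕ Fin d → ℂ :=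
  Sum.elim (fun _ => fHat a u ξ) (fun k => g₁Hat u k ξ + g₂Hat μ ν a u k ξ + g₃Hat κ a k ξ)

/-! ### Mild solutions -/

/-- `(a, u)` is a mild solution on `]0, ∞[` with initial data `(a₀, u₀)`:
`(a, u)(t) = W(t)(a₀, u₀) + ∫₀ᵗ W(t - s) (f, g)(s) ds`, read on the Fourier side. -/
def IsMildSolution {d : ℕ} (μ ν κ α : ℝ) (a₀ : 𝓢'(Space d, ℂ)) (u₀ : Fin d → 𝓢'(Space d, ℂ))
    (a : ℝ → 𝓢'(Space d, ℂ)) (u : ℝ → Fin d → 𝓢'(Space d, ℂ)) : Prop :=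
  ∀ t : ℝ, 0 < t → ∀ᵐ ξ : Space d,
    IntervalIntegrable
        (fun s => semigroup μ ν κ α (t - s) ξ *ᵥ nonlinHat μ ν κ (a s) (u s) ξ) volume 0 t ∧
      hatPair (a t) (u t) ξ =
        semigroup μ ν κ α t ξ *ᵥ hatPair a₀ u₀ ξ +
          ∫ s in (0 : ℝ)..t, semigroup μ ν κ α (t - s) ξ *ᵥ nonlinHat μ ν κ (a s) (u s) ξ

/-- `(a, u)` is a solution in the closed ball of radius `R` of `X_∞`. -/
def IsSolutionInBall {d : ℕ} (μ ν κ α p R : ℝ) (a₀ : 𝓢'(Space d, ℂ))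
    (u₀ : Fin d → 𝓢'(Space d, ℂ)) (a : ℝ → 𝓢'(Space d, ℂ))
    (u : ℝ → Fin d → 𝓢'(Space d, ℂ)) : Prop :=
  MemX p a u ∧ xNorm p a u ≤ ENNReal.ofReal R ∧ IsMildSolution μ ν κ α a₀ u₀ a u

/-! ### Analyticity -/

/-- `e^{σ|D|} T ∈ PM^r`. -/
def ExpMemPM {d : ℕ} (r σ : ℝ) (T : 𝓢'(Space d, ℂ)) : Prop :=
  ∃ S : 𝓢'(Space d, ℂ),
    IsFourierDensity S (fun ξ => ((Real.exp (σ * ‖ξ‖) : ℝ) : ℂ) * hat T ξ) ∧ MemPM r S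

/-- The radius of analyticity `sup {σ > 0 : e^{σ|D|} T ∈ PM^r}` of `T ∈ PM^r`, in `[0, ∞]`. -/
def rad {d : ℕ} (r : ℝ) (T : 𝓢'(Space d, ℂ)) : ℝ≥0∞ :=
  ⨆ (σ : ℝ) (_ : 0 < σ ∧ ExpMemPM r σ T), ENNReal.ofReal σ

/-- The radius of analyticity of a pair: the minimum over all components. -/
def radPair {d : ℕ} (r : ℝ) (a : 𝓢'(Space d, ℂ)) (u : Fin d → 𝓢'(Space d, ℂ)) : ℝ≥0∞ :=
  min (rad r a) (⨅ k, rad r (u k))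

/-- `T` is (the distribution defined by) a real analytic function on `ℝ^d`. -/
def IsRealAnalytic {d : ℕ} (T : 𝓢'(Space d, ℂ)) : Prop :=
  ∃ h : Space d → ℂ, AnalyticOnNhd ℝ h Set.univ ∧
    ∀ ψ : 𝓢(Space d, ℂ), HasCompactSupport ψ → T ψ = ∫ x, ψ x * h x

end NSK

end

/-!
The solution is constructed on the Fourier side, as a function
`φ(t, ξ) = (â, û₁, …, û_d)(t, ξ)` that solves the integral equation at every `t > 0` and every
`ξ ≠ 0`. All estimates are pointwise bounds in the norm `tripleNorm` of `(w₀, |ξ|w₀, w')` by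
multiples of the weight `t^{-q} |ξ|^{-β} e^{-θ√t|ξ|}`, where `q = 1/p` and `β = d - 1 + 2/p`. For
`θ = 0` such bounds describe balls of `X_∞`; for `θ = c₀` they contain the analyticity statement,
so that existence and analyticity come from the same fixed point argument.

* Linear decay (`exists_semigroup_decay`): the functional
  `(α + κ|ξ|²)|w₀|² + |w'|² + 2δ Re(i w₀ conj(ξ·w'))` is equivalent to the square of the triple
  norm, and for small `δ` it decays at rate `δ|ξ|²` along the linear flow, because the cross term
  produces the dissipation in `w₀` that the diagonal of the symbol lacks. The rate `c₀` of the
  theorem is half of the rate obtained in this way; the other half pays for the exponential weight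
  through `e^{θ(√t - √s)|ξ|} ≤ e^{c₀} e^{c₀(t-s)|ξ|²}` (`exp_weight_le`).
* Products (`exists_nonlin_sub_le`): the convolution of `|ξ|^{-a}` and `|ξ|^{-b}` is a multiple of
  `|ξ|^{d-a-b}` if `a, b < d < a + b`, and `e^{-σ|ξ|}` is submultiplicative. Every nonlinear term
  thereby has order `2β - 1 - d`; the condition `d - 3 + 4/p > 0` is `d < β + (β - 1)`.
* Duhamel integral (`exists_duhamel_le`): the smoothing of the semigroup gains `2 - 2q` powers of
  `|ξ|` at the price of `(t-s)^{-(1-q)}`, which brings the order `2β - 1 - d` back to `β`, and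
  `∫₀ᵗ (t-s)^{-(1-q)} s^{-2q} ds` is a multiple of `t^{-q}`.

Together these make the fixed point map a contraction on small balls, with the same Lipschitz
constant for all `θ ∈ [0, c₀]` (`exists_duhamelLipschitz`). Its iterates are jointly measurable and
converge at every point (`exists_profile`). Uniqueness in the ball of `X_∞` is the case `θ = 0` of
the same estimate (`IsSolutionInBall.unique`); hence every solution in the ball is the one
constructed, and it inherits the exponential decay of its Fourier transform, from which
analyticity follows (`isRealAnalytic_and_le_radPair`). Norm continuity in time also uses the
exponential weight, which compensates for the loss of derivatives in the continuity of the
semigroup at time `0` (`profile_sub_le`).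
-/

namespace NSK

/-! ### Fourier densities -/

section FourierDensity

variable {d : ℕ} {T T' : 𝓢'(Space d, ℂ)} {φ φ' : Space d → ℂ}

lemma two_pi_ne_zero : (2 * Real.pi : ℝ) ≠ 0 := by positivity

/-- Null sets are preserved by the dilation that converts between the two normalizations of the
Fourier transform. -/
lemma ae_dilate {P : Space d → Prop} (h : ∀ᵐ ξ, P ξ) : ∀ᵐ ξ : Space d, P ((2 * Real.pi) • ξ) :=
  (Measure.quasiMeasurePreserving_smul volume two_pi_ne_zero).ae h

lemma ae_of_ae_dilate {P : Space d → Prop} (h : ∀ᵐ ξ : Space d, P ((2 * Real.pi) • ξ)) :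
    ∀ᵐ ξ, P ξ := by
  have := (Measure.quasiMeasurePreserving_smul (volume : Measure (Space d))
    (inv_ne_zero two_pi_ne_zero)).ae h
  simpa only [smul_smul, mul_inv_cancel₀ two_pi_ne_zero, one_smul] using this

lemma locallyIntegrable_dilate (h : LocallyIntegrable φ volume) :
    LocallyIntegrable (fun ξ => φ ((2 * Real.pi) • ξ)) volume := by
  rw [locallyIntegrable_iff] at h ⊢
  intro K hK
  have hK' : IsCompact ((fun ξ : Space d => (2 * Real.pi) • ξ) '' K) :=
    hK.image (continuous_const_smul _)
  have h1 := h _ hK'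
  rw [← integrable_indicator_iff hK'.measurableSet] at h1
  rw [← integrable_indicator_iff hK.measurableSet]
  have h2 := (MeasureTheory.integrable_comp_smul_iff volume _ two_pi_ne_zero).2 h1
  refine h2.congr (ae_of_all _ fun ξ => ?_)
  have : (2 * Real.pi) • ξ ∈ (fun ξ : Space d => (2 * Real.pi) • ξ) '' K ↔ ξ ∈ K :=
    (smul_right_injective _ two_pi_ne_zero).mem_set_image
  by_cases hξ : ξ ∈ K
  · simp only [Set.indicator_of_mem hξ, Set.indicator_of_mem (this.2 hξ)]
  · simp only [Set.indicator_of_notMem hξ, Set.indicator_of_notMem (fun h => hξ (this.1 h))]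

/-- The Fourier density of a distribution is unique up to null sets. -/
theorem IsFourierDensity.ae_eq (h : IsFourierDensity T φ) (h' : IsFourierDensity T φ') :
    φ =ᵐ[volume] φ' := by
  refine ae_of_ae_dilate (P := fun ξ => φ ξ = φ' ξ) ?_
  refine ae_eq_of_integral_contDiff_smul_eq (locallyIntegrable_dilate h.1)
    (locallyIntegrable_dilate h'.1) fun g hg hgc => ?_
  have hg₁ : HasCompactSupport (Complex.ofRealCLM ∘ g) := hgc.comp_left rfl
  have hg₂ : ContDiff ℝ (⊤ : ℕ∞) (Complex.ofRealCLM ∘ g) := by fun_prop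
  have e := (h.2 (hg₁.toSchwartzMap hg₂)).2.symm.trans (h'.2 (hg₁.toSchwartzMap hg₂)).2
  simpa using e

theorem isFourierDensity_hat (h : ∃ φ, IsFourierDensity T φ) : IsFourierDensity T (hat T) := by
  rw [hat, dif_pos h]
  exact h.choose_spec

theorem IsFourierDensity.hat_ae_eq (h : IsFourierDensity T φ) : hat T =ᵐ[volume] φ :=
  (isFourierDensity_hat ⟨φ, h⟩).ae_eq h

theorem IsFourierDensity.congr (h : IsFourierDensity T φ) (e : φ =ᵐ[volume] φ') :
    IsFourierDensity T φ' := by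
  refine ⟨h.1.congr e, fun ψ => ?_⟩
  have e' : (fun ξ => ψ ξ * φ ((2 * Real.pi) • ξ)) =ᵐ[volume]
      fun ξ => ψ ξ * φ' ((2 * Real.pi) • ξ) := by
    filter_upwards [ae_dilate e] with ξ hξ
    rw [hξ]
  exact ⟨(h.2 ψ).1.congr e', (h.2 ψ).2.trans (integral_congr_ae e')⟩

theorem IsFourierDensity.sub (h : IsFourierDensity T φ) (h' : IsFourierDensity T' φ') :
    IsFourierDensity (T - T') (fun ξ => φ ξ - φ' ξ) := by
  refine ⟨h.1.sub h'.1, fun ψ => ?_⟩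
  have i := (h.2 ψ).1.sub (h'.2 ψ).1
  have e : (fun ξ => ψ ξ * (φ ((2 * Real.pi) • ξ) - φ' ((2 * Real.pi) • ξ))) =
      (fun ξ => ψ ξ * φ ((2 * Real.pi) • ξ)) - fun ξ => ψ ξ * φ' ((2 * Real.pi) • ξ) := by
    ext ξ
    simp [mul_sub]
  refine ⟨by rw [e]; exact i, ?_⟩
  have h3 : (𝓕 (T - T')) ψ = (𝓕 T) ψ - (𝓕 T') ψ := by
    simp only [TemperedDistribution.fourier_apply]
    rfl
  rw [h3, (h.2 ψ).2, (h'.2 ψ).2, e, ← integral_sub (h.2 ψ).1 (h'.2 ψ).1]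
  rfl

/-- A distribution is determined by its Fourier density. -/
theorem IsFourierDensity.unique (h : IsFourierDensity T φ) (h' : IsFourierDensity T' φ) :
    T = T' := by
  ext ψ
  have e := (h.2 (𝓕⁻ ψ)).2.trans (h'.2 (𝓕⁻ ψ)).2.symm
  simpa [TemperedDistribution.fourier_apply] using e

/-- A measurable function dominated by `‖ξ‖ ^ (-r)` with `0 ≤ r < d` is a Fourier density. -/
theorem exists_isFourierDensity {r K : ℝ} (hr : 0 ≤ r) (hrd : r < d)
    (hm : AEStronglyMeasurable φ volume) (hφ : ∀ᵐ ξ, ‖φ ξ‖ ≤ K * ‖ξ‖ ^ (-r)) :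
    ∃ T : 𝓢'(Space d, ℂ), IsFourierDensity T φ := by
  have hd : 1 ≤ Module.finrank ℝ (Space d) := by
    have : (0 : ℝ) < d := hr.trans_lt hrd
    rw [finrank_euclideanSpace_fin]
    exact_mod_cast this
  have hrd' : r < Module.finrank ℝ (Space d) := by rwa [finrank_euclideanSpace_fin]
  have hloc : LocallyIntegrable φ volume :=
    locallyIntegrable_of_norm_le_rpow hd hrd' hφ hm
  set g : Space d → ℂ := fun ξ => φ ((2 * Real.pi) • ξ) with hg
  have hgloc : LocallyIntegrable g volume := locallyIntegrable_dilate hloc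
  have hgm : AEStronglyMeasurable g volume := hgloc.aestronglyMeasurable
  -- Away from the origin the dilated density is bounded.
  have hgb : ∀ᵐ ξ : Space d, 1 ≤ ‖ξ‖ → ‖g ξ‖ ≤ |K| := by
    filter_upwards [ae_dilate hφ] with ξ hξ h1
    refine hξ.trans ?_
    have h2 : 1 ≤ ‖(2 * Real.pi) • ξ‖ := by
      rw [norm_smul, Real.norm_eq_abs, abs_of_pos (by positivity)]
      nlinarith [Real.pi_gt_three]
    have h3 : ‖(2 * Real.pi) • ξ‖ ^ (-r) ≤ 1 :=
      Real.rpow_le_one_of_one_le_of_nonpos h2 (by linarith)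
    calc K * ‖(2 * Real.pi) • ξ‖ ^ (-r) ≤ |K| * ‖(2 * Real.pi) • ξ‖ ^ (-r) := by
          gcongr
          exact le_abs_self K
      _ ≤ |K| * 1 := by gcongr
      _ = |K| := mul_one _
  have hint : Integrable (fun ξ : Space d => (1 + ‖ξ‖) ^ (-((d : ℝ) + 1)) * ‖g ξ‖) volume := by
    have hJ : Integrable (fun ξ : Space d => (1 + ‖ξ‖) ^ (-((d : ℝ) + 1))) volume := by
      apply integrable_one_add_norm
      rw [finrank_euclideanSpace_fin]
      linarith
    have hB : Integrable ((Metric.closedBall (0 : Space d) 1).indicator fun ξ => ‖g ξ‖) volume := by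
      rw [integrable_indicator_iff measurableSet_closedBall]
      exact (hgloc.integrableOn_isCompact (isCompact_closedBall 0 1)).norm
    refine (hB.add (hJ.mul_const |K|)).mono' ?_ ?_
    · exact hJ.aestronglyMeasurable.mul hgm.norm
    · filter_upwards [hgb] with ξ hξ
      have h1 : (0 : ℝ) ≤ (1 + ‖ξ‖) ^ (-((d : ℝ) + 1)) := by positivity
      have h2 : (1 + ‖ξ‖) ^ (-((d : ℝ) + 1)) ≤ 1 :=
        Real.rpow_le_one_of_one_le_of_nonpos (by linarith [norm_nonneg ξ]) (by
          have : (0 : ℝ) ≤ d := by positivity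
          linarith)
      rw [Real.norm_eq_abs, abs_of_nonneg (by positivity), Pi.add_apply]
      by_cases hx : ξ ∈ Metric.closedBall (0 : Space d) 1
      · rw [Set.indicator_of_mem hx]
        have : (1 + ‖ξ‖) ^ (-((d : ℝ) + 1)) * ‖g ξ‖ ≤ 1 * ‖g ξ‖ := by gcongr
        have : 0 ≤ (1 + ‖ξ‖) ^ (-((d : ℝ) + 1)) * |K| := by positivity
        linarith
      · rw [Set.indicator_of_notMem hx, zero_add]
        have : 1 ≤ ‖ξ‖ := by
          simp only [Metric.mem_closedBall, dist_zero_right, not_le] at hx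
          exact hx.le
        gcongr
        exact hξ this
  have hψ : ∀ (ψ : 𝓢(Space d, ℂ)) (ξ : Space d), ‖ψ ξ‖ ≤ (1 + ‖ξ‖) ^ (-((d : ℝ) + 1)) *
      (2 ^ (d + 1) * ((Finset.Iic (d + 1, 0)).sup
        (fun m => SchwartzMap.seminorm ℂ m.1 m.2) ψ)) := by
    intro ψ ξ
    rw [Real.rpow_neg (by positivity), ← div_eq_inv_mul, le_div_iff₀' (by positivity)]
    have e : (1 + ‖ξ‖) ^ ((d : ℝ) + 1) = (1 + ‖ξ‖) ^ (d + 1) := by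
      rw [← Real.rpow_natCast]; push_cast; rfl
    rw [e]
    simpa using SchwartzMap.one_add_le_sup_seminorm_apply (𝕜 := ℂ) (m := (d + 1, 0)) (k := d + 1)
      (n := 0) le_rfl le_rfl ψ ξ
  have hψg : ∀ ψ : 𝓢(Space d, ℂ), ∀ ξ, ‖ψ ξ * g ξ‖ ≤
      (1 + ‖ξ‖) ^ (-((d : ℝ) + 1)) * ‖g ξ‖ * (2 ^ (d + 1) * ((Finset.Iic (d + 1, 0)).sup
        (fun m => SchwartzMap.seminorm ℂ m.1 m.2) ψ)) := by
    intro ψ ξ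
    rw [norm_mul]
    calc _ ≤ _ := mul_le_mul_of_nonneg_right (hψ ψ ξ) (norm_nonneg (g ξ))
      _ = _ := by ring
  have hψi : ∀ ψ : 𝓢(Space d, ℂ), Integrable (fun ξ => ψ ξ * g ξ) volume := fun ψ =>
    (hint.mul_const _).mono' (ψ.continuous.aestronglyMeasurable.mul hgm)
      (ae_of_all _ (hψg ψ))
  let A : 𝓢(Space d, ℂ) →L[ℂ] ℂ := SchwartzMap.mkCLMtoNormedSpace (fun ψ => ∫ ξ, ψ ξ * g ξ)
    (fun f h => by
      rw [← integral_add (hψi f) (hψi h)]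
      simp [add_mul])
    (fun c f => by
      rw [RingHom.id_apply, smul_eq_mul, ← integral_const_mul]
      simp [mul_assoc])
    ⟨Finset.Iic (d + 1, 0), 2 ^ (d + 1) *
        ∫ ξ : Space d, (1 + ‖ξ‖) ^ (-((d : ℝ) + 1)) * ‖g ξ‖, by positivity, fun ψ => by
      refine (norm_integral_le_of_norm_le (hint.mul_const _) (ae_of_all _ (hψg ψ))).trans ?_
      rw [integral_mul_const]
      apply le_of_eq
      unfold schwartzSeminormFamily
      ring⟩
  refine ⟨𝓕⁻ (ContinuousLinearMap.toPointwiseConvergenceCLM _ _ _ _ A), hloc,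
    fun ψ => ⟨hψi ψ, ?_⟩⟩
  rw [FourierTransform.fourier_fourierInv_eq]
  rfl

end FourierDensity

/-! ### Pointwise description of the pseudo-measure norms -/

section PseudoMeasure

variable {d : ℕ} {F : Type} [NormedAddCommGroup F]

lemma ae_ne_zero (hd : 0 < d) : ∀ᵐ ξ : Space d, ξ ≠ 0 := by
  have : Nonempty (Fin d) := ⟨⟨0, hd⟩⟩
  exact Measure.ae_ne volume 0

lemma pmNorm_le_iff {r K : ℝ} (hK : 0 ≤ K) {φ : Space d → F} :
    pmNorm r φ ≤ ENNReal.ofReal K ↔ ∀ᵐ ξ : Space d, ‖ξ‖ ^ r * ‖φ ξ‖ ≤ K := by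
  have hn : ∀ ξ : Space d, ‖‖ξ‖ ^ r * ‖φ ξ‖‖ = ‖ξ‖ ^ r * ‖φ ξ‖ := fun ξ => by
    rw [Real.norm_eq_abs, abs_of_nonneg (by positivity)]
  rw [pmNorm, eLpNorm_exponent_top]
  constructor
  · intro h
    filter_upwards [ae_le_eLpNormEssSup (μ := (volume : Measure (Space d)))
      (f := fun ξ => ‖ξ‖ ^ r * ‖φ ξ‖)] with ξ hξ
    have := hξ.trans h
    rwa [← ofReal_norm, ENNReal.ofReal_le_ofReal_iff hK, hn] at this
  · intro h
    refine eLpNormEssSup_le_of_ae_bound ?_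
    simpa only [hn] using h

/-- Membership in a ball of a pseudo-measure space as an almost everywhere upper bound. -/
lemma pmNorm_le_iff_le_rpow (hd : 0 < d) {r K : ℝ} (hK : 0 ≤ K) {φ : Space d → F} :
    pmNorm r φ ≤ ENNReal.ofReal K ↔ ∀ᵐ ξ : Space d, ‖φ ξ‖ ≤ K * ‖ξ‖ ^ (-r) := by
  rw [pmNorm_le_iff hK]
  have key : ∀ ξ : Space d, ξ ≠ 0 → (‖ξ‖ ^ r * ‖φ ξ‖ ≤ K ↔ ‖φ ξ‖ ≤ K * ‖ξ‖ ^ (-r)) := by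
    intro ξ hξ
    have hp : 0 < ‖ξ‖ := norm_pos_iff.2 hξ
    rw [Real.rpow_neg hp.le, ← div_eq_mul_inv, le_div_iff₀' (by positivity)]
  constructor
  · intro h
    filter_upwards [h, ae_ne_zero hd] with ξ h1 h2 using (key ξ h2).1 h1
  · intro h
    filter_upwards [h, ae_ne_zero hd] with ξ h1 h2 using (key ξ h2).2 h1

lemma pmNorm_congr {r : ℝ} {φ φ' : Space d → F} (h : φ =ᵐ[volume] φ') :
    pmNorm r φ = pmNorm r φ' := by
  refine eLpNorm_congr_ae ?_
  filter_upwards [h] with ξ hξ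
  rw [hξ]

lemma katoNorm_le_iff {p r K : ℝ} {φ : ℝ → Space d → F} :
    katoNorm p r φ ≤ ENNReal.ofReal K ↔
      ∀ t, 0 < t → pmNorm (r + 2 / p) (φ t) ≤ ENNReal.ofReal (K * t ^ (-(1 / p))) := by
  simp only [katoNorm, iSup_le_iff, Set.mem_Ioi]
  refine forall₂_congr fun t ht => ?_
  have hp : 0 < t ^ (1 / p) := Real.rpow_pos_of_pos ht _
  rw [Real.rpow_neg ht.le, ← div_eq_mul_inv, ENNReal.ofReal_div_of_pos hp,
    ENNReal.le_div_iff_mul_le (Or.inl (by simpa using hp)) (Or.inl ENNReal.ofReal_ne_top), mul_comm]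

end PseudoMeasure

/-! ### Real analyticity from exponential decay of the density -/

section Analytic

variable {d : ℕ}

/-- If `e^{δ‖ξ‖} g` is integrable for some `δ > 0`, then `𝓕 g` is real analytic: expanding
`e^{-2πi y·ξ}` under the integral sign gives a power series around every point, with radius of
convergence at least `δ / (2π)`. -/
theorem analyticOnNhd_fourier {g : Space d → ℂ} {δ : ℝ} (hδ : 0 < δ)
    (hg : Integrable (fun ξ => Real.exp (δ * ‖ξ‖) * ‖g ξ‖) volume)
    (hgm : AEStronglyMeasurable g volume) :
    AnalyticOnNhd ℝ (𝓕 g) Set.univ := by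
  intro x _
  set L : Space d →L[ℝ] Space d →L[ℝ] ℝ := innerSL ℝ with hL
  have hLa : ∀ ξ y, L ξ y = inner ℝ ξ y := fun _ _ => rfl
  have hL1 : ‖L‖ ≤ 1 := norm_innerSL_le _
  set G : Space d → ℂ := fun ξ => (𝐞 (-inner ℝ ξ x) : ℂ) * g ξ with hG
  have hGn : ∀ ξ, ‖G ξ‖ = ‖g ξ‖ := fun ξ => by
    rw [hG, norm_mul, Circle.norm_coe, one_mul]
  have hGm : AEStronglyMeasurable G volume := by
    refine AEStronglyMeasurable.mul (Continuous.aestronglyMeasurable ?_) hgm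
    exact continuous_induced_dom.comp (Real.continuous_fourierChar.comp (by fun_prop))
  set I := ∫ ξ, Real.exp (δ * ‖ξ‖) * ‖g ξ‖ with hI
  have hI0 : 0 ≤ I := integral_nonneg fun ξ => by positivity
  -- `s ^ n / n! ≤ e^s` controls the moments of `g`.
  have hexp : ∀ (n : ℕ) (ξ : Space d), ‖ξ‖ ^ n ≤ n.factorial / δ ^ n * Real.exp (δ * ‖ξ‖) := by
    intro n ξ
    have := Real.pow_div_factorial_le_exp (δ * ‖ξ‖) (by positivity) n
    rw [mul_pow, div_le_iff₀ (by positivity)] at this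
    rw [div_mul_eq_mul_div, le_div_iff₀ (by positivity)]
    linarith
  have hmom : ∀ n : ℕ, Integrable (fun ξ => ‖ξ‖ ^ n * ‖G ξ‖) volume := by
    intro n
    refine (hg.const_mul (n.factorial / δ ^ n)).mono' ?_ (ae_of_all _ fun ξ => ?_)
    · exact (by fun_prop : Continuous fun ξ : Space d => ‖ξ‖ ^ n).aestronglyMeasurable.mul hGm.norm
    · rw [Real.norm_eq_abs, abs_of_nonneg (by positivity), hGn, ← mul_assoc]
      gcongr
      exact hexp n ξ
  have hmomI : ∀ n : ℕ, ∫ ξ, ‖ξ‖ ^ n * ‖G ξ‖ ≤ n.factorial / δ ^ n * I := by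
    intro n
    rw [hI, ← integral_const_mul]
    refine integral_mono (hmom n) (hg.const_mul _) fun ξ => ?_
    simp only [hGn]
    rw [← mul_assoc]
    gcongr
    exact hexp n ξ
  set q : FormalMultilinearSeries ℝ (Space d) ℂ := fun n =>
    ((n.factorial : ℝ)⁻¹) • ∫ ξ, VectorFourier.fourierPowSMulRight L G ξ n with hq
  have hqi : ∀ n : ℕ, Integrable (fun ξ => VectorFourier.fourierPowSMulRight L G ξ n) volume :=
    fun n => VectorFourier.integrable_fourierPowSMulRight L (hmom n) hGm
  set ρ : ℝ := δ / (2 * Real.pi) with hρ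
  have hρ0 : 0 < ρ := by positivity
  have hqn : ∀ n : ℕ, ‖q n‖ * ρ ^ n ≤ I := by
    intro n
    have h1 : ‖∫ ξ, VectorFourier.fourierPowSMulRight L G ξ n‖ ≤
        (2 * Real.pi) ^ n * (n.factorial / δ ^ n * I) := by
      calc _ ≤ ∫ ξ, (2 * Real.pi) ^ n * (‖ξ‖ ^ n * ‖G ξ‖) := by
            refine norm_integral_le_of_norm_le ((hmom n).const_mul _) (ae_of_all _ fun ξ => ?_)
            refine (VectorFourier.norm_fourierPowSMulRight_le L G ξ n).trans ?_
            rw [mul_assoc]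
            have : 2 * Real.pi * ‖L‖ ≤ 2 * Real.pi := mul_le_of_le_one_right (by positivity) hL1
            gcongr
        _ ≤ _ := by
            rw [integral_const_mul]
            gcongr
            exact hmomI n
    rw [hq, norm_smul, norm_inv, Real.norm_natCast]
    calc (n.factorial : ℝ)⁻¹ * ‖∫ ξ, VectorFourier.fourierPowSMulRight L G ξ n‖ * ρ ^ n ≤
        (n.factorial : ℝ)⁻¹ * ((2 * Real.pi) ^ n * (n.factorial / δ ^ n * I)) * ρ ^ n := by gcongr
      _ = I := by
        have : (n.factorial : ℝ) ≠ 0 := by positivity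
        rw [hρ, div_pow]
        field_simp
  refine HasFPowerSeriesOnBall.analyticAt (p := q) (r := ENNReal.ofReal ρ)
    ⟨?_, by simpa using hρ0, ?_⟩
  · refine FormalMultilinearSeries.le_radius_of_bound q I (r := ρ.toNNReal) fun n => ?_
    rw [Real.coe_toNNReal _ hρ0.le]
    exact hqn n
  · intro y hy
    have hy' : ‖y‖ < ρ := by
      rw [Metric.mem_eball, edist_zero_right, ← ofReal_norm,
        ENNReal.ofReal_lt_ofReal_iff hρ0] at hy
      exact hy
    set z : Space d → ℂ := fun ξ => -(2 * Real.pi * Complex.I) * (inner ℝ ξ y : ℝ) with hz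
    have hterm : ∀ n : ℕ, (q n fun _ => y) = ∫ ξ, z ξ ^ n / n.factorial * G ξ := by
      intro n
      rw [hq]
      simp only [smul_apply]
      rw [ContinuousMultilinearMap.integral_apply (hqi n), ← integral_smul]
      refine integral_congr_ae (ae_of_all _ fun ξ => ?_)
      simp only [VectorFourier.fourierPowSMulRight_apply, hz, hLa,
        Finset.prod_const, Finset.card_univ, Fintype.card_fin, Complex.real_smul, smul_eq_mul,
        mul_pow]
      push_cast
      ring
    have hzn : ∀ (n : ℕ) (ξ : Space d), ‖z ξ ^ n / n.factorial * G ξ‖ ≤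
        (2 * Real.pi * ‖y‖) ^ n / n.factorial * (‖ξ‖ ^ n * ‖G ξ‖) := by
      intro n ξ
      rw [norm_mul, norm_div, norm_pow, Complex.norm_natCast]
      have : ‖z ξ‖ ≤ 2 * Real.pi * (‖ξ‖ * ‖y‖) := by
        simp only [hz, norm_mul, norm_neg, Complex.norm_I, Complex.norm_real, Complex.norm_two,
          Real.norm_eq_abs, abs_of_pos Real.pi_pos, mul_one]
        gcongr
        exact abs_real_inner_le_norm ξ y
      calc ‖z ξ‖ ^ n / n.factorial * ‖G ξ‖ ≤
          (2 * Real.pi * (‖ξ‖ * ‖y‖)) ^ n / n.factorial * ‖G ξ‖ := by gcongr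
        _ = _ := by ring
    have hzi : ∀ n : ℕ, Integrable (fun ξ => z ξ ^ n / n.factorial * G ξ) volume := by
      intro n
      refine ((hmom n).const_mul _).mono' ?_ (ae_of_all _ (hzn n))
      refine AEStronglyMeasurable.mul (Continuous.aestronglyMeasurable ?_) hGm
      simp only [hz]
      fun_prop
    have hsum : Summable fun n : ℕ => ∫ ξ, ‖z ξ ^ n / n.factorial * G ξ‖ := by
      have hr : ‖y‖ / ρ < 1 := (div_lt_one hρ0).2 hy'
      refine Summable.of_nonneg_of_le (fun n => integral_nonneg fun ξ => norm_nonneg _)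
        (fun n => ?_)
        ((summable_geometric_of_lt_one (by positivity) hr).mul_right I)
      calc ∫ ξ, ‖z ξ ^ n / n.factorial * G ξ‖ ≤
          ∫ ξ, (2 * Real.pi * ‖y‖) ^ n / n.factorial * (‖ξ‖ ^ n * ‖G ξ‖) :=
            integral_mono (hzi n).norm ((hmom n).const_mul _) (hzn n)
        _ ≤ (2 * Real.pi * ‖y‖) ^ n / n.factorial * (n.factorial / δ ^ n * I) := by
            rw [integral_const_mul]
            gcongr
            exact hmomI n
        _ = (‖y‖ / ρ) ^ n * I := by
            have : (n.factorial : ℝ) ≠ 0 := by positivity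
            rw [hρ, div_pow, div_pow, mul_pow]
            field_simp
    have key := hasSum_integral_of_summable_integral_norm hzi hsum
    have hval : ∫ ξ, ∑' n : ℕ, z ξ ^ n / n.factorial * G ξ = 𝓕 g (x + y) := by
      rw [Real.fourier_eq]
      refine integral_congr_ae (ae_of_all _ fun ξ => ?_)
      simp only
      rw [tsum_mul_right, ← congrFun (NormedSpace.exp_eq_tsum_div (𝔸 := ℂ)) (z ξ),
        ← Complex.exp_eq_exp_ℂ, hG, hz, Circle.smul_def, smul_eq_mul, ← mul_assoc]
      congr 1
      rw [Real.fourierChar_apply, Real.fourierChar_apply, ← Complex.exp_add, inner_add_right]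
      congr 1
      push_cast
      ring
    rw [hval] at key
    simpa only [hterm] using key

/-- A tempered distribution whose density decays exponentially is a real analytic function, namely
the inverse Fourier transform of its density. -/
theorem IsFourierDensity.isRealAnalytic {T : 𝓢'(Space d, ℂ)} {φ : Space d → ℂ} {δ : ℝ}
    (hT : IsFourierDensity T φ) (hδ : 0 < δ)
    (hφ : Integrable (fun ξ => Real.exp (δ * ‖ξ‖) * ‖φ ξ‖) volume) : IsRealAnalytic T := by
  set g : Space d → ℂ := fun ξ => φ ((2 * Real.pi) • ξ) with hg
  have hgm : AEStronglyMeasurable g volume := (locallyIntegrable_dilate hT.1).aestronglyMeasurable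
  have hgi : Integrable (fun ξ => Real.exp (δ * (2 * Real.pi) * ‖ξ‖) * ‖g ξ‖) volume := by
    have := (MeasureTheory.integrable_comp_smul_iff volume _ two_pi_ne_zero).2 hφ
    refine this.congr (ae_of_all _ fun ξ => ?_)
    simp only [hg, norm_smul, Real.norm_eq_abs, abs_of_pos Real.two_pi_pos, mul_assoc]
  have hgi' : Integrable g volume := by
    refine hgi.mono hgm (ae_of_all _ fun ξ => ?_)
    rw [norm_mul, norm_norm, Real.norm_eq_abs, Real.abs_exp]
    exact le_mul_of_one_le_left (norm_nonneg _) (Real.one_le_exp (by positivity))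
  refine ⟨𝓕⁻ g, ?_, fun ψ _ => ?_⟩
  · have h1 := analyticOnNhd_fourier (by positivity) hgi hgm
    have h2 : 𝓕⁻ g = (𝓕 g) ∘ fun x => -x := by
      ext x
      exact Real.fourierInv_eq_fourier_neg g x
    rw [h2]
    exact h1.comp (t := Set.univ) (analyticOnNhd_id.neg) (Set.mapsTo_univ _ _)
  · have h1 := (hT.2 (𝓕⁻ ψ)).2
    rw [TemperedDistribution.fourier_apply, FourierTransform.fourier_fourierInv_eq] at h1
    rw [h1]
    have h2 := VectorFourier.integral_fourierIntegral_smul_eq_flip (e := 𝐞) (μ := volume)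
      (ν := volume) (L := -innerₗ (Space d)) (f := ψ) (g := g) Real.continuous_fourierChar
      (by simp only [LinearMap.neg_apply, innerₗ_apply_apply]; fun_prop) ψ.integrable hgi'
    simp only [smul_eq_mul] at h2
    have e1 : ∀ ξ, VectorFourier.fourierIntegral 𝐞 volume (-innerₗ (Space d)) ψ ξ = (𝓕⁻ ψ) ξ := by
      intro ξ
      rw [SchwartzMap.fourierInv_coe, Real.fourierInv_eq, VectorFourier.fourierIntegral]
      simp
    have e2 : ∀ ξ, VectorFourier.fourierIntegral 𝐞 volume (-innerₗ (Space d)).flip g ξ =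
        (𝓕⁻ g) ξ := by
      intro ξ
      rw [Real.fourierInv_eq, VectorFourier.fourierIntegral]
      simp [real_inner_comm]
    simpa only [e1, e2] using h2

end Analytic

/-! ### The pointwise norm of the triple `(a, |D|a, u)` -/

section TripleNorm

variable {d : ℕ}

/-- The linear map `w ↦ (‖ξ‖ w₀, w₀, w₁, …, w_d)`, whose Euclidean norm is `tripleNorm ξ w`; the
first coordinate is indexed by `none`. -/
noncomputable def tripleMap (ξ : Space d) :
    (Unit ⊕ Fin d → ℂ) →L[ℂ] EuclideanSpace ℂ (Option (Unit ⊕ Fin d)) :=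
  LinearMap.toContinuousLinearMap
    { toFun := fun w => WithLp.toLp 2 fun i => Option.elim i ((‖ξ‖ : ℂ) * w (Sum.inl ())) w
      map_add' := fun w w' => by
        ext i
        cases i <;> simp [mul_add]
      map_smul' := fun c w => by
        ext i
        cases i <;> simp [mul_left_comm] }

lemma norm_tripleMap (ξ : Space d) (w : Unit ⊕ Fin d → ℂ) :
    ‖tripleMap ξ w‖ = tripleNorm ξ w := by
  rw [EuclideanSpace.norm_eq, tripleNorm]
  congr 1
  simp [tripleMap, Fintype.sum_option, mul_pow]
  ring

lemma tripleNorm_nonneg (ξ : Space d) (w : Unit ⊕ Fin d → ℂ) : 0 ≤ tripleNorm ξ w :=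
  Real.sqrt_nonneg _

lemma tripleNorm_sq (ξ : Space d) (w : Unit ⊕ Fin d → ℂ) :
    tripleNorm ξ w ^ 2 = ‖w (Sum.inl ())‖ ^ 2 + (‖ξ‖ * ‖w (Sum.inl ())‖) ^ 2 +
      ∑ k, ‖w (Sum.inr k)‖ ^ 2 :=
  Real.sq_sqrt (by positivity)

@[simp]
lemma tripleNorm_zero (ξ : Space d) : tripleNorm ξ (0 : Unit ⊕ Fin d → ℂ) = 0 := by
  simp [← norm_tripleMap]

lemma tripleNorm_add_le (ξ : Space d) (w w' : Unit ⊕ Fin d → ℂ) :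
    tripleNorm ξ (w + w') ≤ tripleNorm ξ w + tripleNorm ξ w' := by
  simpa [← norm_tripleMap] using norm_add_le (tripleMap ξ w) (tripleMap ξ w')

lemma tripleNorm_sub_le (ξ : Space d) (w w' : Unit ⊕ Fin d → ℂ) :
    tripleNorm ξ (w - w') ≤ tripleNorm ξ w + tripleNorm ξ w' := by
  simpa [← norm_tripleMap] using norm_sub_le (tripleMap ξ w) (tripleMap ξ w')

lemma norm_apply_le_tripleNorm (ξ : Space d) (w : Unit ⊕ Fin d → ℂ) (i : Unit ⊕ Fin d) :
    ‖w i‖ ≤ tripleNorm ξ w := by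
  rw [← norm_tripleMap]
  exact PiLp.norm_apply_le (tripleMap ξ w) (some i)

lemma norm_mul_apply_le_tripleNorm (ξ : Space d) (w : Unit ⊕ Fin d → ℂ) :
    ‖ξ‖ * ‖w (Sum.inl ())‖ ≤ tripleNorm ξ w := by
  rw [← norm_tripleMap]
  have := PiLp.norm_apply_le (tripleMap ξ w) none
  simpa [tripleMap] using this

lemma norm_toLp_inr_le_tripleNorm (ξ : Space d) (w : Unit ⊕ Fin d → ℂ) :
    ‖(WithLp.toLp 2 fun k => w (Sum.inr k) : EuclideanSpace ℂ (Fin d))‖ ≤ tripleNorm ξ w := by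
  rw [EuclideanSpace.norm_eq]
  exact Real.sqrt_le_sqrt (le_add_of_nonneg_left (by positivity))

lemma norm_le_tripleNorm (ξ : Space d) (w : Unit ⊕ Fin d → ℂ) : ‖w‖ ≤ tripleNorm ξ w :=
  (pi_norm_le_iff_of_nonneg (tripleNorm_nonneg ξ w)).2 (norm_apply_le_tripleNorm ξ w)

lemma tripleNorm_le_add (ξ : Space d) (w : Unit ⊕ Fin d → ℂ) :
    tripleNorm ξ w ≤ ‖w (Sum.inl ())‖ + ‖ξ‖ * ‖w (Sum.inl ())‖ +
      ‖(WithLp.toLp 2 fun k => w (Sum.inr k) : EuclideanSpace ℂ (Fin d))‖ := by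
  refine Real.sqrt_le_iff.2 ⟨by positivity, ?_⟩
  have h : ‖(WithLp.toLp 2 fun k => w (Sum.inr k) : EuclideanSpace ℂ (Fin d))‖ ^ 2 =
      ∑ k, ‖w (Sum.inr k)‖ ^ 2 := by simp [EuclideanSpace.norm_sq_eq]
  rw [← h]
  have h1 := norm_nonneg (w (Sum.inl ()))
  have h2 := mul_nonneg (norm_nonneg ξ) h1
  have h3 := norm_nonneg (WithLp.toLp 2 fun k => w (Sum.inr k) : EuclideanSpace ℂ (Fin d))
  nlinarith [mul_nonneg h1 h2, mul_nonneg h1 h3, mul_nonneg h2 h3]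

lemma tripleNorm_le_sum (ξ : Space d) (w : Unit ⊕ Fin d → ℂ) :
    tripleNorm ξ w ≤ ‖w (Sum.inl ())‖ + ‖ξ‖ * ‖w (Sum.inl ())‖ + ∑ k, ‖w (Sum.inr k)‖ := by
  refine (tripleNorm_le_add ξ w).trans (add_le_add le_rfl ?_)
  rw [EuclideanSpace.norm_eq]
  exact Real.sqrt_le_iff.2 ⟨by positivity,
    Finset.sum_sq_le_sq_sum_of_nonneg fun k _ => norm_nonneg _⟩

lemma measurable_tripleNorm :
    Measurable fun z : Space d × (Unit ⊕ Fin d → ℂ) => tripleNorm z.1 z.2 := by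
  unfold tripleNorm
  fun_prop

end TripleNorm

/-! ### The linear semigroup -/

section Semigroup

variable {d : ℕ} {μ ν κ α : ℝ}

lemma symbol_mulVec_inl (ξ : Space d) (w : Unit ⊕ Fin d → ℂ) :
    (symbol μ ν κ α ξ *ᵥ w) (Sum.inl ()) = Complex.I * ∑ k, (ξ k : ℂ) * w (Sum.inr k) := by
  simp [symbol, Matrix.mulVec, dotProduct, Finset.mul_sum, mul_assoc]

lemma symbol_mulVec_inr (ξ : Space d) (w : Unit ⊕ Fin d → ℂ) (j : Fin d) :
    (symbol μ ν κ α ξ *ᵥ w) (Sum.inr j) =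
      Complex.I * (((α + κ * ‖ξ‖ ^ 2) * ξ j : ℝ) : ℂ) * w (Sum.inl ()) +
        ((μ * ‖ξ‖ ^ 2 : ℝ) : ℂ) * w (Sum.inr j) +
        (((μ + ν) * ξ j : ℝ) : ℂ) * ∑ k, (ξ k : ℂ) * w (Sum.inr k) := by
  simp only [symbol, Matrix.mulVec, dotProduct, Fintype.sum_sum_type, Matrix.fromBlocks_apply₂₁,
    Matrix.fromBlocks_apply₂₂, Matrix.of_apply, Finset.univ_unique, Finset.sum_singleton]
  have : ∀ k, (((if j = k then μ * ‖ξ‖ ^ 2 else 0) + (μ + ν) * ξ j * ξ k : ℝ) : ℂ) * w (Sum.inr k) =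
      (if j = k then ((μ * ‖ξ‖ ^ 2 : ℝ) : ℂ) * w (Sum.inr j) else 0) +
        (((μ + ν) * ξ j : ℝ) : ℂ) * ((ξ k : ℂ) * w (Sum.inr k)) := by
    intro k
    split_ifs with h
    · subst h
      push_cast
      ring
    · push_cast
      ring
  simp only [this, Finset.sum_add_distrib, Finset.sum_ite_eq, Finset.mem_univ, if_true,
    Finset.mul_sum]
  rw [show (default : Unit) = () from rfl]
  push_cast
  ring

lemma continuous_symbol : Continuous (symbol μ ν κ α : Space d → _) := by
  unfold symbol
  refine Continuous.matrix_fromBlocks continuous_const ?_ ?_ ?_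
  · refine continuous_matrix fun i j => ?_
    simp only [Matrix.of_apply]
    fun_prop
  · refine continuous_matrix fun i j => ?_
    simp only [Matrix.of_apply]
    fun_prop
  · refine continuous_matrix fun i j => ?_
    simp only [Matrix.of_apply]
    split_ifs <;> fun_prop

open scoped Matrix.Norms.Operator in
lemma continuous_semigroup :
    Continuous fun z : ℝ × Space d => semigroup μ ν κ α z.1 z.2 := by
  unfold semigroup
  refine NormedSpace.exp_continuous.comp ?_
  exact (by fun_prop : Continuous fun z : ℝ × Space d => ((-z.1 : ℝ) : ℂ)).smul
    (continuous_symbol.comp continuous_snd)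

lemma semigroup_zero (ξ : Space d) : semigroup μ ν κ α 0 ξ = 1 := by
  simp [semigroup, NormedSpace.exp_zero]

lemma semigroup_add (s t : ℝ) (ξ : Space d) :
    semigroup μ ν κ α (s + t) ξ = semigroup μ ν κ α s ξ * semigroup μ ν κ α t ξ := by
  unfold semigroup
  rw [← Matrix.exp_add_of_commute _ _ (((Commute.refl _).smul_left _).smul_right _), ← add_smul]
  push_cast
  ring_nf

open scoped Matrix.Norms.Operator in
lemma hasDerivAt_semigroup_mulVec (ξ : Space d) (w : Unit ⊕ Fin d → ℂ) (t : ℝ) :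
    HasDerivAt (fun t => semigroup μ ν κ α t ξ *ᵥ w)
      (-(symbol μ ν κ α ξ *ᵥ (semigroup μ ν κ α t ξ *ᵥ w))) t := by
  have e : ∀ t : ℝ, NormedSpace.exp (t • -symbol μ ν κ α ξ) = semigroup μ ν κ α t ξ := by
    intro t
    rw [semigroup]
    congr 1
    ext i j
    simp
  have h : HasDerivAt (fun u : ℝ => semigroup μ ν κ α u ξ)
      (-symbol μ ν κ α ξ * semigroup μ ν κ α t ξ) t := by
    rw [← e t, show (fun u : ℝ => semigroup μ ν κ α u ξ) =
      fun u => NormedSpace.exp (u • -symbol μ ν κ α ξ) from funext fun u => (e u).symm]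
    exact hasDerivAt_exp_smul_const' (𝕂 := ℝ) (-symbol μ ν κ α ξ) t
  let Λ : Matrix (Unit ⊕ Fin d) (Unit ⊕ Fin d) ℂ →L[ℝ] (Unit ⊕ Fin d → ℂ) :=
    LinearMap.toContinuousLinearMap
      { toFun := fun M => M *ᵥ w
        map_add' := fun M N => Matrix.add_mulVec M N w
        map_smul' := fun c M => Matrix.smul_mulVec c M w }
  have h2 := Λ.hasFDerivAt.comp_hasDerivAt t h
  have e2 : Λ (-symbol μ ν κ α ξ * semigroup μ ν κ α t ξ) =
      -(symbol μ ν κ α ξ *ᵥ (semigroup μ ν κ α t ξ *ᵥ w)) := by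
    change (-symbol μ ν κ α ξ * semigroup μ ν κ α t ξ) *ᵥ w = _
    rw [← Matrix.mulVec_mulVec, Matrix.neg_mulVec]
  exact h2.congr_deriv e2

end Semigroup

/-! ### Parabolic decay of the linear semigroup -/

section Decay

variable {d : ℕ} {μ ν κ α : ℝ}

/-- The divergence symbol `ξ·w` of the velocity part. -/
noncomputable def divPart (ξ : Space d) (w : Unit ⊕ Fin d → ℂ) : ℂ := ∑ k, (ξ k : ℂ) * w (Sum.inr k)

/-- The Lyapunov functional `(α + κ‖ξ‖²)|w₀|² + |w'|² + 2δ Re(i w₀ conj(ξ·w'))` of the linearized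
system, written with real and imaginary parts. -/
noncomputable def lyapunov (κ α δ : ℝ) (ξ : Space d) (w : Unit ⊕ Fin d → ℂ) : ℝ :=
  (α + κ * ‖ξ‖ ^ 2) * ((w (Sum.inl ())).re ^ 2 + (w (Sum.inl ())).im ^ 2) +
    ∑ k, ((w (Sum.inr k)).re ^ 2 + (w (Sum.inr k)).im ^ 2) +
    2 * δ * ((w (Sum.inl ())).re * (divPart ξ w).im - (w (Sum.inl ())).im * (divPart ξ w).re)

lemma norm_divPart_sq_le (ξ : Space d) (w : Unit ⊕ Fin d → ℂ) :
    (divPart ξ w).re ^ 2 + (divPart ξ w).im ^ 2 ≤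
      ‖ξ‖ ^ 2 * ∑ k, ((w (Sum.inr k)).re ^ 2 + (w (Sum.inr k)).im ^ 2) := by
  have h1 : ∀ z : ℂ, z.re ^ 2 + z.im ^ 2 = ‖z‖ ^ 2 := fun z => by
    rw [Complex.sq_norm, Complex.normSq_apply]; ring
  simp only [h1]
  have h2 : ‖divPart ξ w‖ ≤ ∑ k, |ξ k| * ‖w (Sum.inr k)‖ := by
    refine (norm_sum_le _ _).trans (Finset.sum_le_sum fun k _ => ?_)
    rw [norm_mul, Complex.norm_real, Real.norm_eq_abs]
  calc ‖divPart ξ w‖ ^ 2 ≤ (∑ k, |ξ k| * ‖w (Sum.inr k)‖) ^ 2 := by gcongr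
    _ ≤ (∑ k, |ξ k| ^ 2) * ∑ k, ‖w (Sum.inr k)‖ ^ 2 := Finset.sum_mul_sq_le_sq_mul_sq _ _ _
    _ = _ := by
        rw [EuclideanSpace.norm_sq_eq]
        simp

/-- The cross term of the Lyapunov functional is dominated by the energy. -/
lemma cross_sq_le (hκ : 0 < κ) (hα : 0 < α) {r a b v v' U : ℝ}
    (hV : v ^ 2 + v' ^ 2 ≤ r ^ 2 * U) (hU : 0 ≤ U) :
    κ * (a * v' - b * v) ^ 2 ≤ (α + κ * r ^ 2) * (a ^ 2 + b ^ 2) * U := by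
  have h1 : (a * v' - b * v) ^ 2 ≤ (a ^ 2 + b ^ 2) * (v ^ 2 + v' ^ 2) := by
    linarith [sq_nonneg (a * v + b * v')]
  have h2 : (a ^ 2 + b ^ 2) * (v ^ 2 + v' ^ 2) ≤ (a ^ 2 + b ^ 2) * (r ^ 2 * U) := by gcongr
  have h3 : 0 ≤ α * ((a ^ 2 + b ^ 2) * U) := by positivity
  linarith [mul_le_mul_of_nonneg_left (h1.trans h2) hκ.le]

/-- Along the linear flow, `dL/dt ≤ -δ‖ξ‖² L` for the Lyapunov functional `L` with parameter
`δ`, provided `δ` is small with respect to the coefficients. Here `N = a² + b²`, `V = v² + v'²`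
and `U` stand for `|w₀|²`, `|ξ·w'|²` and `|w'|²`. -/
lemma lyapunov_dissipation (hμ : 0 < μ) (hμν : 0 < μ + ν) (hκ : 0 < κ) (hα : 0 < α) {δ : ℝ}
    (hδ : 0 < δ) (hδ1 : δ ≤ μ / 4) (hδ2 : δ * (2 * μ + ν) ^ 2 ≤ μ * κ) {r a b v v' U : ℝ}
    (hU : 0 ≤ U) (hV : v ^ 2 + v' ^ 2 ≤ r ^ 2 * U) :
    -2 * μ * r ^ 2 * U - 2 * (μ + ν) * (v ^ 2 + v' ^ 2) +
        2 * δ * ((v ^ 2 + v' ^ 2) - (α + κ * r ^ 2) * r ^ 2 * (a ^ 2 + b ^ 2) -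
          (2 * μ + ν) * r ^ 2 * (a * v' - b * v)) +
        δ * r ^ 2 * ((α + κ * r ^ 2) * (a ^ 2 + b ^ 2) + U + 2 * δ * (a * v' - b * v)) ≤ 0 := by
  set Y := (α + κ * r ^ 2) * (a ^ 2 + b ^ 2) with hY
  set P := a * v' - b * v with hP
  have hY0 : 0 ≤ Y := by positivity
  have hPsq : κ * P ^ 2 ≤ Y * U := cross_sq_le hκ hα hV hU
  set m := 2 * μ + ν - δ with hm
  have hm0 : 0 ≤ m := by linarith
  have hmle : m ≤ 2 * μ + ν := by linarith
  -- Young's inequality for the remaining cross term.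
  have hY1 : -(δ * m * P) ≤ μ / 2 * U + δ / 2 * Y := by
    have h1 : (δ * m * P) ^ 2 ≤ (μ / 2 * U + δ / 2 * Y) ^ 2 := by
      have h2 : δ * m ^ 2 ≤ μ * κ := by
        have : m ^ 2 ≤ (2 * μ + ν) ^ 2 := by gcongr
        linarith [mul_le_mul_of_nonneg_left this hδ.le]
      have h3 : δ * m ^ 2 * P ^ 2 ≤ μ * κ * P ^ 2 := by gcongr
      have h4 : μ * (κ * P ^ 2) ≤ μ * (Y * U) := by gcongr
      have h5 : (δ * m * P) ^ 2 ≤ δ * (μ * (Y * U)) := by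
        calc (δ * m * P) ^ 2 = δ * (δ * m ^ 2 * P ^ 2) := by ring
          _ ≤ δ * (μ * (Y * U)) := mul_le_mul_of_nonneg_left (by linarith) hδ.le
      linarith [sq_nonneg (μ / 2 * U - δ / 2 * Y)]
    have h6 := abs_le.1 (abs_le_of_sq_le_sq h1 (by positivity))
    linarith [h6.1]
  have hVd : (δ - (μ + ν)) * (v ^ 2 + v' ^ 2) ≤ δ * (r ^ 2 * U) := by
    have : 0 ≤ v ^ 2 + v' ^ 2 := by positivity
    linarith [mul_nonneg hμν.le this, mul_le_mul_of_nonneg_left hV hδ.le]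
  have h7 : 0 ≤ r ^ 2 * (μ / 2 * U + δ / 2 * Y + δ * m * P) := by
    have : 0 ≤ μ / 2 * U + δ / 2 * Y + δ * m * P := by linarith
    positivity
  have h8 : 0 ≤ r ^ 2 * U * (μ / 4 - δ) := by
    have : 0 ≤ μ / 4 - δ := by linarith
    positivity
  have h9 : 0 ≤ r ^ 2 * U * δ := by positivity
  have h10 : 0 ≤ r ^ 2 * U * μ := by positivity
  have hYr : (α + κ * r ^ 2) * r ^ 2 * (a ^ 2 + b ^ 2) = r ^ 2 * Y := by
    rw [hY]
    ring
  rw [hm] at h7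
  rw [hYr]
  linarith

lemma lyapunov_antitone (hμ : 0 < μ) (hμν : 0 < μ + ν) (hκ : 0 < κ) (hα : 0 < α) {δ : ℝ}
    (hδ : 0 < δ) (hδ1 : δ ≤ μ / 4) (hδ2 : δ * (2 * μ + ν) ^ 2 ≤ μ * κ) (ξ : Space d)
    (w : Unit ⊕ Fin d → ℂ) :
    Antitone fun t => Real.exp (δ * ‖ξ‖ ^ 2 * t) *
      lyapunov κ α δ ξ (semigroup μ ν κ α t ξ *ᵥ w) := by
  set x : ℝ → Unit ⊕ Fin d → ℂ := fun t => semigroup μ ν κ α t ξ *ᵥ w with hx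
  have hd : ∀ t i, HasDerivAt (fun t => x t i) (-((symbol μ ν κ α ξ *ᵥ x t) i)) t := fun t i =>
    hasDerivAt_pi.1 (hasDerivAt_semigroup_mulVec ξ w t) i
  have hre : ∀ t i, HasDerivAt (fun t => (x t i).re) (-((symbol μ ν κ α ξ *ᵥ x t) i)).re t :=
    fun t i => Complex.reCLM.hasFDerivAt.comp_hasDerivAt t (hd t i)
  have him : ∀ t i, HasDerivAt (fun t => (x t i).im) (-((symbol μ ν κ α ξ *ᵥ x t) i)).im t :=
    fun t i => Complex.imCLM.hasFDerivAt.comp_hasDerivAt t (hd t i)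
  have hv : ∀ t, HasDerivAt (fun t => divPart ξ (x t)) (divPart ξ (-(symbol μ ν κ α ξ *ᵥ x t))) t :=
    fun t => HasDerivAt.fun_sum fun k _ => (hd t (Sum.inr k)).const_mul _
  have hvre : ∀ t, HasDerivAt (fun t => (divPart ξ (x t)).re)
      (divPart ξ (-(symbol μ ν κ α ξ *ᵥ x t))).re t :=
    fun t => Complex.reCLM.hasFDerivAt.comp_hasDerivAt t (hv t)
  have hvim : ∀ t, HasDerivAt (fun t => (divPart ξ (x t)).im)
      (divPart ξ (-(symbol μ ν κ α ξ *ᵥ x t))).im t :=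
    fun t => Complex.imCLM.hasFDerivAt.comp_hasDerivAt t (hv t)
  -- The factor `α + κ‖ξ‖²` is chosen so that the coupling of `w₀` and the velocity cancels in the
  -- derivative of the first two summands.
  have hL : ∀ t, HasDerivAt (fun t => lyapunov κ α δ ξ (x t))
      (-2 * μ * ‖ξ‖ ^ 2 * (∑ k, ((x t (Sum.inr k)).re ^ 2 + (x t (Sum.inr k)).im ^ 2)) -
        2 * (μ + ν) * ((divPart ξ (x t)).re ^ 2 + (divPart ξ (x t)).im ^ 2) +
        2 * δ * (((divPart ξ (x t)).re ^ 2 + (divPart ξ (x t)).im ^ 2) -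
          (α + κ * ‖ξ‖ ^ 2) * ‖ξ‖ ^ 2 * ((x t (Sum.inl ())).re ^ 2 + (x t (Sum.inl ())).im ^ 2) -
          (2 * μ + ν) * ‖ξ‖ ^ 2 * ((x t (Sum.inl ())).re * (divPart ξ (x t)).im -
            (x t (Sum.inl ())).im * (divPart ξ (x t)).re))) t := by
    intro t
    have h := (((((hre t (Sum.inl ())).fun_pow 2).fun_add
      ((him t (Sum.inl ())).fun_pow 2)).const_mul (α + κ * ‖ξ‖ ^ 2)).fun_add (HasDerivAt.fun_sum (u := Finset.univ) fun k _ =>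
        ((hre t (Sum.inr k)).fun_pow 2).fun_add ((him t (Sum.inr k)).fun_pow 2))).fun_add
      ((((hre t (Sum.inl ())).fun_mul (hvim t)).fun_sub
        ((him t (Sum.inl ())).fun_mul (hvre t))).const_mul (2 * δ))
    refine h.congr_deriv ?_
    set V := divPart ξ (x t) with hV
    set A := x t (Sum.inl ()) with hA
    have e0 : (symbol μ ν κ α ξ *ᵥ x t) (Sum.inl ()) = Complex.I * V := symbol_mulVec_inl ξ (x t)
    have ej : ∀ j, (symbol μ ν κ α ξ *ᵥ x t) (Sum.inr j) =
        Complex.I * (((α + κ * ‖ξ‖ ^ 2) * ξ j : ℝ) : ℂ) * A +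
        ((μ * ‖ξ‖ ^ 2 : ℝ) : ℂ) * x t (Sum.inr j) + (((μ + ν) * ξ j : ℝ) : ℂ) * V :=
      symbol_mulVec_inr ξ (x t)
    have hr2 : ∑ j, ((ξ j : ℝ) : ℂ) * ξ j = ((‖ξ‖ ^ 2 : ℝ) : ℂ) := by
      rw [EuclideanSpace.real_norm_sq_eq]
      push_cast
      simp only [sq]
    have ev : divPart ξ (-(symbol μ ν κ α ξ *ᵥ x t)) =
        -(Complex.I * (((α + κ * ‖ξ‖ ^ 2) * ‖ξ‖ ^ 2 : ℝ) : ℂ) * A +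
          (((2 * μ + ν) * ‖ξ‖ ^ 2 : ℝ) : ℂ) * V) := by
      have : ∀ j, (ξ j : ℂ) * (-(symbol μ ν κ α ξ *ᵥ x t)) (Sum.inr j) =
          -(Complex.I * ((α + κ * ‖ξ‖ ^ 2 : ℝ) : ℂ) * A + ((μ + ν : ℝ) : ℂ) * V) *
            ((ξ j : ℂ) * ξ j) - ((μ * ‖ξ‖ ^ 2 : ℝ) : ℂ) * ((ξ j : ℂ) * x t (Sum.inr j)) := by
        intro j
        rw [Pi.neg_apply, ej]
        push_cast
        ring
      rw [divPart, Finset.sum_congr rfl fun j _ => this j, Finset.sum_sub_distrib,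
        ← Finset.mul_sum, ← Finset.mul_sum, hr2, show ∑ j, (ξ j : ℂ) * x t (Sum.inr j) = V from rfl]
      push_cast
      ring
    have hVre : V.re = ∑ j, ξ j * (x t (Sum.inr j)).re := by
      rw [hV, divPart, Complex.re_sum]
      simp
    have hVim : V.im = ∑ j, ξ j * (x t (Sum.inr j)).im := by
      rw [hV, divPart, Complex.im_sum]
      simp
    have es : ∑ j, ((2 : ℕ) * (x t (Sum.inr j)).re ^ (2 - 1) *
          (-((symbol μ ν κ α ξ *ᵥ x t) (Sum.inr j))).re +
          (2 : ℕ) * (x t (Sum.inr j)).im ^ (2 - 1) *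
          (-((symbol μ ν κ α ξ *ᵥ x t) (Sum.inr j))).im) =
        2 * (α + κ * ‖ξ‖ ^ 2) * (A.im * V.re - A.re * V.im) -
        2 * μ * ‖ξ‖ ^ 2 * (∑ k, ((x t (Sum.inr k)).re ^ 2 + (x t (Sum.inr k)).im ^ 2)) -
        2 * (μ + ν) * (V.re * V.re + V.im * V.im) := by
      have : ∀ j, ((2 : ℕ) * (x t (Sum.inr j)).re ^ (2 - 1) *
          (-((symbol μ ν κ α ξ *ᵥ x t) (Sum.inr j))).re +
          (2 : ℕ) * (x t (Sum.inr j)).im ^ (2 - 1) *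
          (-((symbol μ ν κ α ξ *ᵥ x t) (Sum.inr j))).im : ℝ) =
          (2 * (α + κ * ‖ξ‖ ^ 2) * A.im - 2 * (μ + ν) * V.re) * (ξ j * (x t (Sum.inr j)).re) +
          (-(2 * (α + κ * ‖ξ‖ ^ 2) * A.re) - 2 * (μ + ν) * V.im) * (ξ j * (x t (Sum.inr j)).im) -
          2 * μ * ‖ξ‖ ^ 2 * ((x t (Sum.inr j)).re ^ 2 + (x t (Sum.inr j)).im ^ 2) := by
        intro j
        rw [ej]
        simp only [Complex.neg_re, Complex.neg_im, Complex.add_re, Complex.add_im, Complex.mul_re,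
          Complex.mul_im, Complex.I_re, Complex.I_im, Complex.ofReal_re, Complex.ofReal_im]
        push_cast
        ring
      rw [Finset.sum_congr rfl fun j _ => this j, Finset.sum_sub_distrib, Finset.sum_add_distrib,
        ← Finset.mul_sum, ← Finset.mul_sum, ← Finset.mul_sum, ← hVre, ← hVim]
      ring
    rw [es, ev, e0]
    simp only [Complex.neg_re, Complex.neg_im, Complex.add_re, Complex.add_im, Complex.mul_re,
      Complex.mul_im, Complex.I_re, Complex.I_im, Complex.ofReal_re, Complex.ofReal_im]
    push_cast
    ring
  have hE : ∀ t, HasDerivAt (fun t => Real.exp (δ * ‖ξ‖ ^ 2 * t))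
      (Real.exp (δ * ‖ξ‖ ^ 2 * t) * (δ * ‖ξ‖ ^ 2)) t := fun t => by
    simpa using ((hasDerivAt_id t).const_mul (δ * ‖ξ‖ ^ 2)).exp
  refine antitone_of_hasDerivAt_nonpos (fun t => (hE t).fun_mul (hL t)) fun t => ?_
  have := lyapunov_dissipation hμ hμν hκ hα hδ hδ1 hδ2 (a := (x t (Sum.inl ())).re)
    (b := (x t (Sum.inl ())).im) (Finset.sum_nonneg fun k _ => by positivity)
    (norm_divPart_sq_le ξ (x t))
  have hp := mul_nonpos_of_nonneg_of_nonpos (Real.exp_pos (δ * ‖ξ‖ ^ 2 * t)).le this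
  refine le_trans (le_of_eq ?_) hp
  change _ * _ * lyapunov κ α δ ξ (x t) + _ = _
  rw [lyapunov]
  ring

/-- The linear semigroup decays like the heat semigroup in the norm of the triple, with a rate and
a constant that do not depend on the dimension. -/
theorem exists_semigroup_decay (hμ : 0 < μ) (hμν : 0 < μ + ν) (hκ : 0 < κ) (hα : 0 < α) :
    ∃ c C : ℝ, 0 < c ∧ 0 < C ∧ ∀ (d : ℕ) (t : ℝ), 0 ≤ t →
      ∀ (ξ : Space d) (w : Unit ⊕ Fin d → ℂ),
        tripleNorm ξ (semigroup μ ν κ α t ξ *ᵥ w) ≤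
          C * Real.exp (-c * t * ‖ξ‖ ^ 2) * tripleNorm ξ w := by
  have hm : 0 < 2 * μ + ν := by linarith
  set δ := min (μ / 4) (min (μ * κ / (2 * μ + ν) ^ 2) (Real.sqrt κ / 2)) with hδ
  have hδ0 : 0 < δ := by positivity
  have hδ1 : δ ≤ μ / 4 := min_le_left _ _
  have hδ2 : δ * (2 * μ + ν) ^ 2 ≤ μ * κ :=
    (le_div_iff₀ (by positivity)).1 ((min_le_right _ _).trans (min_le_left _ _))
  have hδ3 : 4 * δ ^ 2 ≤ κ := by
    have h : δ ≤ Real.sqrt κ / 2 := (min_le_right _ _).trans (min_le_right _ _)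
    have : δ ^ 2 ≤ (Real.sqrt κ / 2) ^ 2 := by gcongr
    rw [div_pow, Real.sq_sqrt hκ.le] at this
    linarith
  set C₁ := max 1 (max α⁻¹ κ⁻¹) with hC₁
  set C₂ := max 1 (max α κ) with hC₂
  have hC₁0 : 0 < C₁ := by positivity
  have hC₂0 : 0 < C₂ := by positivity
  -- The Lyapunov functional is equivalent to the squared norm of the triple.
  have hnorm : ∀ z : ℂ, ‖z‖ ^ 2 = z.re ^ 2 + z.im ^ 2 := fun z => by
    rw [Complex.sq_norm, Complex.normSq_apply]; ring
  have hcmp : ∀ (d : ℕ) (ξ : Space d) (w : Unit ⊕ Fin d → ℂ),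
      tripleNorm ξ w ^ 2 ≤ 2 * C₁ * lyapunov κ α δ ξ w ∧
        2 * lyapunov κ α δ ξ w ≤ 3 * C₂ * tripleNorm ξ w ^ 2 := by
    intro d ξ w
    rw [tripleNorm_sq, mul_pow, hnorm, Finset.sum_congr rfl fun k _ => hnorm (w (Sum.inr k)),
      lyapunov]
    set N := (w (Sum.inl ())).re ^ 2 + (w (Sum.inl ())).im ^ 2 with hN
    set U := ∑ k, ((w (Sum.inr k)).re ^ 2 + (w (Sum.inr k)).im ^ 2) with hU
    have hU0 : 0 ≤ U := Finset.sum_nonneg fun k _ => by positivity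
    have hN0 : 0 ≤ N := by positivity
    have hP := cross_sq_le hκ hα (a := (w (Sum.inl ())).re) (b := (w (Sum.inl ())).im)
      (norm_divPart_sq_le ξ w) hU0
    set P := (w (Sum.inl ())).re * (divPart ξ w).im - (w (Sum.inl ())).im * (divPart ξ w).re
    set Y := (α + κ * ‖ξ‖ ^ 2) * N with hY
    have hY0 : 0 ≤ Y := by positivity
    have hP2 : (4 * δ * P) ^ 2 ≤ (Y + U) ^ 2 := by
      have : 4 * δ ^ 2 * P ^ 2 ≤ κ * P ^ 2 := by gcongr
      linarith [sq_nonneg (Y - U)]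
    have hP3 := abs_le.1 (abs_le_of_sq_le_sq hP2 (by positivity))
    have a1 : 1 ≤ C₁ := le_max_left _ _
    have a2 : 1 ≤ C₁ * α := by
      have : α⁻¹ ≤ C₁ := (le_max_left _ _).trans (le_max_right _ _)
      calc (1 : ℝ) = α⁻¹ * α := by field_simp
        _ ≤ C₁ * α := by gcongr
    have a3 : 1 ≤ C₁ * κ := by
      have : κ⁻¹ ≤ C₁ := (le_max_right _ _).trans (le_max_right _ _)
      calc (1 : ℝ) = κ⁻¹ * κ := by field_simp
        _ ≤ C₁ * κ := by gcongr
    have b1 : 1 ≤ C₂ := le_max_left _ _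
    have b2 : α ≤ C₂ := (le_max_left _ _).trans (le_max_right _ _)
    have b3 : κ ≤ C₂ := (le_max_right _ _).trans (le_max_right _ _)
    have hR0 : 0 ≤ ‖ξ‖ ^ 2 * N := by positivity
    constructor
    · have h1 : N + ‖ξ‖ ^ 2 * N + U ≤ C₁ * (Y + U) := by
        rw [hY]
        linarith [mul_le_mul_of_nonneg_right a1 hU0, mul_le_mul_of_nonneg_right a2 hN0,
          mul_le_mul_of_nonneg_right a3 hR0]
      have h2 : C₁ * (Y + U) ≤ C₁ * (2 * (Y + U + 2 * δ * P)) := by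
        gcongr
        linarith [hP3.1]
      linarith
    · have h1 : Y + U ≤ C₂ * (N + ‖ξ‖ ^ 2 * N + U) := by
        rw [hY]
        linarith [mul_le_mul_of_nonneg_right b1 hU0, mul_le_mul_of_nonneg_right b2 hN0,
          mul_le_mul_of_nonneg_right b3 hR0]
      linarith [hP3.2]
  refine ⟨δ / 2, Real.sqrt (3 * C₁ * C₂), by positivity, by positivity, fun d t ht ξ w => ?_⟩
  have hmono := lyapunov_antitone hμ hμν hκ hα hδ0 hδ1 hδ2 ξ w ht
  simp only [mul_zero, Real.exp_zero, one_mul, semigroup_zero, Matrix.one_mulVec] at hmono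
  set x := semigroup μ ν κ α t ξ *ᵥ w
  have h1 : lyapunov κ α δ ξ x ≤ Real.exp (-(δ * ‖ξ‖ ^ 2 * t)) * lyapunov κ α δ ξ w := by
    rw [Real.exp_neg, inv_mul_eq_div, le_div_iff₀' (Real.exp_pos _)]
    exact hmono
  have h2 : tripleNorm ξ x ^ 2 ≤
      (Real.sqrt (3 * C₁ * C₂) * Real.exp (-(δ / 2) * t * ‖ξ‖ ^ 2) * tripleNorm ξ w) ^ 2 := by
    rw [mul_pow, mul_pow, Real.sq_sqrt (by positivity), ← Real.exp_nat_mul]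
    have e : ((2 : ℕ) : ℝ) * (-(δ / 2) * t * ‖ξ‖ ^ 2) = -(δ * ‖ξ‖ ^ 2 * t) := by push_cast; ring
    rw [e]
    calc tripleNorm ξ x ^ 2 ≤ 2 * C₁ * lyapunov κ α δ ξ x := (hcmp d ξ x).1
      _ ≤ 2 * C₁ * (Real.exp (-(δ * ‖ξ‖ ^ 2 * t)) * lyapunov κ α δ ξ w) := by gcongr
      _ = C₁ * Real.exp (-(δ * ‖ξ‖ ^ 2 * t)) * (2 * lyapunov κ α δ ξ w) := by ring
      _ ≤ C₁ * Real.exp (-(δ * ‖ξ‖ ^ 2 * t)) * (3 * C₂ * tripleNorm ξ w ^ 2) :=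
          mul_le_mul_of_nonneg_left (hcmp d ξ w).2 (by positivity)
      _ = _ := by ring
  exact (abs_le.1 (abs_le_of_sq_le_sq h2 (mul_nonneg (by positivity) (tripleNorm_nonneg ξ w)))).2

end Decay

/-! ### Time regularity of the linear semigroup -/

section TimeRegularity

variable {d : ℕ} {μ ν κ α : ℝ}

lemma tripleNorm_symbol_mulVec_le (hμ : 0 < μ) (hμν : 0 < μ + ν) (hκ : 0 < κ) (hα : 0 < α)
    (ξ : Space d) (w : Unit ⊕ Fin d → ℂ) :
    tripleNorm ξ (symbol μ ν κ α ξ *ᵥ w) ≤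
      (d * (1 + α + κ + μ + (μ + ν) * d)) * (‖ξ‖ + ‖ξ‖ ^ 2) * tripleNorm ξ w := by
  set r := ‖ξ‖ with hr
  set N := tripleNorm ξ w with hN
  have hr0 : 0 ≤ r := norm_nonneg _
  have hN0 : 0 ≤ N := tripleNorm_nonneg ξ w
  have hcoord : ∀ k, |ξ k| ≤ r := fun k => by
    simpa using PiLp.norm_apply_le ξ k
  have hdiv : ‖∑ k, (ξ k : ℂ) * w (Sum.inr k)‖ ≤ d * (r * N) := by
    refine (norm_sum_le _ _).trans ?_
    calc ∑ k, ‖(ξ k : ℂ) * w (Sum.inr k)‖ ≤ ∑ _k : Fin d, r * N := by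
          refine Finset.sum_le_sum fun k _ => ?_
          rw [norm_mul, Complex.norm_real, Real.norm_eq_abs]
          exact mul_le_mul (hcoord k) (norm_apply_le_tripleNorm ξ w _) (norm_nonneg _) hr0
      _ = d * (r * N) := by simp
  have h0 : ‖(symbol μ ν κ α ξ *ᵥ w) (Sum.inl ())‖ ≤ d * (r * N) := by
    rw [symbol_mulVec_inl, norm_mul, Complex.norm_I, one_mul]
    exact hdiv
  have hk : ∀ k, ‖(symbol μ ν κ α ξ *ᵥ w) (Sum.inr k)‖ ≤
      (α + κ + μ + (μ + ν) * d) * (r + r ^ 2) * N := by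
    intro k
    rw [symbol_mulVec_inr]
    refine (norm_add₃_le).trans ?_
    simp only [norm_mul, Complex.norm_I, one_mul, Complex.norm_real, Real.norm_eq_abs]
    rw [abs_of_pos (by positivity : 0 < α + κ * ‖ξ‖ ^ 2), abs_of_pos hμ,
      abs_of_pos hμν, abs_of_nonneg (by positivity : 0 ≤ ‖ξ‖ ^ 2)]
    have a1 : (α + κ * r ^ 2) * |ξ k| * ‖w (Sum.inl ())‖ ≤ α * r * N + κ * r ^ 2 * N := by
      have e1 : (α + κ * r ^ 2) * |ξ k| * ‖w (Sum.inl ())‖ ≤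
          (α + κ * r ^ 2) * r * ‖w (Sum.inl ())‖ := by
        gcongr
        exact hcoord k
      have e2 : α * r * ‖w (Sum.inl ())‖ ≤ α * r * N := by
        gcongr
        exact norm_apply_le_tripleNorm ξ w _
      have e3 : κ * r ^ 2 * (r * ‖w (Sum.inl ())‖) ≤ κ * r ^ 2 * N := by
        gcongr
        exact norm_mul_apply_le_tripleNorm ξ w
      linarith
    have a2 : μ * r ^ 2 * ‖w (Sum.inr k)‖ ≤ μ * r ^ 2 * N := by
      gcongr
      exact norm_apply_le_tripleNorm ξ w _
    have a3 : (μ + ν) * |ξ k| * ‖∑ k, (ξ k : ℂ) * w (Sum.inr k)‖ ≤ (μ + ν) * r * (d * (r * N)) := by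
      gcongr
      exact hcoord k
    have b1 : 0 ≤ α * r ^ 2 * N := by positivity
    have b2 : 0 ≤ κ * r * N := by positivity
    have b3 : 0 ≤ μ * r * N := by positivity
    have b4 : 0 ≤ (μ + ν) * d * r * N := by positivity
    linarith
  calc tripleNorm ξ (symbol μ ν κ α ξ *ᵥ w) ≤ d * (r * N) + r * (d * (r * N)) +
        ∑ _k : Fin d, (α + κ + μ + (μ + ν) * d) * (r + r ^ 2) * N := by
        refine (tripleNorm_le_sum ξ _).trans ?_
        gcongr with k
        exact hk k
    _ = _ := by
        simp only [Finset.sum_const, Finset.card_univ, Fintype.card_fin, nsmul_eq_mul]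
        ring

/-- Lipschitz continuity in time of the linear semigroup at `0`, with a loss of derivatives. -/
theorem exists_semigroup_sub_one_le (d : ℕ) (hμ : 0 < μ) (hμν : 0 < μ + ν) (hκ : 0 < κ)
    (hα : 0 < α) :
    ∃ C : ℝ, 0 ≤ C ∧ ∀ h : ℝ, 0 ≤ h → ∀ (ξ : Space d) (w : Unit ⊕ Fin d → ℂ),
        tripleNorm ξ (semigroup μ ν κ α h ξ *ᵥ w - w) ≤
          C * (h * (‖ξ‖ + ‖ξ‖ ^ 2)) * tripleNorm ξ w := by
  obtain ⟨c, C, hc, hC, hdec⟩ := exists_semigroup_decay hμ hμν hκ hα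
  set K : ℝ := d * (1 + α + κ + μ + (μ + ν) * d) with hK
  have hdec' : ∀ t : ℝ, 0 ≤ t → ∀ (ξ : Space d) (w : Unit ⊕ Fin d → ℂ),
      tripleNorm ξ (semigroup μ ν κ α t ξ *ᵥ w) ≤ C * tripleNorm ξ w := by
    intro t ht ξ w
    refine (hdec d t ht ξ w).trans ?_
    have h1 : Real.exp (-c * t * ‖ξ‖ ^ 2) ≤ 1 := by
      rw [Real.exp_le_one_iff]
      have : 0 ≤ c * t * ‖ξ‖ ^ 2 := by positivity
      linarith
    calc C * Real.exp (-c * t * ‖ξ‖ ^ 2) * tripleNorm ξ w ≤ C * 1 * tripleNorm ξ w := by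
          have := tripleNorm_nonneg ξ w
          gcongr
      _ = _ := by ring
  refine ⟨K * C, by positivity, fun h hh ξ w => ?_⟩
  have hder : ∀ t ∈ Set.Icc 0 h, HasDerivWithinAt
      (fun t => tripleMap ξ (semigroup μ ν κ α t ξ *ᵥ w))
      (tripleMap ξ (-(symbol μ ν κ α ξ *ᵥ (semigroup μ ν κ α t ξ *ᵥ w)))) (Set.Icc 0 h) t := by
    intro t _
    exact (((tripleMap ξ).restrictScalars ℝ).hasFDerivAt.comp_hasDerivAt t
      (hasDerivAt_semigroup_mulVec ξ w t)).hasDerivWithinAt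
  have hb : ∀ t ∈ Set.Ico 0 h,
      ‖tripleMap ξ (-(symbol μ ν κ α ξ *ᵥ (semigroup μ ν κ α t ξ *ᵥ w)))‖ ≤
        K * (‖ξ‖ + ‖ξ‖ ^ 2) * (C * tripleNorm ξ w) := by
    intro t ht
    rw [map_neg, norm_neg, norm_tripleMap]
    refine (tripleNorm_symbol_mulVec_le hμ hμν hκ hα ξ _).trans ?_
    gcongr
    exact hdec' t ht.1 ξ w
  have := norm_image_sub_le_of_norm_deriv_le_segment' hder hb h (Set.right_mem_Icc.2 hh)
  simp only [semigroup_zero, Matrix.one_mulVec, ← map_sub, norm_tripleMap, sub_zero] at this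
  refine this.trans (le_of_eq ?_)
  ring

end TimeRegularity

/-! ### Convolution of homogeneous weights -/

section Convolution

variable {d : ℕ}

lemma integrable_indicator_ball_rpow (hd : 0 < d) {a : ℝ} (ha : a < d) :
    Integrable ((Metric.ball (0 : Space d) 1).indicator fun η => ‖η‖ ^ (-a)) volume := by
  rw [integrable_indicator_iff measurableSet_ball]
  refine integrableOn_ball_of_norm_le_rpow (C := 1) (α := a) ?_ ?_ (ae_of_all _ fun η => ?_) ?_
  · rwa [finrank_euclideanSpace_fin]
  · rwa [finrank_euclideanSpace_fin]
  · rw [one_mul, Real.norm_eq_abs, abs_of_nonneg (by positivity)]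
  · exact (measurable_norm.pow_const _).aestronglyMeasurable

/-- For a unit vector `e`, the convolution of the weights `‖·‖ ^ (-a)` and `‖·‖ ^ (-b)` at `e` is
finite, with a bound that does not depend on `e`. -/
lemma exists_conv_unit_le (hd : 0 < d) {a b : ℝ} (ha0 : 0 < a) (ha : a < d) (hb0 : 0 < b)
    (hb : b < d) (hab : d < a + b) :
    ∃ C : ℝ, 0 < C ∧ ∀ e : Space d, ‖e‖ = 1 →
      Integrable (fun η => ‖e - η‖ ^ (-a) * ‖η‖ ^ (-b)) volume ∧
        ∫ η, ‖e - η‖ ^ (-a) * ‖η‖ ^ (-b) ≤ C := by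
  set p : ℝ → Space d → ℝ := fun a => (Metric.ball (0 : Space d) 1).indicator fun η => ‖η‖ ^ (-a)
    with hp
  have hp0 : ∀ a η, 0 ≤ p a η := fun a η => Set.indicator_nonneg (fun η _ => by positivity) η
  have ha1 := integrable_indicator_ball_rpow hd ha
  have hb1 := integrable_indicator_ball_rpow hd hb
  have hJ : Integrable (fun η : Space d => (1 + ‖η‖) ^ (-(a + b))) volume :=
    integrable_one_add_norm (by rwa [finrank_euclideanSpace_fin])
  set C := (2 : ℝ) ^ a * ∫ η, p b η
  set C' := (2 : ℝ) ^ b * ∫ η, p a η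
  set C'' := (5 : ℝ) ^ a * 3 ^ b * ∫ η : Space d, (1 + ‖η‖) ^ (-(a + b))
  have hC : 0 ≤ C := mul_nonneg (by positivity) (integral_nonneg (hp0 b))
  have hC' : 0 ≤ C' := mul_nonneg (by positivity) (integral_nonneg (hp0 a))
  have hC'' : 0 ≤ C'' := mul_nonneg (by positivity) (integral_nonneg fun η => by positivity)
  refine ⟨C + C' + C'' + 1, by positivity, fun e he => ?_⟩
  set q : Space d → ℝ := fun η =>
    (2 : ℝ) ^ a * p b η + 2 ^ b * p a (e - η) + 5 ^ a * 3 ^ b * (1 + ‖η‖) ^ (-(a + b)) with hq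
  have hq1 : Integrable (fun η => (2 : ℝ) ^ a * p b η) volume := hb1.const_mul _
  have hq2 : Integrable (fun η => (2 : ℝ) ^ b * p a (e - η)) volume :=
    (ha1.comp_sub_left e).const_mul _
  have hq3 : Integrable (fun η : Space d => (5 : ℝ) ^ a * 3 ^ b * (1 + ‖η‖) ^ (-(a + b))) volume :=
    hJ.const_mul _
  have hq12 : Integrable (fun η => (2 : ℝ) ^ a * p b η + 2 ^ b * p a (e - η)) volume := hq1.add hq2
  have hqi : Integrable q volume := hq12.add hq3
  have hqI : ∫ η, q η = C + C' + C'' := by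
    simp only [hq]
    rw [integral_add hq12 hq3, integral_add hq1 hq2, integral_const_mul,
      integral_const_mul, integral_const_mul, integral_sub_left_eq_self (p a)]
  have hneg : ∀ {x y c : ℝ}, 0 < c → 0 < x → x ≤ y * c → ∀ s : ℝ, 0 < s →
      y ^ (-s) ≤ c ^ s * x ^ (-s) := by
    intro x y c hc hx hxy s hs
    have hy : 0 < y := by
      by_contra h
      have := mul_nonpos_of_nonpos_of_nonneg (not_lt.1 h) hc.le
      linarith
    rw [Real.rpow_neg hy.le, Real.rpow_neg hx.le, ← div_eq_mul_inv, le_div_iff₀ (by positivity),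
      inv_mul_eq_div, div_le_iff₀ (by positivity), mul_comm, ← Real.mul_rpow hy.le hc.le]
    exact Real.rpow_le_rpow hx.le hxy hs.le
  -- Three regions: close to `0`, close to `e`, and the rest, where both distances are comparable
  -- to `1 + ‖η‖`.
  have hle : ∀ η, ‖e - η‖ ^ (-a) * ‖η‖ ^ (-b) ≤ q η := by
    intro η
    have t1 : 0 ≤ (2 : ℝ) ^ a * p b η := mul_nonneg (by positivity) (hp0 b η)
    have t2 : 0 ≤ (2 : ℝ) ^ b * p a (e - η) := mul_nonneg (by positivity) (hp0 a _)
    have t3 : 0 ≤ (5 : ℝ) ^ a * 3 ^ b * (1 + ‖η‖) ^ (-(a + b)) := by positivity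
    have htri : 1 ≤ ‖e - η‖ + ‖η‖ := by
      calc 1 = ‖(e - η) + η‖ := by rw [sub_add_cancel, he]
        _ ≤ _ := norm_add_le _ _
    have htri' : ‖η‖ ≤ 1 + ‖e - η‖ := by
      calc ‖η‖ = ‖e - (e - η)‖ := by rw [sub_sub_cancel]
        _ ≤ ‖e‖ + ‖e - η‖ := norm_sub_le _ _
        _ = _ := by rw [he]
    by_cases h1 : ‖η‖ < 1 / 2
    · have hpb : p b η = ‖η‖ ^ (-b) := by
        rw [hp]
        exact Set.indicator_of_mem (by rw [mem_ball_zero_iff]; linarith) _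
      have := hneg (x := 1) (y := ‖e - η‖) two_pos one_pos (by linarith) a ha0
      rw [Real.one_rpow, mul_one] at this
      calc _ ≤ 2 ^ a * ‖η‖ ^ (-b) := by gcongr
        _ ≤ q η := by
          rw [hq]
          simp only
          rw [← hpb]
          linarith
    by_cases h2 : ‖e - η‖ < 1 / 2
    · have hpa : p a (e - η) = ‖e - η‖ ^ (-a) := by
        rw [hp]
        exact Set.indicator_of_mem (by rw [mem_ball_zero_iff]; linarith) _
      have := hneg (x := 1) (y := ‖η‖) two_pos one_pos (by linarith) b hb0
      rw [Real.one_rpow, mul_one] at this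
      calc _ ≤ ‖e - η‖ ^ (-a) * 2 ^ b := by gcongr
        _ = 2 ^ b * p a (e - η) := by rw [hpa, mul_comm]
        _ ≤ q η := by
          rw [hq]
          simp only
          linarith
    · push Not at h1 h2
      have hpos : 0 < 1 + ‖η‖ := by positivity
      have e1 := hneg (x := 1 + ‖η‖) (y := ‖e - η‖) (c := 5) (by norm_num) hpos (by linarith) a ha0
      have e2 := hneg (x := 1 + ‖η‖) (y := ‖η‖) (c := 3) (by norm_num) hpos (by linarith) b hb0
      calc _ ≤ (5 ^ a * (1 + ‖η‖) ^ (-a)) * (3 ^ b * (1 + ‖η‖) ^ (-b)) := by gcongr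
        _ = 5 ^ a * 3 ^ b * (1 + ‖η‖) ^ (-(a + b)) := by
          rw [neg_add, Real.rpow_add hpos]
          ring
        _ ≤ q η := by
          rw [hq]
          simp only
          linarith
  have hm : AEStronglyMeasurable (fun η : Space d => ‖e - η‖ ^ (-a) * ‖η‖ ^ (-b)) volume :=
    (((measurable_const.sub measurable_id).norm.pow_const _).mul
      (measurable_norm.pow_const _)).aestronglyMeasurable
  have hint : Integrable (fun η => ‖e - η‖ ^ (-a) * ‖η‖ ^ (-b)) volume :=
    hqi.mono' hm (ae_of_all _ fun η => by
      rw [Real.norm_eq_abs, abs_of_nonneg (by positivity)]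
      exact hle η)
  refine ⟨hint, ?_⟩
  have := integral_mono hint hqi hle
  rw [hqI] at this
  linarith

/-- The convolution of `‖·‖ ^ (-a)` and `‖·‖ ^ (-b)` is bounded by a multiple of
`‖·‖ ^ (d - a - b)`: this follows from the case of unit vectors by scaling. -/
theorem exists_conv_rpow_le (hd : 0 < d) {a b : ℝ} (ha0 : 0 < a) (ha : a < d) (hb0 : 0 < b)
    (hb : b < d) (hab : d < a + b) :
    ∃ C : ℝ, 0 < C ∧ ∀ ξ : Space d, ξ ≠ 0 →
      Integrable (fun η => ‖ξ - η‖ ^ (-a) * ‖η‖ ^ (-b)) volume ∧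
        ∫ η, ‖ξ - η‖ ^ (-a) * ‖η‖ ^ (-b) ≤ C * ‖ξ‖ ^ (d - a - b) := by
  obtain ⟨C, hC, h⟩ := exists_conv_unit_le hd ha0 ha hb0 hb hab
  refine ⟨C, hC, fun ξ hξ => ?_⟩
  set r := ‖ξ‖ with hr
  have hr0 : 0 < r := norm_pos_iff.2 hξ
  set e : Space d := r⁻¹ • ξ with he
  have hξe : ξ = r • e := by rw [he, smul_smul, mul_inv_cancel₀ hr0.ne', one_smul]
  have he1 : ‖e‖ = 1 := by
    rw [he, norm_smul, norm_inv, Real.norm_eq_abs, abs_of_pos hr0, ← hr, inv_mul_cancel₀ hr0.ne']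
  obtain ⟨hi, hI⟩ := h e he1
  have hscale : ∀ η : Space d, ‖ξ - r • η‖ ^ (-a) * ‖r • η‖ ^ (-b) =
      r ^ (-a - b) * (‖e - η‖ ^ (-a) * ‖η‖ ^ (-b)) := by
    intro η
    rw [hξe, ← smul_sub, norm_smul, norm_smul, Real.norm_eq_abs, abs_of_pos hr0,
      Real.mul_rpow hr0.le (norm_nonneg _), Real.mul_rpow hr0.le (norm_nonneg _),
      sub_eq_add_neg (-a) b, Real.rpow_add hr0]
    ring
  constructor
  · rw [← MeasureTheory.integrable_comp_smul_iff volume _ hr0.ne']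
    simp only [hscale]
    exact hi.const_mul _
  · have := Measure.integral_comp_smul volume
      (fun η : Space d => ‖ξ - η‖ ^ (-a) * ‖η‖ ^ (-b)) r
    simp only [hscale] at this
    rw [integral_const_mul, finrank_euclideanSpace_fin, smul_eq_mul, abs_of_pos (by positivity),
      inv_mul_eq_div, eq_div_iff (by positivity)] at this
    rw [← this, sub_sub, show ((d : ℝ) - (a + b)) = (-a - b) + d by ring, Real.rpow_add hr0,
      Real.rpow_natCast]
    calc r ^ (-a - b) * (∫ η, ‖e - η‖ ^ (-a) * ‖η‖ ^ (-b)) * r ^ d ≤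
        r ^ (-a - b) * C * r ^ d := by gcongr
      _ = _ := by ring

/-- The almost everywhere bound `|φ(η)| ≤ A ‖η‖ ^ (-a) e^{-σ‖η‖}`. -/
def HasWeightBound (σ a A : ℝ) (φ : Space d → ℂ) : Prop :=
  ∀ᵐ η, ‖φ η‖ ≤ A * (‖η‖ ^ (-a) * Real.exp (-(σ * ‖η‖)))

lemma ae_comp_sub_left {P : Space d → Prop} (h : ∀ᵐ η, P η) (ξ : Space d) :
    ∀ᵐ η, P (ξ - η) :=
  (Measure.measurePreserving_sub_left volume ξ).quasiMeasurePreserving.ae h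

lemma aestronglyMeasurable_comp_sub_left {φ : Space d → ℂ} (h : AEStronglyMeasurable φ volume)
    (ξ : Space d) : AEStronglyMeasurable (fun η => φ (ξ - η)) volume :=
  h.comp_quasiMeasurePreserving (Measure.measurePreserving_sub_left volume ξ).quasiMeasurePreserving

/-- Weighted bounds pass to convolutions. The exponential weight is submultiplicative, hence it
plays no role in the constant. -/
theorem exists_conv_weight_le (hd : 0 < d) {a b : ℝ} (ha0 : 0 < a) (ha : a < d) (hb0 : 0 < b)
    (hb : b < d) (hab : d < a + b) :
    ∃ C : ℝ, 0 < C ∧ ∀ (σ A B : ℝ), 0 ≤ σ → 0 ≤ A → 0 ≤ B → ∀ φ ψ : Space d → ℂ,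
      AEStronglyMeasurable φ volume → AEStronglyMeasurable ψ volume →
      HasWeightBound σ a A φ → HasWeightBound σ b B ψ → ∀ ξ : Space d, ξ ≠ 0 →
        Integrable (fun η => φ (ξ - η) * ψ η) volume ∧
          ‖∫ η, φ (ξ - η) * ψ η‖ ≤
            C * (A * B) * (‖ξ‖ ^ (d - a - b) * Real.exp (-(σ * ‖ξ‖))) := by
  obtain ⟨C, hC, h⟩ := exists_conv_rpow_le hd ha0 ha hb0 hb hab
  refine ⟨C, hC, fun σ A B hσ hA hB φ ψ hφm hψm hφ hψ ξ hξ => ?_⟩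
  obtain ⟨hi, hI⟩ := h ξ hξ
  have hbound : ∀ᵐ η, ‖φ (ξ - η) * ψ η‖ ≤
      A * B * Real.exp (-(σ * ‖ξ‖)) * (‖ξ - η‖ ^ (-a) * ‖η‖ ^ (-b)) := by
    filter_upwards [ae_comp_sub_left hφ ξ, hψ] with η h1 h2
    have h3 : Real.exp (-(σ * ‖ξ - η‖)) * Real.exp (-(σ * ‖η‖)) ≤ Real.exp (-(σ * ‖ξ‖)) := by
      rw [← Real.exp_add, Real.exp_le_exp]
      have : ‖ξ‖ ≤ ‖ξ - η‖ + ‖η‖ := by simpa using norm_add_le (ξ - η) η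
      linarith [mul_le_mul_of_nonneg_left this hσ]
    rw [norm_mul]
    calc ‖φ (ξ - η)‖ * ‖ψ η‖ ≤ (A * (‖ξ - η‖ ^ (-a) * Real.exp (-(σ * ‖ξ - η‖)))) *
          (B * (‖η‖ ^ (-b) * Real.exp (-(σ * ‖η‖)))) := by gcongr
      _ = A * B * (‖ξ - η‖ ^ (-a) * ‖η‖ ^ (-b)) *
          (Real.exp (-(σ * ‖ξ - η‖)) * Real.exp (-(σ * ‖η‖))) := by ring
      _ ≤ A * B * (‖ξ - η‖ ^ (-a) * ‖η‖ ^ (-b)) * Real.exp (-(σ * ‖ξ‖)) := by gcongr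
      _ = _ := by ring
  have hi' := hi.const_mul (A * B * Real.exp (-(σ * ‖ξ‖)))
  refine ⟨hi'.mono' ((aestronglyMeasurable_comp_sub_left hφm ξ).mul hψm) hbound, ?_⟩
  refine (norm_integral_le_of_norm_le hi' hbound).trans ?_
  rw [integral_const_mul]
  calc A * B * Real.exp (-(σ * ‖ξ‖)) * ∫ η, ‖ξ - η‖ ^ (-a) * ‖η‖ ^ (-b) ≤
      A * B * Real.exp (-(σ * ‖ξ‖)) * (C * ‖ξ‖ ^ (d - a - b)) := by gcongr
    _ = _ := by ring

/-- Local Lipschitz estimate for the product in weighted spaces. -/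
theorem exists_prodHat_sub_le (hd : 0 < d) {a b : ℝ} (ha0 : 0 < a) (ha : a < d) (hb0 : 0 < b)
    (hb : b < d) (hab : d < a + b) :
    ∃ C : ℝ, 0 < C ∧ ∀ (σ A D : ℝ), 0 ≤ σ → 0 ≤ A → 0 ≤ D → ∀ φ φ' ψ ψ' : Space d → ℂ,
      AEStronglyMeasurable φ volume → AEStronglyMeasurable φ' volume →
      AEStronglyMeasurable ψ volume → AEStronglyMeasurable ψ' volume →
      HasWeightBound σ a A φ → HasWeightBound σ a A φ' → HasWeightBound σ b A ψ →
      HasWeightBound σ b A ψ' → HasWeightBound σ a D (fun η => φ η - φ' η) →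
      HasWeightBound σ b D (fun η => ψ η - ψ' η) → ∀ ξ : Space d, ξ ≠ 0 →
        ‖prodHat φ ψ ξ - prodHat φ' ψ' ξ‖ ≤
          C * (A * D) * (‖ξ‖ ^ (d - a - b) * Real.exp (-(σ * ‖ξ‖))) := by
  obtain ⟨C, hC, h⟩ := exists_conv_weight_le hd ha0 ha hb0 hb hab
  refine ⟨((2 * Real.pi) ^ d)⁻¹ * (2 * C), by positivity, ?_⟩
  intro σ A D hσ hA hD φ φ' ψ ψ' mφ mφ' mψ mψ' hφ hφ' hψ hψ' hd1 hd2 ξ hξ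
  have i1 := h σ A A hσ hA hA φ ψ mφ mψ hφ hψ ξ hξ
  have i2 := h σ A A hσ hA hA φ' ψ' mφ' mψ' hφ' hψ' ξ hξ
  have i3 := h σ D A hσ hD hA (fun η => φ η - φ' η) ψ (mφ.sub mφ') mψ hd1 hψ ξ hξ
  have i4 := h σ A D hσ hA hD φ' (fun η => ψ η - ψ' η) mφ' (mψ.sub mψ') hφ' hd2 ξ hξ
  have e : (∫ η, φ (ξ - η) * ψ η) - ∫ η, φ' (ξ - η) * ψ' η =
      (∫ η, (φ (ξ - η) - φ' (ξ - η)) * ψ η) + ∫ η, φ' (ξ - η) * (ψ η - ψ' η) := by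
    rw [← integral_sub i1.1 i2.1, ← integral_add i3.1 i4.1]
    congr 1
    ext η
    ring
  rw [prodHat, prodHat, ← mul_sub, e, norm_mul, norm_inv, Complex.norm_real, Real.norm_eq_abs,
    abs_of_pos (by positivity), mul_assoc, mul_assoc]
  gcongr
  refine (norm_add_le _ _).trans ((add_le_add i3.2 i4.2).trans (le_of_eq ?_))
  ring

end Convolution

/-! ### The nonlinear terms -/

section Nonlinearity

variable {d : ℕ}

/-- The nonlinearity `(f, g₁ + g₂ + g₃)` as a function of the Fourier profile
`w = (â, û₁, …, û_d)`. -/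
noncomputable def nonlin (μ ν κ : ℝ) (w : Space d → Unit ⊕ Fin d → ℂ) (ξ : Space d) :
    Unit ⊕ Fin d → ℂ :=
  Sum.elim
    (fun _ => -∑ j, prodHat (fun η => w η (Sum.inr j)) (dHat j fun η => w η (Sum.inl ())) ξ)
    (fun k =>
      -∑ j, prodHat (fun η => w η (Sum.inr j)) (dHat j fun η => w η (Sum.inr k)) ξ +
      ((μ : ℂ) * ∑ j, prodHat (dHat j fun η => w η (Sum.inl ()))
          (dHat j fun η => w η (Sum.inr k)) ξ +
        ((μ + ν : ℝ) : ℂ) * ∑ j, prodHat (dHat j fun η => w η (Sum.inl ()))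
          (dHat k fun η => w η (Sum.inr j)) ξ) +
      ((κ / 2 : ℝ) : ℂ) * dHat k (fun ζ => ∑ j, prodHat (dHat j fun η => w η (Sum.inl ()))
        (dHat j fun η => w η (Sum.inl ())) ζ) ξ)

lemma nonlinHat_eq (μ ν κ : ℝ) (a : 𝓢'(Space d, ℂ)) (u : Fin d → 𝓢'(Space d, ℂ)) (ξ : Space d) :
    nonlinHat μ ν κ a u ξ = nonlin μ ν κ (hatPair a u) ξ := rfl

lemma prodHat_congr {φ φ' ψ ψ' : Space d → ℂ} (h : φ =ᵐ[volume] φ') (h' : ψ =ᵐ[volume] ψ') :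
    prodHat φ ψ = prodHat φ' ψ' := by
  ext ξ
  rw [prodHat, prodHat]
  congr 1
  refine integral_congr_ae ?_
  filter_upwards [ae_comp_sub_left h ξ, h'] with η h1 h2
  rw [h1, h2]

lemma dHat_congr (j : Fin d) {φ φ' : Space d → ℂ} (h : φ =ᵐ[volume] φ') :
    dHat j φ =ᵐ[volume] dHat j φ' := by
  filter_upwards [h] with η h1
  rw [dHat, dHat, h1]

/-- The nonlinearity at a given frequency depends only on the almost everywhere class of the
profile. -/
lemma nonlin_congr (μ ν κ : ℝ) {w w' : Space d → Unit ⊕ Fin d → ℂ} (h : w =ᵐ[volume] w') :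
    nonlin μ ν κ w = nonlin μ ν κ w' := by
  have hi : ∀ i, (fun η => w η i) =ᵐ[volume] fun η => w' η i := fun i => by
    filter_upwards [h] with η h1
    rw [h1]
  have hd : ∀ j i, dHat j (fun η => w η i) =ᵐ[volume] dHat j fun η => w' η i :=
    fun j i => dHat_congr j (hi i)
  have e1 : ∀ i j k, prodHat (fun η => w η i) (dHat j fun η => w η k) =
      prodHat (fun η => w' η i) (dHat j fun η => w' η k) :=
    fun i j k => prodHat_congr (hi i) (hd j k)
  have e2 : ∀ j i l k, prodHat (dHat j fun η => w η i) (dHat l fun η => w η k) =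
      prodHat (dHat j fun η => w' η i) (dHat l fun η => w' η k) :=
    fun j i l k => prodHat_congr (hd j i) (hd l k)
  ext ξ i
  simp only [nonlin, e1, e2]

@[simp]
lemma nonlin_zero (μ ν κ : ℝ) : nonlin μ ν κ (0 : Space d → Unit ⊕ Fin d → ℂ) = 0 := by
  ext ξ i
  rcases i with i | i <;> simp [nonlin, prodHat, dHat]

/-- Almost everywhere bound of a profile by `A ‖η‖ ^ (-β) e^{-σ‖η‖}` in the norm of the triple. -/
def HasTripleBound (σ β A : ℝ) (w : Space d → Unit ⊕ Fin d → ℂ) : Prop :=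
  ∀ᵐ η, tripleNorm η (w η) ≤ A * (‖η‖ ^ (-β) * Real.exp (-(σ * ‖η‖)))

variable {σ β A : ℝ} {w : Space d → Unit ⊕ Fin d → ℂ}

lemma HasTripleBound.apply (h : HasTripleBound σ β A w) (i : Unit ⊕ Fin d) :
    HasWeightBound σ β A fun η => w η i := by
  filter_upwards [h] with η hη
  exact (norm_apply_le_tripleNorm η _ i).trans hη

lemma norm_dHat_le (j : Fin d) (φ : Space d → ℂ) (η : Space d) :
    ‖dHat j φ η‖ ≤ ‖η‖ * ‖φ η‖ := by
  rw [dHat, norm_mul, norm_mul, Complex.norm_I, one_mul, Complex.norm_real]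
  gcongr
  exact PiLp.norm_apply_le η j

/-- A derivative of the density part costs nothing. -/
lemma HasTripleBound.dHat_inl (h : HasTripleBound σ β A w) (j : Fin d) :
    HasWeightBound σ β A (dHat j fun η => w η (Sum.inl ())) := by
  filter_upwards [h] with η hη
  exact (norm_dHat_le j _ η).trans ((norm_mul_apply_le_tripleNorm η (w η)).trans hη)

/-- A derivative of any component costs one power of the frequency. -/
lemma HasTripleBound.dHat_apply (hd : 0 < d) (h : HasTripleBound σ β A w) (j : Fin d)
    (i : Unit ⊕ Fin d) : HasWeightBound σ (β - 1) A (dHat j fun η => w η i) := by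
  filter_upwards [h, ae_ne_zero hd] with η hη h0
  have hη0 : 0 < ‖η‖ := norm_pos_iff.2 h0
  refine (norm_dHat_le j _ η).trans ?_
  calc ‖η‖ * ‖w η i‖ ≤ ‖η‖ * (A * (‖η‖ ^ (-β) * Real.exp (-(σ * ‖η‖)))) := by
        gcongr
        exact (norm_apply_le_tripleNorm η _ i).trans hη
    _ = A * (‖η‖ ^ (-(β - 1)) * Real.exp (-(σ * ‖η‖))) := by
        rw [show -(β - 1) = -β + 1 by ring, Real.rpow_add hη0, Real.rpow_one]
        ring

lemma aestronglyMeasurable_dHat (j : Fin d) {φ : Space d → ℂ} (h : AEStronglyMeasurable φ volume) :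
    AEStronglyMeasurable (dHat j φ) volume := by
  refine AEStronglyMeasurable.mul (Continuous.aestronglyMeasurable ?_) h
  fun_prop

lemma norm_sum_sub_sum_le {x y : Fin d → ℂ} {B : ℝ} (h : ∀ j, ‖x j - y j‖ ≤ B) :
    ‖(∑ j, x j) - ∑ j, y j‖ ≤ d * B := by
  rw [← Finset.sum_sub_distrib]
  refine (norm_sum_le _ _).trans ((Finset.sum_le_sum fun j _ => h j).trans (le_of_eq ?_))
  simp

/-- Local Lipschitz estimate for the nonlinearity. Every product pairs a factor of order `β` with
a factor of order `β - 1`, or two factors of order `β` under a derivative; both give the order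
`2β - 1 - d`. -/
theorem exists_nonlin_sub_le (hd : 0 < d) (μ ν κ : ℝ) (hβd : β < d)
    (hβ : (d : ℝ) + 1 < 2 * β) :
    ∃ C : ℝ, 0 < C ∧ ∀ (σ A D : ℝ), 0 ≤ σ → 0 ≤ A → 0 ≤ D →
      ∀ w w' : Space d → Unit ⊕ Fin d → ℂ,
      (∀ i, AEStronglyMeasurable (fun η => w η i) volume) →
      (∀ i, AEStronglyMeasurable (fun η => w' η i) volume) →
      HasTripleBound σ β A w → HasTripleBound σ β A w' →
      HasTripleBound σ β D (fun η => w η - w' η) → ∀ ξ : Space d, ξ ≠ 0 →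
        tripleNorm ξ (nonlin μ ν κ w ξ - nonlin μ ν κ w' ξ) ≤
          C * (A * D) * (‖ξ‖ ^ (-(2 * β - 1 - d)) * Real.exp (-(σ * ‖ξ‖))) := by
  obtain ⟨C₁, hC₁, h₁⟩ := exists_prodHat_sub_le (d := d) hd (a := β) (b := β - 1) (by linarith) hβd
    (by linarith) (by linarith) (by linarith)
  obtain ⟨C₂, hC₂, h₂⟩ := exists_prodHat_sub_le (d := d) hd (a := β) (b := β) (by linarith) hβd
    (by linarith) (by linarith) (by linarith)
  set c : ℝ := d * C₁ + d * C₂ + d * (d * C₁ + |μ| * (d * C₁) + |μ + ν| * (d * C₁) +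
    |κ / 2| * (d * C₂)) with hc
  have hd' : (0 : ℝ) < d := by exact_mod_cast hd
  refine ⟨c, by positivity, fun σ A D hσ hA hD w w' mw mw' hw hw' hww ξ hξ => ?_⟩
  have hξ0 : 0 < ‖ξ‖ := norm_pos_iff.2 hξ
  set E := (A * D) * (‖ξ‖ ^ (-(2 * β - 1 - d)) * Real.exp (-(σ * ‖ξ‖))) with hE
  have hE0 : 0 ≤ E := by positivity
  have mdw := fun j i => aestronglyMeasurable_dHat j (mw i)
  have mdw' := fun j i => aestronglyMeasurable_dHat j (mw' i)
  have hsub : ∀ (j : Fin d) (i : Unit ⊕ Fin d), (fun η => dHat j (fun η => w η i) η -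
      dHat j (fun η => w' η i) η) = dHat j fun η => (w η - w' η) i := fun j i => by
    ext η
    simp only [dHat, Pi.sub_apply]
    ring
  -- Products of a component with a derivative of a component.
  have p1 : ∀ i j k, ‖prodHat (fun η => w η i) (dHat j fun η => w η k) ξ -
      prodHat (fun η => w' η i) (dHat j fun η => w' η k) ξ‖ ≤ C₁ * E := by
    intro i j k
    have := h₁ σ A D hσ hA hD _ _ _ _ (mw i) (mw' i) (mdw j k) (mdw' j k) (hw.apply i) (hw'.apply i)
      (hw.dHat_apply hd j k) (hw'.dHat_apply hd j k) (hww.apply i)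
      (by rw [hsub]; exact hww.dHat_apply hd j k) ξ hξ
    rw [hE]
    refine this.trans (le_of_eq ?_)
    rw [show (d : ℝ) - β - (β - 1) = -(2 * β - 1 - d) by ring]
    ring
  -- Products of a derivative of the density part with a derivative of a component.
  have p2 : ∀ j l k, ‖prodHat (dHat j fun η => w η (Sum.inl ())) (dHat l fun η => w η k) ξ -
      prodHat (dHat j fun η => w' η (Sum.inl ())) (dHat l fun η => w' η k) ξ‖ ≤ C₁ * E := by
    intro j l k
    have := h₁ σ A D hσ hA hD _ _ _ _ (mdw j _) (mdw' j _) (mdw l k) (mdw' l k) (hw.dHat_inl j)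
      (hw'.dHat_inl j) (hw.dHat_apply hd l k) (hw'.dHat_apply hd l k)
      (by rw [hsub]; exact hww.dHat_inl j) (by rw [hsub]; exact hww.dHat_apply hd l k) ξ hξ
    rw [hE]
    refine this.trans (le_of_eq ?_)
    rw [show (d : ℝ) - β - (β - 1) = -(2 * β - 1 - d) by ring]
    ring
  have hpow : ‖ξ‖ * ‖ξ‖ ^ ((d : ℝ) - β - β) = ‖ξ‖ ^ (-(2 * β - 1 - d)) := by
    rw [show -(2 * β - 1 - d) = ((d : ℝ) - β - β) + 1 by ring, Real.rpow_add hξ0, Real.rpow_one]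
    ring
  -- Two factors of order `β`, under an outer derivative.
  have p3 : ∀ i j, ‖ξ‖ * ‖prodHat (fun η => w η i) (dHat j fun η => w η (Sum.inl ())) ξ -
      prodHat (fun η => w' η i) (dHat j fun η => w' η (Sum.inl ())) ξ‖ ≤ C₂ * E := by
    intro i j
    have := h₂ σ A D hσ hA hD _ _ _ _ (mw i) (mw' i) (mdw j _) (mdw' j _) (hw.apply i) (hw'.apply i)
      (hw.dHat_inl j) (hw'.dHat_inl j) (hww.apply i)
      (by rw [hsub]; exact hww.dHat_inl j) ξ hξ
    rw [hE, ← hpow]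
    refine (mul_le_mul_of_nonneg_left this hξ0.le).trans (le_of_eq ?_)
    ring
  have p4 : ∀ j, ‖ξ‖ * ‖prodHat (dHat j fun η => w η (Sum.inl ()))
        (dHat j fun η => w η (Sum.inl ())) ξ -
      prodHat (dHat j fun η => w' η (Sum.inl ())) (dHat j fun η => w' η (Sum.inl ())) ξ‖ ≤
        C₂ * E := by
    intro j
    have := h₂ σ A D hσ hA hD _ _ _ _ (mdw j _) (mdw' j _) (mdw j _) (mdw' j _) (hw.dHat_inl j)
      (hw'.dHat_inl j) (hw.dHat_inl j) (hw'.dHat_inl j) (by rw [hsub]; exact hww.dHat_inl j)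
      (by rw [hsub]; exact hww.dHat_inl j) ξ hξ
    rw [hE, ← hpow]
    refine (mul_le_mul_of_nonneg_left this hξ0.le).trans (le_of_eq ?_)
    ring
  have hswap : ∀ {B : ℝ} {z : ℂ}, ‖ξ‖ * ‖z‖ ≤ B → ‖z‖ ≤ B / ‖ξ‖ := fun {B z} h => by
    rwa [le_div_iff₀' hξ0]
  have hf : ‖(nonlin μ ν κ w ξ - nonlin μ ν κ w' ξ) (Sum.inl ())‖ ≤ d * (C₁ * E) := by
    simp only [nonlin, Pi.sub_apply, Sum.elim_inl]
    rw [neg_sub_neg, norm_sub_rev]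
    exact norm_sum_sub_sum_le fun j => p1 _ _ _
  have hf' : ‖ξ‖ * ‖(nonlin μ ν κ w ξ - nonlin μ ν κ w' ξ) (Sum.inl ())‖ ≤ d * (C₂ * E) := by
    simp only [nonlin, Pi.sub_apply, Sum.elim_inl]
    rw [neg_sub_neg, norm_sub_rev, ← le_div_iff₀' hξ0, mul_div_assoc]
    exact norm_sum_sub_sum_le fun j => hswap (p3 _ _)
  have hg : ∀ k, ‖(nonlin μ ν κ w ξ - nonlin μ ν κ w' ξ) (Sum.inr k)‖ ≤
      d * (C₁ * E) + (|μ| * (d * (C₁ * E)) + |μ + ν| * (d * (C₁ * E))) +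
        |κ / 2| * (d * (C₂ * E)) := by
    intro k
    simp only [nonlin, Pi.sub_apply, Sum.elim_inr]
    rw [add_sub_add_comm, add_sub_add_comm, add_sub_add_comm, neg_sub_neg, ← mul_sub, ← mul_sub,
      ← mul_sub]
    refine norm_add₃_le.trans (add_le_add (add_le_add ?_ ?_) ?_)
    · rw [norm_sub_rev]
      exact norm_sum_sub_sum_le fun j => p1 _ _ _
    · refine (norm_add_le _ _).trans (add_le_add ?_ ?_)
      · rw [norm_mul, Complex.norm_real, Real.norm_eq_abs]
        gcongr
        exact norm_sum_sub_sum_le fun j => p2 _ _ _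
      · rw [norm_mul, Complex.norm_real, Real.norm_eq_abs]
        gcongr
        exact norm_sum_sub_sum_le fun j => p2 _ _ _
    · rw [norm_mul, Complex.norm_real, Real.norm_eq_abs]
      gcongr
      rw [dHat, dHat, ← mul_sub]
      refine (norm_dHat_le k (fun ξ => (∑ j, prodHat (dHat j fun η => w η (Sum.inl ()))
        (dHat j fun η => w η (Sum.inl ())) ξ) - ∑ j, prodHat (dHat j fun η => w' η (Sum.inl ()))
        (dHat j fun η => w' η (Sum.inl ())) ξ) ξ).trans ?_
      rw [← le_div_iff₀' hξ0, mul_div_assoc]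
      exact norm_sum_sub_sum_le fun j => hswap (p4 _)
  refine (tripleNorm_le_sum ξ _).trans ?_
  refine (add_le_add (add_le_add hf hf') (Finset.sum_le_sum fun k _ => hg k)).trans (le_of_eq ?_)
  rw [mul_assoc, ← hE, hc]
  simp only [Finset.sum_const, Finset.card_univ, Fintype.card_fin, nsmul_eq_mul]
  ring

/-- Joint measurability in time and frequency of the nonlinearity. -/
theorem measurable_nonlin (μ ν κ : ℝ) {φ : ℝ → Space d → Unit ⊕ Fin d → ℂ}
    (hφ : Measurable fun z : ℝ × Space d => φ z.1 z.2) :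
    Measurable fun z : ℝ × Space d => nonlin μ ν κ (φ z.1) z.2 := by
  have hP : ∀ F G : ℝ → Space d → ℂ, (Measurable fun z : ℝ × Space d => F z.1 z.2) →
      (Measurable fun z : ℝ × Space d => G z.1 z.2) →
      Measurable fun z : ℝ × Space d => prodHat (F z.1) (G z.1) z.2 := by
    intro F G hF hG
    unfold prodHat
    refine Measurable.const_mul ?_ _
    have h : Measurable fun y : (ℝ × Space d) × Space d =>
        F y.1.1 (y.1.2 - y.2) * G y.1.1 y.2 :=
      (hF.comp (f := fun y : (ℝ × Space d) × Space d => (y.1.1, y.1.2 - y.2)) (by fun_prop)).mul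
        (hG.comp (f := fun y : (ℝ × Space d) × Space d => (y.1.1, y.2)) (by fun_prop))
    exact (h.stronglyMeasurable.integral_prod_right' (ν := volume)).measurable
  have hC : ∀ i, Measurable fun z : ℝ × Space d => φ z.1 z.2 i := fun i =>
    (measurable_pi_apply i).comp hφ
  have hD : ∀ (F : ℝ → Space d → ℂ) (j : Fin d), (Measurable fun z : ℝ × Space d => F z.1 z.2) →
      Measurable fun z : ℝ × Space d => dHat j (F z.1) z.2 := by
    intro F j hF
    unfold dHat
    refine Measurable.mul ?_ hF
    fun_prop
  have h1 : ∀ i j k, Measurable fun z : ℝ × Space d =>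
      prodHat (fun η => φ z.1 η i) (dHat j fun η => φ z.1 η k) z.2 := fun i j k =>
    hP (fun s η => φ s η i) (fun s => dHat j fun η => φ s η k) (hC i)
      (hD (fun s η => φ s η k) j (hC k))
  have h2 : ∀ j i l k, Measurable fun z : ℝ × Space d =>
      prodHat (dHat j fun η => φ z.1 η i) (dHat l fun η => φ z.1 η k) z.2 := fun j i l k =>
    hP (fun s => dHat j fun η => φ s η i) (fun s => dHat l fun η => φ s η k)
      (hD (fun s η => φ s η i) j (hC i)) (hD (fun s η => φ s η k) l (hC k))
  refine measurable_pi_iff.2 fun i => ?_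
  rcases i with i | k
  · simp only [nonlin, Sum.elim_inl]
    exact (Finset.measurable_sum _ fun j _ => h1 _ _ _).neg
  · simp only [nonlin, Sum.elim_inr]
    refine ((Finset.measurable_sum _ fun j _ => h1 _ _ _).neg.add
      (((Finset.measurable_sum _ fun j _ => h2 _ _ _ _).const_mul _).add
        ((Finset.measurable_sum _ fun j _ => h2 _ _ _ _).const_mul _))).add ?_
    refine Measurable.const_mul ?_ _
    exact hD (fun s ζ => ∑ j, prodHat (dHat j fun η => φ s η (Sum.inl ()))
      (dHat j fun η => φ s η (Sum.inl ())) ζ) k (Finset.measurable_sum _ fun j _ => h2 _ _ _ _)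

end Nonlinearity

/-! ### Time integrals -/

section TimeIntegral

/-- The Beta-type integral `∫₀ᵗ (t - s)^{-a} s^{-b} ds` scales like `t^{1 - a - b}`. -/
theorem exists_integral_rpow_mul_rpow_le {a b : ℝ} (ha0 : 0 ≤ a) (ha : a < 1) (hb0 : 0 ≤ b)
    (hb : b < 1) :
    ∃ C : ℝ, 0 < C ∧ ∀ t : ℝ, 0 < t →
      IntegrableOn (fun s => (t - s) ^ (-a) * s ^ (-b)) (Set.Ioo 0 t) volume ∧
        ∫ s in Set.Ioo 0 t, (t - s) ^ (-a) * s ^ (-b) ≤ C * t ^ (1 - a - b) := by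
  have ha' : 0 < 1 - a := by linarith
  have hb' : 0 < 1 - b := by linarith
  refine ⟨2 ^ a / (1 - b) + 2 ^ b / (1 - a), by positivity, fun t ht => ?_⟩
  have i1 : IntervalIntegrable (fun s : ℝ => s ^ (-b)) volume 0 t :=
    intervalIntegral.intervalIntegrable_rpow' (by linarith)
  have i2' : IntervalIntegrable (fun s : ℝ => s ^ (-a)) volume 0 t :=
    intervalIntegral.intervalIntegrable_rpow' (by linarith)
  have i2 : IntervalIntegrable (fun s : ℝ => (t - s) ^ (-a)) volume 0 t := by
    have := (i2'.comp_sub_left t).symm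
    simpa using this
  have v1 : ∫ s in (0 : ℝ)..t, s ^ (-b) = t ^ (1 - b) / (1 - b) := by
    rw [integral_rpow (Or.inl (by linarith)), show -b + 1 = 1 - b by ring,
      Real.zero_rpow hb'.ne', sub_zero]
  have v2 : ∫ s in (0 : ℝ)..t, (t - s) ^ (-a) = t ^ (1 - a) / (1 - a) := by
    rw [intervalIntegral.integral_comp_sub_left (fun s => s ^ (-a)) t, sub_self, sub_zero,
      integral_rpow (Or.inl (by linarith)), show -a + 1 = 1 - a by ring,
      Real.zero_rpow ha'.ne', sub_zero]
  -- On each half of the interval one of the two factors is bounded.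
  set g : ℝ → ℝ := fun s => (t / 2) ^ (-a) * s ^ (-b) + (t / 2) ^ (-b) * (t - s) ^ (-a) with hg
  have ig : IntervalIntegrable g volume 0 t := (i1.const_mul _).add (i2.const_mul _)
  have vg : ∫ s in (0 : ℝ)..t, g s = (2 ^ a / (1 - b) + 2 ^ b / (1 - a)) * t ^ (1 - a - b) := by
    rw [hg, intervalIntegral.integral_add (i1.const_mul _) (i2.const_mul _),
      intervalIntegral.integral_const_mul, intervalIntegral.integral_const_mul, v1, v2,
      Real.div_rpow ht.le two_pos.le, Real.div_rpow ht.le two_pos.le,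
      Real.rpow_neg two_pos.le, Real.rpow_neg two_pos.le]
    have e1 : t ^ (1 - a - b) = t ^ (-a) * t ^ (1 - b) := by
      rw [← Real.rpow_add ht]; ring_nf
    have e2 : t ^ (1 - a - b) = t ^ (-b) * t ^ (1 - a) := by
      rw [← Real.rpow_add ht]; ring_nf
    rw [add_mul]
    nth_rw 1 [e1]
    rw [e2]
    have h2a : (2 : ℝ) ^ a ≠ 0 := by positivity
    have h2b : (2 : ℝ) ^ b ≠ 0 := by positivity
    field_simp
  have hle : ∀ s ∈ Set.Ioo 0 t, (t - s) ^ (-a) * s ^ (-b) ≤ g s := by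
    intro s hs
    have h0 : 0 ≤ t - s := by linarith [hs.2]
    have hs0 : 0 < s := hs.1
    have p1 : 0 ≤ (t / 2) ^ (-a) * s ^ (-b) := by positivity
    have p2 : 0 ≤ (t / 2) ^ (-b) * (t - s) ^ (-a) := by positivity
    rcases le_total s (t / 2) with h | h
    · have : (t - s) ^ (-a) ≤ (t / 2) ^ (-a) :=
        Real.rpow_le_rpow_of_nonpos (by positivity) (by linarith) (by linarith)
      calc _ ≤ (t / 2) ^ (-a) * s ^ (-b) := by gcongr
        _ ≤ g s := le_add_of_nonneg_right p2
    · have : s ^ (-b) ≤ (t / 2) ^ (-b) :=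
        Real.rpow_le_rpow_of_nonpos (by positivity) h (by linarith)
      calc _ ≤ (t - s) ^ (-a) * (t / 2) ^ (-b) := by gcongr
        _ = (t / 2) ^ (-b) * (t - s) ^ (-a) := mul_comm _ _
        _ ≤ g s := le_add_of_nonneg_left p1
  have ig' : IntegrableOn g (Set.Ioo 0 t) volume :=
    (intervalIntegrable_iff_integrableOn_Ioo_of_le ht.le).1 ig
  have hi : IntegrableOn (fun s => (t - s) ^ (-a) * s ^ (-b)) (Set.Ioo 0 t) volume := by
    refine Integrable.mono' ig' ?_ ?_
    · exact (((measurable_const.sub measurable_id).pow_const _).mul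
        (measurable_id.pow_const _)).aestronglyMeasurable
    · refine (ae_restrict_iff' measurableSet_Ioo).2 (ae_of_all _ fun s hs => ?_)
      have h0 : 0 ≤ t - s := by linarith [hs.2]
      have hs0 : 0 < s := hs.1
      rw [Real.norm_eq_abs, abs_of_nonneg (by positivity)]
      exact hle s hs
  refine ⟨hi, ?_⟩
  rw [← vg, intervalIntegral.integral_of_le ht.le, integral_Ioc_eq_integral_Ioo]
  exact setIntegral_mono_on hi ig' measurableSet_Ioo hle

/-- Parabolic smoothing, in scalar form. -/
lemma exp_neg_le_rpow {c a x : ℝ} (hc : 0 < c) (ha0 : 0 ≤ a) (ha : a ≤ 1) (hx : 0 < x) :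
    Real.exp (-(c * x)) ≤ (1 + 1 / c) * x ^ (-a) := by
  have h1 : x ^ a ≤ 1 + x := by
    rcases le_total x 1 with h | h
    · linarith [Real.rpow_le_one hx.le h ha0]
    · have := Real.rpow_le_rpow_of_exponent_le h ha
      rw [Real.rpow_one] at this
      linarith
  have h2 : 1 + x ≤ (1 + 1 / c) * Real.exp (c * x) := by
    have h3 : 1 ≤ Real.exp (c * x) := Real.one_le_exp (by positivity)
    have h4 : c * x ≤ Real.exp (c * x) := by linarith [Real.add_one_le_exp (c * x)]
    have h5 : x ≤ 1 / c * Real.exp (c * x) := by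
      rw [one_div, inv_mul_eq_div, le_div_iff₀' hc]
      exact h4
    linarith
  rw [Real.exp_neg, Real.rpow_neg hx.le, ← div_eq_mul_inv, le_div_iff₀ (by positivity),
    inv_mul_eq_div, div_le_iff₀ (Real.exp_pos _)]
  exact h1.trans h2

/-- The exponential weight `e^{θ√t r}` is absorbed by half of the parabolic decay. -/
lemma exp_weight_le {c θ r s t : ℝ} (hc : 0 ≤ c) (hθ0 : 0 ≤ θ) (hθ : θ ≤ c) (hr : 0 ≤ r)
    (hs : 0 ≤ s) (hst : s ≤ t) :
    Real.exp (-(2 * c) * (t - s) * r ^ 2) * Real.exp (-(θ * Real.sqrt s * r)) ≤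
      Real.exp c * Real.exp (-(c * ((t - s) * r ^ 2))) * Real.exp (-(θ * Real.sqrt t * r)) := by
  rw [← Real.exp_add, ← Real.exp_add, ← Real.exp_add, Real.exp_le_exp]
  set τ := t - s with hτ
  have hτ0 : 0 ≤ τ := by linarith
  have h1 : Real.sqrt t ≤ Real.sqrt s + Real.sqrt τ := by
    refine Real.sqrt_le_iff.2 ⟨by positivity, ?_⟩
    rw [add_sq, Real.sq_sqrt hs, Real.sq_sqrt hτ0]
    have : 0 ≤ 2 * Real.sqrt s * Real.sqrt τ := by positivity
    linarith
  have h2 : Real.sqrt τ * r ≤ 1 + τ * r ^ 2 := by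
    have : (Real.sqrt τ * r) ^ 2 = τ * r ^ 2 := by rw [mul_pow, Real.sq_sqrt hτ0]
    nlinarith [sq_nonneg (Real.sqrt τ * r - 1), mul_nonneg (Real.sqrt_nonneg τ) hr]
  have h3 : θ * (Real.sqrt τ * r) ≤ c * (1 + τ * r ^ 2) := by gcongr
  have h4 : θ * r * Real.sqrt t ≤ θ * r * (Real.sqrt s + Real.sqrt τ) := by gcongr
  linarith

end TimeIntegral

/-! ### The Duhamel term -/

section Duhamel

variable {d : ℕ} {μ ν κ α c q β : ℝ}

/-- The weight `t^{-q} ‖ξ‖^{-β} e^{-θ√t‖ξ‖}`: bounds by multiples of it describe balls of the Kato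
space for `θ = 0`, and of its analytic analogue for `θ > 0`. -/
noncomputable def weight (q β θ t : ℝ) (ξ : Space d) : ℝ :=
  t ^ (-q) * (‖ξ‖ ^ (-β) * Real.exp (-(θ * Real.sqrt t * ‖ξ‖)))

lemma weight_nonneg {q β θ t : ℝ} (ht : 0 ≤ t) (ξ : Space d) : 0 ≤ weight q β θ t ξ := by
  unfold weight
  positivity

/-- Parabolic smoothing gains `2 - 2q` powers of the frequency, which turns the order
`2β - 1 - d` of the nonlinearity into the order `β` of the solution. -/
lemma exists_kernel_le (hc : 0 < c) (hq : 0 < q) (hq1 : q < 1 / 2) (hβ : β = d - 1 + 2 * q) :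
    ∃ K : ℝ, 0 < K ∧ ∀ θ s t r : ℝ, 0 ≤ θ → θ ≤ c → 0 < s → s < t → 0 < r →
      Real.exp (-(2 * c) * (t - s) * r ^ 2) *
          (s ^ (-(2 * q)) * (r ^ (-(2 * β - 1 - d)) * Real.exp (-(θ * Real.sqrt s * r)))) ≤
        K * ((t - s) ^ (-(1 - q)) * s ^ (-(2 * q))) *
          (r ^ (-β) * Real.exp (-(θ * Real.sqrt t * r))) := by
  refine ⟨Real.exp c * (1 + 1 / c), by positivity, fun θ s t r hθ0 hθ hs hst hr => ?_⟩
  have hτ : 0 < t - s := by linarith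
  have h1 := exp_weight_le hc.le hθ0 hθ hr.le hs.le hst.le
  have h2 := exp_neg_le_rpow (a := 1 - q) hc (by linarith) (by linarith)
    (by positivity : 0 < (t - s) * r ^ 2)
  have e2 : ((t - s) * r ^ 2) ^ (-(1 - q)) =
      (t - s) ^ (-(1 - q)) * r ^ (((2 : ℕ) : ℝ) * -(1 - q)) := by
    rw [Real.mul_rpow hτ.le (by positivity), ← Real.rpow_natCast, ← Real.rpow_mul hr.le]
  rw [e2] at h2
  have e : r ^ (-β) = r ^ (((2 : ℕ) : ℝ) * -(1 - q)) * r ^ (-(2 * β - 1 - d)) := by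
    rw [← Real.rpow_add hr, hβ]
    congr 1
    push_cast
    ring
  rw [e]
  calc _ = (Real.exp (-(2 * c) * (t - s) * r ^ 2) * Real.exp (-(θ * Real.sqrt s * r))) *
        (s ^ (-(2 * q)) * r ^ (-(2 * β - 1 - d))) := by ring
    _ ≤ (Real.exp c * Real.exp (-(c * ((t - s) * r ^ 2))) * Real.exp (-(θ * Real.sqrt t * r))) *
        (s ^ (-(2 * q)) * r ^ (-(2 * β - 1 - d))) := by gcongr
    _ ≤ (Real.exp c * ((1 + 1 / c) * ((t - s) ^ (-(1 - q)) * r ^ (((2 : ℕ) : ℝ) * -(1 - q)))) *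
        Real.exp (-(θ * Real.sqrt t * r))) *
        (s ^ (-(2 * q)) * r ^ (-(2 * β - 1 - d))) := by gcongr
    _ = _ := by ring

lemma tripleNorm_setIntegral_le (ξ : Space d) {S : Set ℝ} (hS : MeasurableSet S)
    {G : ℝ → Unit ⊕ Fin d → ℂ} {g : ℝ → ℝ} (hg : IntegrableOn g S volume)
    (h : ∀ s ∈ S, tripleNorm ξ (G s) ≤ g s) :
    tripleNorm ξ (∫ s in S, G s) ≤ ∫ s in S, g s := by
  have hae : ∀ᵐ s ∂volume.restrict S, ‖tripleMap ξ (G s)‖ ≤ g s :=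
    (ae_restrict_iff' hS).2 (ae_of_all _ fun s hs => by rw [norm_tripleMap]; exact h s hs)
  by_cases hG : IntegrableOn G S volume
  · rw [← norm_tripleMap, ← ContinuousLinearMap.integral_comp_comm _ hG]
    exact norm_integral_le_of_norm_le hg hae
  · -- The integral of a function that is not integrable is `0` by convention.
    rw [integral_undef hG, tripleNorm_zero]
    exact setIntegral_nonneg hS fun s hs => (tripleNorm_nonneg ξ _).trans (h s hs)

lemma integrableOn_of_tripleNorm_le (ξ : Space d) {S : Set ℝ} (hS : MeasurableSet S)
    {G : ℝ → Unit ⊕ Fin d → ℂ} {g : ℝ → ℝ} (hg : IntegrableOn g S volume)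
    (hG : AEStronglyMeasurable G (volume.restrict S)) (h : ∀ s ∈ S, tripleNorm ξ (G s) ≤ g s) :
    IntegrableOn G S volume :=
  hg.mono' hG ((ae_restrict_iff' hS).2 (ae_of_all _ fun s hs =>
    (norm_le_tripleNorm ξ _).trans (h s hs)))

/-- The pointwise decay estimate of the semigroup with constant `C` and rate `2c`. -/
def SemigroupDecay (d : ℕ) (μ ν κ α c C : ℝ) : Prop :=
  ∀ t : ℝ, 0 ≤ t → ∀ (ξ : Space d) (w : Unit ⊕ Fin d → ℂ),
    tripleNorm ξ (semigroup μ ν κ α t ξ *ᵥ w) ≤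
      C * Real.exp (-(2 * c) * t * ‖ξ‖ ^ 2) * tripleNorm ξ w

/-- Contribution of the initial data. -/
theorem exists_semigroup_data_le {C : ℝ} (hC : 0 < C) (hdec : SemigroupDecay d μ ν κ α c C)
    (hc : 0 < c) (hq : 0 < q) (hq1 : q < 1 / 2) (hβ : β = d - 1 + 2 * q) :
    ∃ K : ℝ, 0 < K ∧ ∀ θ ρ t : ℝ, 0 ≤ θ → θ ≤ c → 0 ≤ ρ → 0 < t → ∀ ξ : Space d, ξ ≠ 0 →
      ∀ w, tripleNorm ξ w ≤ ρ * ‖ξ‖ ^ (-((d : ℝ) - 1)) →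
        tripleNorm ξ (semigroup μ ν κ α t ξ *ᵥ w) ≤ K * ρ * weight q β θ t ξ := by
  refine ⟨C * (Real.exp c * (1 + 1 / c)), by positivity,
    fun θ ρ t hθ0 hθ hρ ht ξ hξ w hw => ?_⟩
  have hr : 0 < ‖ξ‖ := norm_pos_iff.2 hξ
  refine (hdec t ht.le ξ w).trans ?_
  have h1 := exp_weight_le hc.le hθ0 hθ hr.le le_rfl ht.le
  rw [Real.sqrt_zero, mul_zero, zero_mul, neg_zero, Real.exp_zero, mul_one, sub_zero] at h1
  have h2 := exp_neg_le_rpow (a := q) hc (by linarith) (by linarith)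
    (by positivity : 0 < t * ‖ξ‖ ^ 2)
  have e2 : (t * ‖ξ‖ ^ 2) ^ (-q) = t ^ (-q) * ‖ξ‖ ^ (((2 : ℕ) : ℝ) * -q) := by
    rw [Real.mul_rpow ht.le (by positivity), ← Real.rpow_natCast ‖ξ‖, ← Real.rpow_mul hr.le]
  rw [e2] at h2
  have hw0 := tripleNorm_nonneg ξ w
  have e : ‖ξ‖ ^ (-β) = ‖ξ‖ ^ (((2 : ℕ) : ℝ) * -q) * ‖ξ‖ ^ (-((d : ℝ) - 1)) := by
    rw [← Real.rpow_add hr, hβ]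
    congr 1
    push_cast
    ring
  rw [weight, e]
  calc _ ≤ C * (Real.exp c * Real.exp (-(c * (t * ‖ξ‖ ^ 2))) *
        Real.exp (-(θ * Real.sqrt t * ‖ξ‖))) * (ρ * ‖ξ‖ ^ (-((d : ℝ) - 1))) := by gcongr
    _ ≤ C * (Real.exp c * ((1 + 1 / c) * (t ^ (-q) * ‖ξ‖ ^ (((2 : ℕ) : ℝ) * -q))) *
        Real.exp (-(θ * Real.sqrt t * ‖ξ‖))) * (ρ * ‖ξ‖ ^ (-((d : ℝ) - 1))) := by gcongr
    _ = _ := by ring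

lemma semigroup_forcing_le {C K B θ s t : ℝ} (hC : 0 < C)
    (hdec : SemigroupDecay d μ ν κ α c C) (hB : 0 ≤ B) (hst : s < t) {ξ : Space d}
    {w : Unit ⊕ Fin d → ℂ}
    (hK : Real.exp (-(2 * c) * (t - s) * ‖ξ‖ ^ 2) * (s ^ (-(2 * q)) * (‖ξ‖ ^ (-(2 * β - 1 - d)) *
        Real.exp (-(θ * Real.sqrt s * ‖ξ‖)))) ≤
      K * ((t - s) ^ (-(1 - q)) * s ^ (-(2 * q))) *
        (‖ξ‖ ^ (-β) * Real.exp (-(θ * Real.sqrt t * ‖ξ‖))))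
    (hw : tripleNorm ξ w ≤ B * (s ^ (-(2 * q)) * (‖ξ‖ ^ (-(2 * β - 1 - d)) *
        Real.exp (-(θ * Real.sqrt s * ‖ξ‖))))) :
    tripleNorm ξ (semigroup μ ν κ α (t - s) ξ *ᵥ w) ≤
      C * K * B * (‖ξ‖ ^ (-β) * Real.exp (-(θ * Real.sqrt t * ‖ξ‖))) *
        ((t - s) ^ (-(1 - q)) * s ^ (-(2 * q))) := by
  refine (hdec (t - s) (by linarith) ξ w).trans ?_
  calc _ ≤ C * Real.exp (-(2 * c) * (t - s) * ‖ξ‖ ^ 2) * (B * (s ^ (-(2 * q)) *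
        (‖ξ‖ ^ (-(2 * β - 1 - d)) * Real.exp (-(θ * Real.sqrt s * ‖ξ‖))))) := by gcongr
    _ = C * B * (Real.exp (-(2 * c) * (t - s) * ‖ξ‖ ^ 2) * (s ^ (-(2 * q)) *
        (‖ξ‖ ^ (-(2 * β - 1 - d)) * Real.exp (-(θ * Real.sqrt s * ‖ξ‖))))) := by ring
    _ ≤ C * B * (K * ((t - s) ^ (-(1 - q)) * s ^ (-(2 * q))) *
        (‖ξ‖ ^ (-β) * Real.exp (-(θ * Real.sqrt t * ‖ξ‖)))) := by gcongr
    _ = _ := by ring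

/-- A profile whose bound in time and frequency is that of the nonlinearity contributes a multiple
of the weight through the Duhamel integral. The bound does not require measurability of `F`; with
measurability the integral converges. The last statement controls the integral over a short final
time interval. -/
theorem exists_duhamel_le {C : ℝ} (hC : 0 < C) (hdec : SemigroupDecay d μ ν κ α c C)
    (hc : 0 < c) (hq : 0 < q) (hq1 : q < 1 / 2) (hβ : β = d - 1 + 2 * q) :
    ∃ K : ℝ, 0 < K ∧ ∀ θ B t : ℝ, 0 ≤ θ → θ ≤ c → 0 ≤ B → 0 < t → ∀ ξ : Space d, ξ ≠ 0 →
      ∀ F : ℝ → Unit ⊕ Fin d → ℂ,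
      (∀ s ∈ Set.Ioo 0 t, tripleNorm ξ (F s) ≤ B * (s ^ (-(2 * q)) *
        (‖ξ‖ ^ (-(2 * β - 1 - d)) * Real.exp (-(θ * Real.sqrt s * ‖ξ‖))))) →
      tripleNorm ξ (∫ s in Set.Ioo 0 t, semigroup μ ν κ α (t - s) ξ *ᵥ F s) ≤
          K * B * weight q β θ t ξ ∧
        (AEStronglyMeasurable (fun s => semigroup μ ν κ α (t - s) ξ *ᵥ F s)
          (volume.restrict (Set.Ioo 0 t)) →
            IntegrableOn (fun s => semigroup μ ν κ α (t - s) ξ *ᵥ F s) (Set.Ioo 0 t) volume) ∧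
        ∀ t₀ ∈ Set.Ioo 0 t,
          tripleNorm ξ (∫ s in Set.Ioo t₀ t, semigroup μ ν κ α (t - s) ξ *ᵥ F s) ≤
            K * B * (t₀ ^ (-(2 * q)) * (t - t₀) ^ q) * ‖ξ‖ ^ (-β) := by
  obtain ⟨K₁, hK₁, h₁⟩ := exists_kernel_le (d := d) (β := β) hc hq hq1 hβ
  obtain ⟨K₂, hK₂, h₂⟩ := exists_integral_rpow_mul_rpow_le (a := 1 - q) (b := 2 * q) (by linarith)
    (by linarith) (by linarith) (by linarith)
  obtain ⟨K₃, hK₃, h₃⟩ := exists_integral_rpow_mul_rpow_le (a := 1 - q) (b := 0) (by linarith)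
    (by linarith) le_rfl (by linarith)
  refine ⟨C * K₁ * (K₂ + K₃), by positivity, fun θ B t hθ0 hθ hB ht ξ hξ F hF => ?_⟩
  have hr : 0 < ‖ξ‖ := norm_pos_iff.2 hξ
  obtain ⟨hi, hI⟩ := h₂ t ht
  set M := C * K₁ * B * (‖ξ‖ ^ (-β) * Real.exp (-(θ * Real.sqrt t * ‖ξ‖))) with hM
  have hM0 : 0 ≤ M := by positivity
  have hb : ∀ s ∈ Set.Ioo 0 t, tripleNorm ξ (semigroup μ ν κ α (t - s) ξ *ᵥ F s) ≤
      M * ((t - s) ^ (-(1 - q)) * s ^ (-(2 * q))) := fun s hs =>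
    semigroup_forcing_le hC hdec hB hs.2 (h₁ θ s t ‖ξ‖ hθ0 hθ hs.1 hs.2 hr) (hF s hs)
  have hgi : IntegrableOn (fun s => M * ((t - s) ^ (-(1 - q)) * s ^ (-(2 * q)))) (Set.Ioo 0 t)
    volume := hi.const_mul M
  refine ⟨?_, fun hm => integrableOn_of_tripleNorm_le ξ measurableSet_Ioo hgi hm hb,
    fun t₀ ht₀ => ?_⟩
  · refine (tripleNorm_setIntegral_le ξ measurableSet_Ioo hgi hb).trans ?_
    rw [integral_const_mul]
    have hE : 0 ≤ K₃ * (C * K₁ * B * weight q β θ t ξ) := by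
      have := weight_nonneg (q := q) (β := β) (θ := θ) ht.le ξ
      positivity
    calc M * _ ≤ M * (K₂ * t ^ (1 - (1 - q) - 2 * q)) := by gcongr
      _ = K₂ * (C * K₁ * B * weight q β θ t ξ) := by
        rw [hM, weight, show 1 - (1 - q) - 2 * q = -q by ring]
        ring
      _ ≤ _ := by linarith
  · have ht₀' : 0 < t - t₀ := by linarith [ht₀.2]
    obtain ⟨hi3, hI3⟩ := h₃ (t - t₀) ht₀'
    -- On the final interval the factor `s ^ (-2q)` is at most `t₀ ^ (-2q)`.
    set N := C * K₁ * B * ‖ξ‖ ^ (-β) * t₀ ^ (-(2 * q)) with hN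
    have hN0 : 0 ≤ N := by
      have := ht₀.1
      positivity
    have hshift : (fun s => N * (((t - t₀) - (s - t₀)) ^ (-(1 - q)) * (s - t₀) ^ (-(0 : ℝ)))) =
        fun s => N * (t - s) ^ (-(1 - q)) := by
      ext s
      simp
    have e0 : (fun s : ℝ => s - t₀) ⁻¹' Set.Ioo 0 (t - t₀) = Set.Ioo t₀ t := by simp
    have hmp := measurePreserving_sub_right (volume : Measure ℝ) t₀
    have hme : MeasurableEmbedding fun s : ℝ => s - t₀ := measurableEmbedding_subRight t₀
    have hi4 : IntegrableOn (fun s => N * (t - s) ^ (-(1 - q))) (Set.Ioo t₀ t) volume := by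
      have := (hmp.integrableOn_comp_preimage hme).2 (hi3.const_mul N)
      rw [e0] at this
      rw [← hshift]
      exact this
    have hI4 : ∫ s in Set.Ioo t₀ t, N * (t - s) ^ (-(1 - q)) =
        N * ∫ s in Set.Ioo 0 (t - t₀), ((t - t₀) - s) ^ (-(1 - q)) * s ^ (-(0 : ℝ)) := by
      rw [← integral_const_mul, ← hmp.setIntegral_preimage_emb hme
        (fun s => N * (((t - t₀) - s) ^ (-(1 - q)) * s ^ (-(0 : ℝ)))), e0, ← hshift]
    have hb' : ∀ s ∈ Set.Ioo t₀ t, tripleNorm ξ (semigroup μ ν κ α (t - s) ξ *ᵥ F s) ≤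
        N * (t - s) ^ (-(1 - q)) := by
      intro s hs
      have hs0 : 0 < s := ht₀.1.trans hs.1
      have hτ : 0 < t - s := by linarith [hs.2]
      refine (hb s ⟨hs0, hs.2⟩).trans ?_
      have e1 : s ^ (-(2 * q)) ≤ t₀ ^ (-(2 * q)) :=
        Real.rpow_le_rpow_of_nonpos ht₀.1 hs.1.le (by linarith)
      have e2 : Real.exp (-(θ * Real.sqrt t * ‖ξ‖)) ≤ 1 := by
        rw [Real.exp_le_one_iff]
        have : 0 ≤ θ * Real.sqrt t * ‖ξ‖ := by positivity
        linarith
      calc M * ((t - s) ^ (-(1 - q)) * s ^ (-(2 * q))) ≤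
          (C * K₁ * B * (‖ξ‖ ^ (-β) * 1)) * ((t - s) ^ (-(1 - q)) * t₀ ^ (-(2 * q))) := by
            rw [hM]
            gcongr
        _ = _ := by
            rw [hN]
            ring
    refine (tripleNorm_setIntegral_le ξ measurableSet_Ioo hi4 hb').trans ?_
    rw [hI4]
    have hE : 0 ≤ K₂ * (C * K₁ * B * (t₀ ^ (-(2 * q)) * (t - t₀) ^ q) * ‖ξ‖ ^ (-β)) := by
      have := ht₀.1
      positivity
    calc N * _ ≤ N * (K₃ * (t - t₀) ^ (1 - (1 - q) - 0)) := by gcongr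
      _ = K₃ * (C * K₁ * B * (t₀ ^ (-(2 * q)) * (t - t₀) ^ q) * ‖ξ‖ ^ (-β)) := by
        rw [hN, show 1 - (1 - q) - 0 = q by ring]
        ring
      _ ≤ _ := by linarith

end Duhamel

/-! ### The integral equation for profiles -/

section IntegralEquation

variable {d : ℕ} {μ ν κ α c q β θ L : ℝ}

/-- The Lipschitz estimate, with constant `L`, of the map which sends a profile `φ` to the Duhamel
integral of its nonlinearity, in the weighted norms with exponential weight `e^{θ√t‖ξ‖}`. No
measurability in time is required for the bounds. -/
def DuhamelLipschitz (d : ℕ) (μ ν κ α q β θ L : ℝ) : Prop :=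
  ∀ A D : ℝ, 0 ≤ A → 0 ≤ D → ∀ φ ψ : ℝ → Space d → Unit ⊕ Fin d → ℂ,
    (∀ s, 0 < s → ∀ i, AEStronglyMeasurable (fun η => φ s η i) volume) →
    (∀ s, 0 < s → ∀ i, AEStronglyMeasurable (fun η => ψ s η i) volume) →
    (∀ s, 0 < s → HasTripleBound (θ * Real.sqrt s) β (A * s ^ (-q)) (φ s)) →
    (∀ s, 0 < s → HasTripleBound (θ * Real.sqrt s) β (A * s ^ (-q)) (ψ s)) →
    (∀ s, 0 < s → HasTripleBound (θ * Real.sqrt s) β (D * s ^ (-q)) fun η => φ s η - ψ s η) →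
    ∀ t, 0 < t → ∀ ξ : Space d, ξ ≠ 0 →
      tripleNorm ξ (∫ s in Set.Ioo 0 t, semigroup μ ν κ α (t - s) ξ *ᵥ
          (nonlin μ ν κ (φ s) ξ - nonlin μ ν κ (ψ s) ξ)) ≤ L * (A * D) * weight q β θ t ξ ∧
        (AEStronglyMeasurable (fun s => semigroup μ ν κ α (t - s) ξ *ᵥ
            (nonlin μ ν κ (φ s) ξ - nonlin μ ν κ (ψ s) ξ)) (volume.restrict (Set.Ioo 0 t)) →
          IntegrableOn (fun s => semigroup μ ν κ α (t - s) ξ *ᵥ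
            (nonlin μ ν κ (φ s) ξ - nonlin μ ν κ (ψ s) ξ)) (Set.Ioo 0 t) volume) ∧
        ∀ t₀ ∈ Set.Ioo 0 t,
          tripleNorm ξ (∫ s in Set.Ioo t₀ t, semigroup μ ν κ α (t - s) ξ *ᵥ
            (nonlin μ ν κ (φ s) ξ - nonlin μ ν κ (ψ s) ξ)) ≤
            L * (A * D) * (t₀ ^ (-(2 * q)) * (t - t₀) ^ q) * ‖ξ‖ ^ (-β)

theorem exists_duhamelLipschitz (hd : 0 < d) {C : ℝ} (hC : 0 < C)
    (hdec : SemigroupDecay d μ ν κ α c C) (hc : 0 < c) (hq : 0 < q) (hq1 : q < 1 / 2)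
    (hβ : β = d - 1 + 2 * q) (hβ2 : (d : ℝ) + 1 < 2 * β) :
    ∃ L : ℝ, 0 < L ∧ ∀ θ, 0 ≤ θ → θ ≤ c → DuhamelLipschitz d μ ν κ α q β θ L := by
  obtain ⟨K, hK, h₁⟩ := exists_duhamel_le (β := β) hC hdec hc hq hq1 hβ
  obtain ⟨N, hN, h₂⟩ := exists_nonlin_sub_le (d := d) (β := β) hd μ ν κ (by linarith) hβ2
  refine ⟨K * N, by positivity, ?_⟩
  intro θ hθ0 hθ A D hA hD φ ψ mφ mψ hφ hψ hφψ t ht ξ hξ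
  have hF : ∀ s ∈ Set.Ioo 0 t, tripleNorm ξ (nonlin μ ν κ (φ s) ξ - nonlin μ ν κ (ψ s) ξ) ≤
      N * (A * D) * (s ^ (-(2 * q)) * (‖ξ‖ ^ (-(2 * β - 1 - d)) *
        Real.exp (-(θ * Real.sqrt s * ‖ξ‖)))) := by
    intro s hs
    have hs0 : 0 < s := hs.1
    refine (h₂ (θ * Real.sqrt s) (A * s ^ (-q)) (D * s ^ (-q)) (by positivity) (by positivity)
      (by positivity) (φ s) (ψ s) (mφ s hs0) (mψ s hs0) (hφ s hs0) (hψ s hs0) (hφψ s hs0) ξ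
      hξ).trans (le_of_eq ?_)
    rw [show -(2 * q) = -q + -q by ring, Real.rpow_add hs0]
    ring
  obtain ⟨a1, a2, a3⟩ := h₁ θ (N * (A * D)) t hθ0 hθ (by positivity) ht ξ hξ _ hF
  refine ⟨a1.trans (le_of_eq (by ring)), a2, fun t₀ ht₀ => (a3 t₀ ht₀).trans (le_of_eq (by ring))⟩

/-- The ball of radius `K` in the weighted space: an everywhere bound off the zero frequency. -/
def ProfileBound (q β θ K : ℝ) (φ : ℝ → Space d → Unit ⊕ Fin d → ℂ) : Prop :=
  ∀ t, 0 < t → ∀ ξ, ξ ≠ 0 → tripleNorm ξ (φ t ξ) ≤ K * weight q β θ t ξ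

lemma ProfileBound.hasTripleBound (hd : 0 < d) {K : ℝ} {φ : ℝ → Space d → Unit ⊕ Fin d → ℂ}
    (h : ProfileBound q β θ K φ) {s : ℝ} (hs : 0 < s) :
    HasTripleBound (θ * Real.sqrt s) β (K * s ^ (-q)) (φ s) := by
  filter_upwards [ae_ne_zero hd] with ξ hξ
  refine (h s hs ξ hξ).trans (le_of_eq ?_)
  rw [weight]
  ring

lemma aestronglyMeasurable_apply {φ : ℝ → Space d → Unit ⊕ Fin d → ℂ}
    (hφ : Measurable fun z : ℝ × Space d => φ z.1 z.2) (s : ℝ) (i : Unit ⊕ Fin d) :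
    AEStronglyMeasurable (fun η => φ s η i) volume :=
  ((measurable_pi_apply i).comp (hφ.comp measurable_prodMk_left)).aestronglyMeasurable

lemma measurable_semigroup_mulVec {X : Type*} [MeasurableSpace X] {τ : X → ℝ} {ζ : X → Space d}
    {F : X → Unit ⊕ Fin d → ℂ} (hτ : Measurable τ) (hζ : Measurable ζ) (hF : Measurable F) :
    Measurable fun x => semigroup μ ν κ α (τ x) (ζ x) *ᵥ F x := by
  have hW : ∀ i j, Measurable fun x => semigroup μ ν κ α (τ x) (ζ x) i j := fun i j =>
    (continuous_semigroup.matrix_elem i j).measurable.comp (hτ.prodMk hζ)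
  refine measurable_pi_iff.2 fun i => ?_
  simp only [Matrix.mulVec, dotProduct]
  exact Finset.measurable_sum _ fun j _ => (hW i j).mul ((measurable_pi_apply j).comp hF)

lemma measurable_duhamel_integrand (μ ν κ α : ℝ) {φ : ℝ → Space d → Unit ⊕ Fin d → ℂ}
    (hφ : Measurable fun z : ℝ × Space d => φ z.1 z.2) :
    Measurable fun y : (ℝ × Space d) × ℝ =>
      semigroup μ ν κ α (y.1.1 - y.2) y.1.2 *ᵥ nonlin μ ν κ (φ y.2) y.1.2 :=
  measurable_semigroup_mulVec (by fun_prop) (by fun_prop)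
    ((measurable_nonlin μ ν κ hφ).comp (f := fun y : (ℝ × Space d) × ℝ => (y.2, y.1.2))
      (by fun_prop))

lemma integrableOn_duhamel (hd : 0 < d) (hLip : DuhamelLipschitz d μ ν κ α q β θ L) {K : ℝ}
    (hK : 0 ≤ K) {φ : ℝ → Space d → Unit ⊕ Fin d → ℂ}
    (hφm : Measurable fun z : ℝ × Space d => φ z.1 z.2) (hφ : ProfileBound q β θ K φ) {t : ℝ}
    (ht : 0 < t) {ξ : Space d} (hξ : ξ ≠ 0) :
    IntegrableOn (fun s => semigroup μ ν κ α (t - s) ξ *ᵥ nonlin μ ν κ (φ s) ξ) (Set.Ioo 0 t)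
      volume := by
  have h := hLip K K hK hK φ (fun _ => 0) (fun s _ i => aestronglyMeasurable_apply hφm s i)
    (fun s _ i => aestronglyMeasurable_const) (fun s hs => hφ.hasTripleBound hd hs)
    (fun s hs => ae_of_all _ fun η => by
      simp only [Pi.zero_apply, tripleNorm_zero]
      positivity)
    (fun s hs => by simpa using hφ.hasTripleBound hd hs) t ht ξ hξ
  simp only [nonlin_zero, Pi.zero_apply, sub_zero] at h
  exact h.2.1 ((measurable_duhamel_integrand μ ν κ α hφm).comp
    (measurable_prodMk_left (x := (t, ξ)))).aestronglyMeasurable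

open scoped Classical in
/-- The right-hand side of the integral equation for Fourier profiles, set to zero where it is
irrelevant (`t ≤ 0` or `ξ = 0`). -/
noncomputable def picardMap (μ ν κ α : ℝ) (w₀ : Space d → Unit ⊕ Fin d → ℂ)
    (φ : ℝ → Space d → Unit ⊕ Fin d → ℂ) (t : ℝ) (ξ : Space d) : Unit ⊕ Fin d → ℂ :=
  if 0 < t ∧ ξ ≠ 0 then semigroup μ ν κ α t ξ *ᵥ w₀ ξ +
    ∫ s in Set.Ioo 0 t, semigroup μ ν κ α (t - s) ξ *ᵥ nonlin μ ν κ (φ s) ξ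
  else 0

lemma picardMap_of_pos {w₀ : Space d → Unit ⊕ Fin d → ℂ} {φ : ℝ → Space d → Unit ⊕ Fin d → ℂ}
    {t : ℝ} (ht : 0 < t) {ξ : Space d} (hξ : ξ ≠ 0) :
    picardMap μ ν κ α w₀ φ t ξ = semigroup μ ν κ α t ξ *ᵥ w₀ ξ +
      ∫ s in Set.Ioo 0 t, semigroup μ ν κ α (t - s) ξ *ᵥ nonlin μ ν κ (φ s) ξ :=
  if_pos ⟨ht, hξ⟩

lemma measurable_picardMap {w₀ : Space d → Unit ⊕ Fin d → ℂ} (hw₀ : Measurable w₀)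
    {φ : ℝ → Space d → Unit ⊕ Fin d → ℂ} (hφ : Measurable fun z : ℝ × Space d => φ z.1 z.2) :
    Measurable fun z : ℝ × Space d => picardMap μ ν κ α w₀ φ z.1 z.2 := by
  unfold picardMap
  refine Measurable.ite ?_ (Measurable.add ?_ ?_) measurable_const
  · exact (measurableSet_lt measurable_const measurable_fst).inter
      ((measurableSet_singleton (0 : Space d)).compl.preimage measurable_snd)
  · exact measurable_semigroup_mulVec measurable_fst measurable_snd (hw₀.comp measurable_snd)
  · have hS : MeasurableSet {y : (ℝ × Space d) × ℝ | 0 < y.2 ∧ y.2 < y.1.1} :=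
      (measurableSet_lt measurable_const measurable_snd).inter
        (measurableSet_lt measurable_snd (measurable_fst.comp measurable_fst))
    have h := (measurable_duhamel_integrand μ ν κ α hφ).indicator hS
    have h2 := (h.stronglyMeasurable.integral_prod_right' (ν := volume)).measurable
    convert! h2 using 2 with z
    rw [← integral_indicator measurableSet_Ioo]
    rfl

lemma picardMap_sub_le (hd : 0 < d) (hLip : DuhamelLipschitz d μ ν κ α q β θ L) {K D : ℝ}
    (hK : 0 ≤ K) (hD : 0 ≤ D) {w₀ : Space d → Unit ⊕ Fin d → ℂ}
    {φ ψ : ℝ → Space d → Unit ⊕ Fin d → ℂ}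
    (hφm : Measurable fun z : ℝ × Space d => φ z.1 z.2)
    (hψm : Measurable fun z : ℝ × Space d => ψ z.1 z.2) (hφ : ProfileBound q β θ K φ)
    (hψ : ProfileBound q β θ K ψ) (hφψ : ProfileBound q β θ D fun t ξ => φ t ξ - ψ t ξ) :
    ProfileBound q β θ (L * (K * D))
      fun t ξ => picardMap μ ν κ α w₀ φ t ξ - picardMap μ ν κ α w₀ ψ t ξ := by
  intro t ht ξ hξ
  have h := (hLip K D hK hD φ ψ (fun s _ i => aestronglyMeasurable_apply hφm s i)
    (fun s _ i => aestronglyMeasurable_apply hψm s i) (fun s hs => hφ.hasTripleBound hd hs)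
    (fun s hs => hψ.hasTripleBound hd hs) (fun s hs => hφψ.hasTripleBound hd hs) t ht ξ hξ).1
  simp only [Matrix.mulVec_sub] at h
  rw [integral_sub (integrableOn_duhamel hd hLip hK hφm hφ ht hξ)
    (integrableOn_duhamel hd hLip hK hψm hψ ht hξ)] at h
  simp only
  rwa [picardMap_of_pos ht hξ, picardMap_of_pos ht hξ, add_sub_add_left_eq_sub]

lemma picardMap_bound (hd : 0 < d) (hLip : DuhamelLipschitz d μ ν κ α q β θ L) {K : ℝ}
    (hK : 0 ≤ K) (hLK : L * K ≤ 1 / 4) {w₀ : Space d → Unit ⊕ Fin d → ℂ}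
    (hlin : ∀ t, 0 < t → ∀ ξ : Space d, ξ ≠ 0 →
      tripleNorm ξ (semigroup μ ν κ α t ξ *ᵥ w₀ ξ) ≤ K / 2 * weight q β θ t ξ)
    {φ : ℝ → Space d → Unit ⊕ Fin d → ℂ}
    (hφm : Measurable fun z : ℝ × Space d => φ z.1 z.2) (hφ : ProfileBound q β θ K φ) :
    ProfileBound q β θ K (picardMap μ ν κ α w₀ φ) := by
  intro t ht ξ hξ
  have h0 : ProfileBound q β θ K fun (_ : ℝ) (_ : Space d) => (0 : Unit ⊕ Fin d → ℂ) := by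
    intro t ht ξ _
    rw [tripleNorm_zero]
    exact mul_nonneg hK (weight_nonneg ht.le ξ)
  have h := picardMap_sub_le (w₀ := w₀) hd hLip hK hK hφm measurable_const hφ h0
    (by simpa using hφ) t ht ξ hξ
  have e : picardMap μ ν κ α w₀ (fun _ _ => 0) t ξ = semigroup μ ν κ α t ξ *ᵥ w₀ ξ := by
    rw [picardMap_of_pos ht hξ]
    have : nonlin μ ν κ (fun _ : Space d => (0 : Unit ⊕ Fin d → ℂ)) ξ = 0 :=
      congrFun (nonlin_zero μ ν κ) ξ
    simp only [this, Matrix.mulVec_zero, integral_zero, add_zero]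
  simp only [e] at h
  have hw := weight_nonneg (q := q) (β := β) (θ := θ) ht.le ξ
  have hL : L * (K * K) * weight q β θ t ξ ≤ 1 / 4 * K * weight q β θ t ξ := by
    have : L * (K * K) ≤ 1 / 4 * K := by
      calc L * (K * K) = L * K * K := by ring
        _ ≤ 1 / 4 * K := by gcongr
    gcongr
  have hsum := tripleNorm_add_le ξ (picardMap μ ν κ α w₀ φ t ξ - semigroup μ ν κ α t ξ *ᵥ w₀ ξ)
    (semigroup μ ν κ α t ξ *ᵥ w₀ ξ)
  rw [sub_add_cancel] at hsum
  have := hlin t ht ξ hξ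
  have : 0 ≤ K * weight q β θ t ξ := mul_nonneg hK hw
  linarith

/-- Existence of a profile solving the integral equation: the Picard iterates converge
geometrically at every point, hence their limit is jointly measurable and obeys the same bound. -/
theorem exists_profile (hd : 0 < d) (hLip : DuhamelLipschitz d μ ν κ α q β θ L) {K : ℝ}
    (hK : 0 ≤ K) (hLK : L * K ≤ 1 / 4) {w₀ : Space d → Unit ⊕ Fin d → ℂ} (hw₀ : Measurable w₀)
    (hlin : ∀ t, 0 < t → ∀ ξ : Space d, ξ ≠ 0 →
      tripleNorm ξ (semigroup μ ν κ α t ξ *ᵥ w₀ ξ) ≤ K / 2 * weight q β θ t ξ) :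
    ∃ φ : ℝ → Space d → Unit ⊕ Fin d → ℂ,
      (Measurable fun z : ℝ × Space d => φ z.1 z.2) ∧ ProfileBound q β θ K φ ∧
        ∀ t, 0 < t → ∀ ξ : Space d, ξ ≠ 0 → φ t ξ = picardMap μ ν κ α w₀ φ t ξ := by
  set f : ℕ → ℝ → Space d → Unit ⊕ Fin d → ℂ :=
    fun n => (picardMap μ ν κ α w₀)^[n] fun _ _ => 0 with hf
  have hf0 : f 0 = fun _ _ => 0 := rfl
  have hfs : ∀ n, f (n + 1) = picardMap μ ν κ α w₀ (f n) := fun n =>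
    Function.iterate_succ_apply' _ _ _
  have hfm : ∀ n, Measurable fun z : ℝ × Space d => f n z.1 z.2 := by
    intro n
    induction n with
    | zero => exact measurable_const
    | succ n ih => rw [hfs]; exact measurable_picardMap hw₀ ih
  have hfb : ∀ n, ProfileBound q β θ K (f n) := by
    intro n
    induction n with
    | zero =>
      intro t ht ξ _
      rw [hf0, tripleNorm_zero]
      exact mul_nonneg hK (weight_nonneg ht.le ξ)
    | succ n ih => rw [hfs]; exact picardMap_bound hd hLip hK hLK hlin (hfm n) ih
  have hcontr : ∀ x : ℝ, 0 ≤ x → L * (K * x) ≤ x * (1 / 2) := by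
    intro x hx
    calc L * (K * x) = L * K * x := by ring
      _ ≤ 1 / 4 * x := by gcongr
      _ ≤ x * (1 / 2) := by linarith
  have hfd : ∀ n, ProfileBound q β θ (K * (1 / 2) ^ n) fun t ξ => f (n + 1) t ξ - f n t ξ := by
    intro n
    induction n with
    | zero => simpa [hf0] using hfb 1
    | succ n ih =>
      intro t ht ξ hξ
      have h := picardMap_sub_le (w₀ := w₀) hd hLip hK (by positivity) (hfm (n + 1)) (hfm n)
        (hfb (n + 1)) (hfb n) ih t ht ξ hξ
      rw [← hfs, ← hfs] at h
      refine h.trans ?_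
      have := hcontr (K * (1 / 2) ^ n) (by positivity)
      rw [pow_succ, ← mul_assoc K ((1 / 2 : ℝ) ^ n)]
      exact mul_le_mul_of_nonneg_right this (weight_nonneg ht.le ξ)
  have hoff : ∀ n t ξ, ¬ (0 < t ∧ ξ ≠ 0) → f n t ξ = 0 := by
    intro n t ξ h
    cases n with
    | zero => rfl
    | succ n => rw [hfs]; exact if_neg h
  have hdist : ∀ t, 0 < t → ∀ ξ : Space d, ξ ≠ 0 → ∀ n,
      dist (tripleMap ξ (f n t ξ)) (tripleMap ξ (f (n + 1) t ξ)) ≤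
        K * weight q β θ t ξ * (1 / 2) ^ n := by
    intro t ht ξ hξ n
    rw [dist_comm, dist_eq_norm, ← map_sub, norm_tripleMap]
    refine (hfd n t ht ξ hξ).trans (le_of_eq ?_)
    ring
  have hlim : ∀ t ξ, ∃ l, Tendsto (fun n => f n t ξ) atTop (𝓝 l) := by
    intro t ξ
    by_cases h : 0 < t ∧ ξ ≠ 0
    · refine cauchySeq_tendsto_of_complete (cauchySeq_of_le_geometric (1 / 2)
        (K * weight q β θ t ξ) (by norm_num) fun n => ?_)
      rw [dist_comm, dist_eq_norm]
      refine (norm_le_tripleNorm ξ _).trans ((hfd n t h.1 ξ h.2).trans (le_of_eq ?_))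
      ring
    · exact ⟨0, by simpa only [hoff _ t ξ h] using tendsto_const_nhds⟩
  choose φ hφ using hlim
  have hφm : Measurable fun z : ℝ × Space d => φ z.1 z.2 :=
    measurable_of_tendsto_metrizable hfm (tendsto_pi_nhds.2 fun z => hφ z.1 z.2)
  have htends : ∀ t ξ, Tendsto (fun n => tripleMap ξ (f n t ξ)) atTop
      (𝓝 (tripleMap ξ (φ t ξ))) := fun t ξ =>
    ((tripleMap ξ).continuous.tendsto _).comp (hφ t ξ)
  have hφb : ProfileBound q β θ K φ := by
    intro t ht ξ hξ
    rw [← norm_tripleMap]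
    refine le_of_tendsto (htends t ξ).norm (Eventually.of_forall fun n => ?_)
    rw [norm_tripleMap]
    exact hfb n t ht ξ hξ
  have hφd : ∀ n, ProfileBound q β θ (K * (1 / 2) ^ n * 2) fun t ξ => φ t ξ - f n t ξ := by
    intro n t ht ξ hξ
    have h := dist_le_of_le_geometric_of_tendsto (1 / 2) (K * weight q β θ t ξ) (by norm_num)
      (hdist t ht ξ hξ) (htends t ξ) n
    rw [dist_comm, dist_eq_norm, ← map_sub, norm_tripleMap] at h
    refine h.trans (le_of_eq ?_)
    ring
  refine ⟨φ, hφm, hφb, fun t ht ξ hξ => ?_⟩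
  -- The defect of the limit is smaller than every term of a geometric sequence.
  have hdef : ∀ n : ℕ, tripleNorm ξ (φ t ξ - picardMap μ ν κ α w₀ φ t ξ) ≤
      2 * K * weight q β θ t ξ * (1 / 2) ^ n := by
    intro n
    have h1 := hφd (n + 1) t ht ξ hξ
    have h2 := picardMap_sub_le (w₀ := w₀) hd hLip hK (by positivity) hφm (hfm n) hφb (hfb n)
      (hφd n) t ht ξ hξ
    simp only [← hfs] at h2
    have h3 := hcontr (K * (1 / 2) ^ n * 2) (by positivity)
    have h4 := mul_le_mul_of_nonneg_right h3 (weight_nonneg (q := q) (β := β) (θ := θ) ht.le ξ)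
    have h5 := tripleNorm_sub_le ξ (φ t ξ - f (n + 1) t ξ)
      (picardMap μ ν κ α w₀ φ t ξ - f (n + 1) t ξ)
    rw [sub_sub_sub_cancel_right] at h5
    rw [pow_succ] at h1
    linarith
  have h0 : tripleNorm ξ (φ t ξ - picardMap μ ν κ α w₀ φ t ξ) ≤ 0 := by
    have h6 : Tendsto (fun n : ℕ => 2 * K * weight q β θ t ξ * (1 / 2) ^ n) atTop (𝓝 0) := by
      simpa using (tendsto_pow_atTop_nhds_zero_of_lt_one (by norm_num : (0 : ℝ) ≤ 1 / 2)
        (by norm_num)).const_mul (2 * K * weight q β θ t ξ)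
    exact ge_of_tendsto' h6 hdef
  have h1 := (norm_le_tripleNorm ξ _).trans h0
  exact sub_eq_zero.1 (norm_le_zero_iff.1 h1)

end IntegralEquation

/-! ### Uniqueness and continuity in time -/

section Regularity

variable {d : ℕ} {μ ν κ α c q β θ L : ℝ}

/-- Uniqueness in a small ball of the Kato space. The two profiles need not be measurable in time:
iterating the Lipschitz estimate halves the distance between them at every step. -/
theorem profile_unique (hLip : DuhamelLipschitz d μ ν κ α q β 0 L) (hd : 0 < d) {K : ℝ}
    (hK : 0 ≤ K) (hLK : L * K ≤ 1 / 4) {w₀ : Space d → Unit ⊕ Fin d → ℂ}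
    {φ ψ : ℝ → Space d → Unit ⊕ Fin d → ℂ}
    (mφ : ∀ s, 0 < s → ∀ i, AEStronglyMeasurable (fun η => φ s η i) volume)
    (mψ : ∀ s, 0 < s → ∀ i, AEStronglyMeasurable (fun η => ψ s η i) volume)
    (hφ : ∀ s, 0 < s → HasTripleBound 0 β (K * s ^ (-q)) (φ s))
    (hψ : ∀ s, 0 < s → HasTripleBound 0 β (K * s ^ (-q)) (ψ s))
    (eφ : ∀ t, 0 < t → ∀ᵐ ξ, IntegrableOn (fun s => semigroup μ ν κ α (t - s) ξ *ᵥ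
        nonlin μ ν κ (φ s) ξ) (Set.Ioo 0 t) volume ∧ φ t ξ = semigroup μ ν κ α t ξ *ᵥ w₀ ξ +
        ∫ s in Set.Ioo 0 t, semigroup μ ν κ α (t - s) ξ *ᵥ nonlin μ ν κ (φ s) ξ)
    (eψ : ∀ t, 0 < t → ∀ᵐ ξ, IntegrableOn (fun s => semigroup μ ν κ α (t - s) ξ *ᵥ
        nonlin μ ν κ (ψ s) ξ) (Set.Ioo 0 t) volume ∧ ψ t ξ = semigroup μ ν κ α t ξ *ᵥ w₀ ξ +
        ∫ s in Set.Ioo 0 t, semigroup μ ν κ α (t - s) ξ *ᵥ nonlin μ ν κ (ψ s) ξ)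
    {t : ℝ} (ht : 0 < t) : φ t =ᵐ[volume] ψ t := by
  have hn : ∀ n : ℕ, ∀ s, 0 < s →
      HasTripleBound 0 β (2 * K * (1 / 2) ^ n * s ^ (-q)) fun η => φ s η - ψ s η := by
    intro n
    induction n with
    | zero =>
      intro s hs
      filter_upwards [hφ s hs, hψ s hs] with η h1 h2
      refine (tripleNorm_sub_le η _ _).trans ((add_le_add h1 h2).trans (le_of_eq ?_))
      ring
    | succ n ih =>
      intro t ht
      have h := hLip K (2 * K * (1 / 2) ^ n) hK (by positivity) φ ψ mφ mψ
        (fun s hs => by rw [zero_mul]; exact hφ s hs) (fun s hs => by rw [zero_mul]; exact hψ s hs)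
        (fun s hs => by rw [zero_mul]; exact ih s hs) t ht
      filter_upwards [eφ t ht, eψ t ht, ae_ne_zero hd] with ξ h1 h2 hξ
      have h3 := (h ξ hξ).1
      simp only [Matrix.mulVec_sub] at h3
      rw [integral_sub h1.1 h2.1] at h3
      rw [h1.2, h2.2, add_sub_add_left_eq_sub]
      refine h3.trans ?_
      have hle : L * (K * (2 * K * (1 / 2) ^ n)) ≤ 2 * K * (1 / 2) ^ (n + 1) := by
        calc L * (K * (2 * K * (1 / 2) ^ n)) = L * K * (2 * K * (1 / 2) ^ n) := by ring
          _ ≤ 1 / 2 * (2 * K * (1 / 2) ^ n) := by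
            gcongr
            linarith
          _ = _ := by ring
      refine (mul_le_mul_of_nonneg_right hle (weight_nonneg ht.le ξ)).trans (le_of_eq ?_)
      simp only [weight, zero_mul]
      ring
  have hall : ∀ᵐ η, ∀ n : ℕ, tripleNorm η (φ t η - ψ t η) ≤
      2 * K * (1 / 2) ^ n * t ^ (-q) * (‖η‖ ^ (-β) * Real.exp (-(0 * ‖η‖))) :=
    ae_all_iff.2 fun n => hn n t ht
  filter_upwards [hall] with η hη
  have h6 : Tendsto (fun n : ℕ => 2 * K * (1 / 2) ^ n * t ^ (-q) *
      (‖η‖ ^ (-β) * Real.exp (-(0 * ‖η‖)))) atTop (𝓝 0) := by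
    simpa using (((tendsto_pow_atTop_nhds_zero_of_lt_one (by norm_num : (0 : ℝ) ≤ 1 / 2)
      (by norm_num)).const_mul (2 * K)).mul_const (t ^ (-q))).mul_const
        (‖η‖ ^ (-β) * Real.exp (-(0 * ‖η‖)))
  have h7 := ge_of_tendsto' h6 hη
  exact sub_eq_zero.1 (norm_le_zero_iff.1 ((norm_le_tripleNorm η _).trans h7))

/-- Restarting the integral equation at a positive time. -/
lemma profile_restart {w₀ : Space d → Unit ⊕ Fin d → ℂ} {φ : ℝ → Space d → Unit ⊕ Fin d → ℂ}
    {s t : ℝ} (hs : 0 < s) (hst : s < t) {ξ : Space d} (hξ : ξ ≠ 0)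
    (hi : ∀ t, 0 < t → IntegrableOn (fun s => semigroup μ ν κ α (t - s) ξ *ᵥ nonlin μ ν κ (φ s) ξ)
      (Set.Ioo 0 t) volume)
    (he : ∀ t, 0 < t → φ t ξ = picardMap μ ν κ α w₀ φ t ξ) :
    φ t ξ = semigroup μ ν κ α (t - s) ξ *ᵥ φ s ξ +
      ∫ τ in Set.Ioo s t, semigroup μ ν κ α (t - τ) ξ *ᵥ nonlin μ ν κ (φ τ) ξ := by
  have ht : 0 < t := hs.trans hst
  have hit := hi t ht
  rw [← integrableOn_Ioc_iff_integrableOn_Ioo] at hit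
  have e1 : ∫ τ in Set.Ioo 0 t, semigroup μ ν κ α (t - τ) ξ *ᵥ nonlin μ ν κ (φ τ) ξ =
      (∫ τ in Set.Ioo 0 s, semigroup μ ν κ α (t - τ) ξ *ᵥ nonlin μ ν κ (φ τ) ξ) +
        ∫ τ in Set.Ioo s t, semigroup μ ν κ α (t - τ) ξ *ᵥ nonlin μ ν κ (φ τ) ξ := by
    rw [← integral_Ioc_eq_integral_Ioo, ← integral_Ioc_eq_integral_Ioo,
      ← integral_Ioc_eq_integral_Ioo, ← Set.Ioc_union_Ioc_eq_Ioc hs.le hst.le,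
      setIntegral_union (Set.Ioc_disjoint_Ioc_of_le le_rfl) measurableSet_Ioc
        (hit.mono_set (Set.Ioc_subset_Ioc_right hst.le))
        (hit.mono_set (Set.Ioc_subset_Ioc_left hs.le))]
  have e2 : ∫ τ in Set.Ioo 0 s, semigroup μ ν κ α (t - τ) ξ *ᵥ nonlin μ ν κ (φ τ) ξ =
      semigroup μ ν κ α (t - s) ξ *ᵥ
        ∫ τ in Set.Ioo 0 s, semigroup μ ν κ α (s - τ) ξ *ᵥ nonlin μ ν κ (φ τ) ξ := by
    set Λ := LinearMap.toContinuousLinearMap (Matrix.mulVecLin (semigroup μ ν κ α (t - s) ξ))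
    change _ = Λ _
    rw [← ContinuousLinearMap.integral_comp_comm Λ (hi s hs)]
    congr 1
    ext1 τ
    change _ = semigroup μ ν κ α (t - s) ξ *ᵥ _
    rw [Matrix.mulVec_mulVec, ← semigroup_add, sub_add_sub_cancel]
  rw [he t ht, he s hs, picardMap_of_pos ht hξ, picardMap_of_pos hs hξ, e1, e2, Matrix.mulVec_add,
    Matrix.mulVec_mulVec, ← semigroup_add, sub_add_cancel, add_assoc]

/-- Modulus of continuity in time. The exponential weight of the solution makes up for the loss of
derivatives in the time regularity of the semigroup. -/
theorem profile_sub_le (hd : 0 < d) (hLip : DuhamelLipschitz d μ ν κ α q β θ L) (hθ : 0 < θ)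
    {C K : ℝ} (hC : 0 ≤ C)
    (hW : ∀ h : ℝ, 0 ≤ h → ∀ (ξ : Space d) (w : Unit ⊕ Fin d → ℂ),
      tripleNorm ξ (semigroup μ ν κ α h ξ *ᵥ w - w) ≤
        C * (h * (‖ξ‖ + ‖ξ‖ ^ 2)) * tripleNorm ξ w)
    (hK : 0 ≤ K) {w₀ : Space d → Unit ⊕ Fin d → ℂ} {φ : ℝ → Space d → Unit ⊕ Fin d → ℂ}
    (hφm : Measurable fun z : ℝ × Space d => φ z.1 z.2) (hφ : ProfileBound q β θ K φ)
    (he : ∀ t, 0 < t → ∀ ξ : Space d, ξ ≠ 0 → φ t ξ = picardMap μ ν κ α w₀ φ t ξ)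
    {s t : ℝ} (hs : 0 < s) (hst : s < t) {ξ : Space d} (hξ : ξ ≠ 0) :
    tripleNorm ξ (φ t ξ - φ s ξ) ≤
      (C * K * s ^ (-q) * ((θ * Real.sqrt s)⁻¹ + 2 * ((θ * Real.sqrt s) ^ 2)⁻¹) * (t - s) +
        L * (K * K) * s ^ (-(2 * q)) * (t - s) ^ q) * ‖ξ‖ ^ (-β) := by
  have hr : 0 < ‖ξ‖ := norm_pos_iff.2 hξ
  have hτ : 0 < t - s := by linarith
  rw [profile_restart hs hst hξ (fun t ht => integrableOn_duhamel hd hLip hK hφm hφ ht hξ)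
    fun t ht => he t ht ξ hξ, add_sub_right_comm]
  refine (tripleNorm_add_le ξ _ _).trans ?_
  rw [add_mul]
  refine add_le_add ?_ ?_
  · set x := θ * Real.sqrt s with hx
    have hx0 : 0 < x := mul_pos hθ (Real.sqrt_pos.2 hs)
    have hexp : (‖ξ‖ + ‖ξ‖ ^ 2) * Real.exp (-(x * ‖ξ‖)) ≤ x⁻¹ + 2 * (x ^ 2)⁻¹ := by
      have hy : 0 ≤ x * ‖ξ‖ := by positivity
      have h1 := Real.add_one_le_exp (x * ‖ξ‖)
      have h2 := Real.quadratic_le_exp_of_nonneg hy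
      rw [Real.exp_neg, ← div_eq_mul_inv, div_le_iff₀ (Real.exp_pos _), add_mul]
      refine add_le_add ?_ ?_
      · rw [inv_mul_eq_div, le_div_iff₀' hx0]
        linarith
      · rw [mul_assoc, inv_mul_eq_div, mul_div_assoc', le_div_iff₀' (by positivity), ← mul_pow]
        linarith
    refine (hW (t - s) hτ.le ξ (φ s ξ)).trans ?_
    calc C * ((t - s) * (‖ξ‖ + ‖ξ‖ ^ 2)) * tripleNorm ξ (φ s ξ) ≤
          C * ((t - s) * (‖ξ‖ + ‖ξ‖ ^ 2)) * (K * weight q β θ s ξ) := by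
          gcongr
          exact hφ s hs ξ hξ
      _ = C * K * s ^ (-q) * ((‖ξ‖ + ‖ξ‖ ^ 2) * Real.exp (-(x * ‖ξ‖))) * (t - s) *
          ‖ξ‖ ^ (-β) := by
          rw [weight]
          ring
      _ ≤ C * K * s ^ (-q) * (x⁻¹ + 2 * (x ^ 2)⁻¹) * (t - s) * ‖ξ‖ ^ (-β) := by gcongr
  · have h := (hLip K K hK hK φ (fun _ => 0) (fun s _ i => aestronglyMeasurable_apply hφm s i)
      (fun s _ i => aestronglyMeasurable_const) (fun s hs => hφ.hasTripleBound hd hs)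
      (fun s hs => ae_of_all _ fun η => by
        simp only [Pi.zero_apply, tripleNorm_zero]
        positivity)
      (fun s hs => by simpa using hφ.hasTripleBound hd hs) t (hs.trans hst) ξ hξ).2.2 s ⟨hs, hst⟩
    simp only [nonlin_zero, Pi.zero_apply, sub_zero] at h
    refine h.trans (le_of_eq ?_)
    ring

/-- The modulus of continuity of `profile_sub_le` vanishes at every positive time. -/
lemma tendsto_modulus (hq : 0 < q) (hθ : 0 < θ) (A B : ℝ) {t₀ : ℝ} (ht₀ : 0 < t₀) :
    Tendsto (fun t => A * (min t t₀) ^ (-q) * ((θ * Real.sqrt (min t t₀))⁻¹ +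
        2 * ((θ * Real.sqrt (min t t₀)) ^ 2)⁻¹) * |t - t₀| +
      B * (min t t₀) ^ (-(2 * q)) * |t - t₀| ^ q) (𝓝 t₀) (𝓝 0) := by
  have hm : Tendsto (fun t => min t t₀) (𝓝 t₀) (𝓝 t₀) := by
    have : Continuous fun t => min t t₀ := by fun_prop
    simpa using this.tendsto t₀
  have ha : Tendsto (fun t => |t - t₀|) (𝓝 t₀) (𝓝 0) := by
    have : Continuous fun t => |t - t₀| := by fun_prop
    simpa using this.tendsto t₀
  have ha' : Tendsto (fun t => |t - t₀| ^ q) (𝓝 t₀) (𝓝 0) := by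
    have := ha.rpow_const (p := q) (Or.inr hq.le)
    rwa [Real.zero_rpow hq.ne'] at this
  have hp : ∀ r : ℝ, Tendsto (fun t => (min t t₀) ^ r) (𝓝 t₀) (𝓝 (t₀ ^ r)) := fun r =>
    hm.rpow_const (Or.inl ht₀.ne')
  have hsq : Tendsto (fun t => θ * Real.sqrt (min t t₀)) (𝓝 t₀) (𝓝 (θ * Real.sqrt t₀)) :=
    ((Real.continuous_sqrt.tendsto t₀).comp hm).const_mul θ
  have hx : 0 < θ * Real.sqrt t₀ := mul_pos hθ (Real.sqrt_pos.2 ht₀)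
  have h1 := ((hp (-q)).const_mul A).mul ((hsq.inv₀ hx.ne').add
    (((hsq.pow 2).inv₀ (pow_pos hx 2).ne').const_mul 2)) |>.mul ha
  have h2 := ((hp (-(2 * q))).const_mul B).mul ha'
  simpa using h1.add h2

end Regularity

/-! ### Pairs of distributions and their Fourier profiles -/

section Pairs

variable {d : ℕ} {β σ A : ℝ}

lemma hasTripleBound_zero_iff {w : Space d → Unit ⊕ Fin d → ℂ} :
    HasTripleBound 0 β A w ↔ ∀ᵐ η, tripleNorm η (w η) ≤ A * ‖η‖ ^ (-β) := by
  simp [HasTripleBound]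

lemma HasTripleBound.to_zero {w : Space d → Unit ⊕ Fin d → ℂ} (h : HasTripleBound σ β A w)
    (hA : 0 ≤ A) (hσ : 0 ≤ σ) : HasTripleBound 0 β A w := by
  refine hasTripleBound_zero_iff.2 ?_
  filter_upwards [h] with η hη
  refine hη.trans (mul_le_mul_of_nonneg_left ?_ hA)
  exact mul_le_of_le_one_right (by positivity) (Real.exp_le_one_iff.2 (by
    have : 0 ≤ σ * ‖η‖ := by positivity
    linarith))

lemma HasTripleBound.pmNorm_apply_le {w : Space d → Unit ⊕ Fin d → ℂ}
    (h : HasTripleBound 0 β A w) (hd : 0 < d) (hA : 0 ≤ A) (i : Unit ⊕ Fin d) :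
    pmNorm β (fun η => w η i) ≤ ENNReal.ofReal A := by
  rw [pmNorm_le_iff_le_rpow hd hA]
  filter_upwards [hasTripleBound_zero_iff.1 h] with η hη
  exact (norm_apply_le_tripleNorm η (w η) i).trans hη

/-- The first component of the triple norm carries one more power of the frequency. -/
lemma HasTripleBound.pmNorm_inl_le {w : Space d → Unit ⊕ Fin d → ℂ}
    (h : HasTripleBound 0 β A w) (hd : 0 < d) (hA : 0 ≤ A) :
    pmNorm (β + 1) (fun η => w η (Sum.inl ())) ≤ ENNReal.ofReal A := by
  rw [pmNorm_le_iff_le_rpow hd hA]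
  filter_upwards [hasTripleBound_zero_iff.1 h, ae_ne_zero hd] with η hη hη0
  have hr : 0 < ‖η‖ := norm_pos_iff.2 hη0
  rw [neg_add, ← sub_eq_add_neg, Real.rpow_sub_one hr.ne', ← mul_div_assoc, le_div_iff₀' hr]
  exact (norm_mul_apply_le_tripleNorm η (w η)).trans hη

lemma HasTripleBound.pmNorm_inr_le {w : Space d → Unit ⊕ Fin d → ℂ}
    (h : HasTripleBound 0 β A w) (hd : 0 < d) (hA : 0 ≤ A) :
    pmNorm β (fun η => (WithLp.toLp 2 fun k => w η (Sum.inr k) : EuclideanSpace ℂ (Fin d))) ≤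
      ENNReal.ofReal A := by
  rw [pmNorm_le_iff_le_rpow hd hA]
  filter_upwards [hasTripleBound_zero_iff.1 h] with η hη
  exact (norm_toLp_inr_le_tripleNorm η (w η)).trans hη

/-- The predicate that `w` represents the Fourier transforms of `a` and of all components
of `u`. -/
def IsPairDensity (a : 𝓢'(Space d, ℂ)) (u : Fin d → 𝓢'(Space d, ℂ))
    (w : Space d → Unit ⊕ Fin d → ℂ) : Prop :=
  IsFourierDensity a (fun η => w η (Sum.inl ())) ∧
    ∀ k, IsFourierDensity (u k) fun η => w η (Sum.inr k)

lemma isPairDensity_hatPair {r s : ℝ} {a : 𝓢'(Space d, ℂ)} {u : Fin d → 𝓢'(Space d, ℂ)}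
    (ha : MemPM r a) (hu : ∀ k, MemPM s (u k)) : IsPairDensity a u (hatPair a u) :=
  ⟨isFourierDensity_hat ha.1, fun k => isFourierDensity_hat (hu k).1⟩

variable {a b : 𝓢'(Space d, ℂ)} {u v : Fin d → 𝓢'(Space d, ℂ)}
  {w w' : Space d → Unit ⊕ Fin d → ℂ}

lemma IsPairDensity.hatPair_ae_eq (h : IsPairDensity a u w) : hatPair a u =ᵐ[volume] w := by
  filter_upwards [h.1.hat_ae_eq, ae_all_iff.2 fun k => (h.2 k).hat_ae_eq] with η h1 h2
  ext i
  rcases i with i | k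
  · exact h1
  · exact h2 k

lemma IsPairDensity.aestronglyMeasurable (h : IsPairDensity a u w) (i : Unit ⊕ Fin d) :
    AEStronglyMeasurable (fun η => w η i) volume := by
  rcases i with i | k
  · exact h.1.1.aestronglyMeasurable
  · exact (h.2 k).1.aestronglyMeasurable

lemma IsPairDensity.unique (h : IsPairDensity a u w) (h' : IsPairDensity b v w')
    (e : w =ᵐ[volume] w') : a = b ∧ u = v := by
  have ei : ∀ i, (fun η => w η i) =ᵐ[volume] fun η => w' η i := fun i => by
    filter_upwards [e] with η hη
    rw [hη]
  exact ⟨(h.1.congr (ei _)).unique h'.1, funext fun k => ((h.2 k).congr (ei _)).unique (h'.2 k)⟩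

lemma exists_isPairDensity (hβ0 : 0 ≤ β) (hβd : β < d)
    (hm : ∀ i, AEStronglyMeasurable (fun η => w η i) volume) (h : HasTripleBound 0 β A w) :
    ∃ (a : 𝓢'(Space d, ℂ)) (u : Fin d → 𝓢'(Space d, ℂ)), IsPairDensity a u w := by
  have hT : ∀ i, ∃ T : 𝓢'(Space d, ℂ), IsFourierDensity T fun η => w η i := fun i =>
    exists_isFourierDensity hβ0 hβd (hm i) (by
      filter_upwards [hasTripleBound_zero_iff.1 h] with η hη
      exact (norm_apply_le_tripleNorm η (w η) i).trans hη)
  choose T hT using hT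
  exact ⟨T (Sum.inl ()), fun k => T (Sum.inr k), hT _, fun k => hT _⟩

/-- Small data have a Borel measurable Fourier profile that obeys the pointwise bound at every
nonzero frequency. -/
lemma exists_measurable_profile (hd : 0 < d) {ρ : ℝ} (hρ : 0 ≤ ρ) (h : IsData a u)
    (hn : dataNorm a u ≤ ENNReal.ofReal ρ) :
    ∃ w₀ : Space d → Unit ⊕ Fin d → ℂ, Measurable w₀ ∧ hatPair a u =ᵐ[volume] w₀ ∧
      ∀ ξ : Space d, ξ ≠ 0 → tripleNorm ξ (w₀ ξ) ≤ ρ * ‖ξ‖ ^ (-((d : ℝ) - 1)) := by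
  have hP := isPairDensity_hatPair h.1 h.2.2
  have hm : AEMeasurable (hatPair a u) volume :=
    aemeasurable_pi_iff.2 fun i => (hP.aestronglyMeasurable i).aemeasurable
  have hb : ∀ᵐ ξ, tripleNorm ξ (hatPair a u ξ) ≤ ρ * ‖ξ‖ ^ (-((d : ℝ) - 1)) := by
    rw [dataNorm, pmNorm_le_iff_le_rpow hd hρ] at hn
    filter_upwards [hn] with ξ hξ
    rwa [Real.norm_eq_abs, abs_of_nonneg (tripleNorm_nonneg _ _)] at hξ
  set S : Set (Space d) := {ξ | tripleNorm ξ (hm.mk _ ξ) ≤ ρ * ‖ξ‖ ^ (-((d : ℝ) - 1))} with hS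
  have hSm : MeasurableSet S := measurableSet_le
    (measurable_tripleNorm.comp (measurable_id.prodMk hm.measurable_mk))
    ((measurable_norm.pow_const _).const_mul ρ)
  refine ⟨S.indicator (hm.mk _), hm.measurable_mk.indicator hSm, ?_, fun ξ _ => ?_⟩
  · filter_upwards [hm.ae_eq_mk, hb] with ξ h1 h2
    rw [Set.indicator_of_mem (show ξ ∈ S by rw [hS, Set.mem_ofPred_eq, ← h1]; exact h2), h1]
  · by_cases hξ : ξ ∈ S
    · rw [Set.indicator_of_mem hξ]
      exact hξ
    · rw [Set.indicator_of_notMem hξ, tripleNorm_zero]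
      positivity

end Pairs

/-! ### Analyticity from exponential decay -/

section Analyticity

variable {d : ℕ} {β σ A : ℝ} {T : 𝓢'(Space d, ℂ)} {φ : Space d → ℂ}

lemma integrable_rpow_mul_exp (hd : 0 < d) (hβ0 : 0 ≤ β) (hβd : β < d) (hσ : 0 < σ) :
    Integrable (fun ξ : Space d => ‖ξ‖ ^ (-β) * Real.exp (-(σ * ‖ξ‖))) volume := by
  have hJ : Integrable (fun ξ : Space d => (1 + ‖ξ‖) ^ (-((d : ℝ) + 1))) volume := by
    apply integrable_one_add_norm
    rw [finrank_euclideanSpace_fin]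
    linarith
  have hE : ∃ M : ℝ, 0 ≤ M ∧ ∀ r : ℝ, 0 ≤ r →
      Real.exp (-(σ * r)) ≤ M * (1 + r) ^ (-((d : ℝ) + 1)) := by
    refine ⟨(d + 1).factorial * (σ⁻¹) ^ (d + 1) * Real.exp σ, by positivity, fun r hr => ?_⟩
    have h1 := Real.pow_div_factorial_le_exp (σ * (1 + r)) (by positivity) (d + 1)
    have e : (1 + r) ^ (-((d : ℝ) + 1)) = ((1 + r) ^ (d + 1))⁻¹ := by
      rw [Real.rpow_neg (by positivity), ← Real.rpow_natCast]
      push_cast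
      rfl
    rw [e, ← div_eq_mul_inv, le_div_iff₀ (by positivity)]
    rw [div_le_iff₀ (by positivity), mul_pow] at h1
    calc Real.exp (-(σ * r)) * (1 + r) ^ (d + 1) =
          Real.exp (-(σ * r)) * (σ⁻¹ ^ (d + 1) * (σ ^ (d + 1) * (1 + r) ^ (d + 1))) := by
          rw [← mul_assoc (σ⁻¹ ^ (d + 1)), ← mul_pow, inv_mul_cancel₀ hσ.ne', one_pow, one_mul]
      _ ≤ Real.exp (-(σ * r)) *
          (σ⁻¹ ^ (d + 1) * (Real.exp (σ * (1 + r)) * (d + 1).factorial)) := by gcongr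
      _ = (d + 1).factorial * σ⁻¹ ^ (d + 1) *
          (Real.exp (-(σ * r)) * Real.exp (σ * (1 + r))) := by ring
      _ = (d + 1).factorial * σ⁻¹ ^ (d + 1) * Real.exp σ := by
          rw [← Real.exp_add]
          congr 2
          ring
  obtain ⟨M, hM, hE⟩ := hE
  refine ((integrable_indicator_ball_rpow hd hβd).add (hJ.const_mul M)).mono' ?_
    (ae_of_all _ fun ξ => ?_)
  · exact ((measurable_norm.pow_const _).mul
      (Real.measurable_exp.comp (measurable_norm.const_mul σ).neg)).aestronglyMeasurable
  · rw [Real.norm_eq_abs, abs_of_nonneg (by positivity), Pi.add_apply]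
    have h0 : 0 ≤ M * (1 + ‖ξ‖) ^ (-((d : ℝ) + 1)) := by positivity
    by_cases hξ : ξ ∈ Metric.ball (0 : Space d) 1
    · rw [Set.indicator_of_mem hξ]
      have : ‖ξ‖ ^ (-β) * Real.exp (-(σ * ‖ξ‖)) ≤ ‖ξ‖ ^ (-β) :=
        mul_le_of_le_one_right (by positivity) (Real.exp_le_one_iff.2 (by
          have : 0 ≤ σ * ‖ξ‖ := by positivity
          linarith))
      linarith
    · rw [Set.indicator_of_notMem hξ, zero_add]
      have h1 : 1 ≤ ‖ξ‖ := by simpa using hξ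
      have h2 : ‖ξ‖ ^ (-β) ≤ 1 := Real.rpow_le_one_of_one_le_of_nonpos h1 (by linarith)
      exact (mul_le_of_le_one_left (by positivity) h2).trans (hE _ (norm_nonneg ξ))

lemma isRealAnalytic_of_norm_le (hd : 0 < d) (hβ0 : 0 ≤ β) (hβd : β < d) (hσ : 0 < σ)
    (hT : IsFourierDensity T φ)
    (hφ : ∀ᵐ ξ, ‖φ ξ‖ ≤ A * (‖ξ‖ ^ (-β) * Real.exp (-(σ * ‖ξ‖)))) : IsRealAnalytic T := by
  refine hT.isRealAnalytic (δ := σ / 2) (by positivity) ?_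
  have hm : Measurable fun ξ : Space d => Real.exp (σ / 2 * ‖ξ‖) :=
    Real.measurable_exp.comp (measurable_norm.const_mul _)
  refine ((integrable_rpow_mul_exp hd hβ0 hβd (half_pos hσ)).const_mul A).mono'
    (hm.aestronglyMeasurable.mul hT.1.aestronglyMeasurable.norm) ?_
  filter_upwards [hφ] with ξ hξ
  rw [Real.norm_eq_abs, abs_of_nonneg (by positivity)]
  calc Real.exp (σ / 2 * ‖ξ‖) * ‖φ ξ‖ ≤
        Real.exp (σ / 2 * ‖ξ‖) * (A * (‖ξ‖ ^ (-β) * Real.exp (-(σ * ‖ξ‖)))) := by gcongr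
    _ = A * (‖ξ‖ ^ (-β) * (Real.exp (σ / 2 * ‖ξ‖) * Real.exp (-(σ * ‖ξ‖)))) := by ring
    _ = A * (‖ξ‖ ^ (-β) * Real.exp (-(σ / 2 * ‖ξ‖))) := by
        rw [← Real.exp_add]
        congr 3
        ring

lemma ofReal_le_rad_of_norm_le (hd : 0 < d) (hβ0 : 0 ≤ β) (hβd : β < d) (hσ : 0 < σ)
    (hA : 0 ≤ A) (hT : IsFourierDensity T φ)
    (hφ : ∀ᵐ ξ, ‖φ ξ‖ ≤ A * (‖ξ‖ ^ (-β) * Real.exp (-(σ * ‖ξ‖)))) :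
    ENNReal.ofReal σ ≤ rad β T := by
  set χ : Space d → ℂ := fun ξ => ((Real.exp (σ * ‖ξ‖) : ℝ) : ℂ) * hat T ξ with hχ
  have hT' := isFourierDensity_hat ⟨φ, hT⟩
  have hm : AEStronglyMeasurable χ volume := by
    have : Measurable fun ξ : Space d => ((Real.exp (σ * ‖ξ‖) : ℝ) : ℂ) :=
      Complex.measurable_ofReal.comp (Real.measurable_exp.comp (measurable_norm.const_mul _))
    exact this.aestronglyMeasurable.mul hT'.1.aestronglyMeasurable
  have hb : ∀ᵐ ξ, ‖χ ξ‖ ≤ A * ‖ξ‖ ^ (-β) := by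
    filter_upwards [hφ, hT.hat_ae_eq] with ξ h1 h2
    rw [hχ]
    simp only
    rw [h2, norm_mul, Complex.norm_real, Real.norm_eq_abs, abs_of_nonneg (Real.exp_pos _).le]
    calc Real.exp (σ * ‖ξ‖) * ‖φ ξ‖ ≤
          Real.exp (σ * ‖ξ‖) * (A * (‖ξ‖ ^ (-β) * Real.exp (-(σ * ‖ξ‖)))) := by gcongr
      _ = A * ‖ξ‖ ^ (-β) * (Real.exp (σ * ‖ξ‖) * Real.exp (-(σ * ‖ξ‖))) := by ring
      _ = A * ‖ξ‖ ^ (-β) := by rw [← Real.exp_add, add_neg_cancel, Real.exp_zero, mul_one]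
  obtain ⟨S, hS⟩ := exists_isFourierDensity hβ0 hβd hm hb
  have hpm : pmNorm β (hat S) ≤ ENNReal.ofReal A := by
    rw [pmNorm_congr hS.hat_ae_eq, pmNorm_le_iff_le_rpow hd hA]
    exact hb
  exact le_iSup₂_of_le (f := fun (σ : ℝ) (_ : 0 < σ ∧ ExpMemPM β σ T) => ENNReal.ofReal σ) σ
    ⟨hσ, S, hS, ⟨_, hS⟩, hpm.trans_lt ENNReal.ofReal_lt_top⟩ le_rfl

/-- Exponential decay of the Fourier profile of a pair at rate `σ` gives analyticity with a radius
of at least `σ`. -/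
theorem isRealAnalytic_and_le_radPair (hd : 0 < d) (hβ0 : 0 ≤ β) (hβd : β < d) (hσ : 0 < σ)
    (hA : 0 ≤ A) {a : 𝓢'(Space d, ℂ)} {u : Fin d → 𝓢'(Space d, ℂ)}
    {w : Space d → Unit ⊕ Fin d → ℂ} (h : IsPairDensity a u w) (hw : HasTripleBound σ β A w) :
    IsRealAnalytic a ∧ (∀ k, IsRealAnalytic (u k)) ∧ ENNReal.ofReal σ ≤ radPair β a u := by
  have hi : ∀ i, ∀ᵐ ξ, ‖w ξ i‖ ≤ A * (‖ξ‖ ^ (-β) * Real.exp (-(σ * ‖ξ‖))) := fun i => by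
    filter_upwards [hw] with ξ hξ
    exact (norm_apply_le_tripleNorm ξ (w ξ) i).trans hξ
  exact ⟨isRealAnalytic_of_norm_le hd hβ0 hβd hσ h.1 (hi _),
    fun k => isRealAnalytic_of_norm_le hd hβ0 hβd hσ (h.2 k) (hi _),
    le_min (ofReal_le_rad_of_norm_le hd hβ0 hβd hσ hA h.1 (hi _))
      (le_iInf fun k => ofReal_le_rad_of_norm_le hd hβ0 hβd hσ hA (h.2 k) (hi _))⟩

end Analyticity

/-! ### Solutions in the Kato space -/

section Solutions

variable {d : ℕ} {μ ν κ α c p β θ K L : ℝ}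

lemma isMildSolution_iff {a₀ : 𝓢'(Space d, ℂ)} {u₀ : Fin d → 𝓢'(Space d, ℂ)}
    {a : ℝ → 𝓢'(Space d, ℂ)} {u : ℝ → Fin d → 𝓢'(Space d, ℂ)} :
    IsMildSolution μ ν κ α a₀ u₀ a u ↔ ∀ t : ℝ, 0 < t → ∀ᵐ ξ : Space d,
      IntegrableOn (fun s => semigroup μ ν κ α (t - s) ξ *ᵥ nonlin μ ν κ (hatPair (a s) (u s)) ξ)
        (Set.Ioo 0 t) volume ∧
      hatPair (a t) (u t) ξ = semigroup μ ν κ α t ξ *ᵥ hatPair a₀ u₀ ξ +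
        ∫ s in Set.Ioo 0 t, semigroup μ ν κ α (t - s) ξ *ᵥ
          nonlin μ ν κ (hatPair (a s) (u s)) ξ := by
  refine forall₂_congr fun t ht => ?_
  have h : ∀ f : ℝ → Unit ⊕ Fin d → ℂ, IntervalIntegrable f volume 0 t ↔
      IntegrableOn f (Set.Ioo 0 t) volume := fun f =>
    intervalIntegrable_iff_integrableOn_Ioo_of_le ht.le
  simp only [h, intervalIntegral.integral_of_le ht.le, integral_Ioc_eq_integral_Ioo, nonlinHat_eq]

lemma memKato_of_density {r : ℝ} {v : ℝ → 𝓢'(Space d, ℂ)} {f : ℝ → Space d → ℂ} {m : ℝ → ℝ → ℝ}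
    (hf : ∀ t, 0 < t → IsFourierDensity (v t) (f t))
    (hb : ∀ t, 0 < t → pmNorm (r + 2 / p) (f t) ≤ ENNReal.ofReal (K * t ^ (-(1 / p))))
    (hm : ∀ t₀, 0 < t₀ → Tendsto (m t₀) (𝓝 t₀) (𝓝 0))
    (hc : ∀ t₀, 0 < t₀ → ∀ t, 0 < t →
      pmNorm (r + 2 / p) (fun ξ => f t ξ - f t₀ ξ) ≤ ENNReal.ofReal (m t₀ t)) :
    MemKato p r v ∧ katoNorm p r (fun t => hat (v t)) ≤ ENNReal.ofReal K := by
  have hb' : ∀ t, 0 < t →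
      pmNorm (r + 2 / p) (hat (v t)) ≤ ENNReal.ofReal (K * t ^ (-(1 / p))) := fun t ht => by
    rw [pmNorm_congr (hf t ht).hat_ae_eq]
    exact hb t ht
  have hk : katoNorm p r (fun t => hat (v t)) ≤ ENNReal.ofReal K := katoNorm_le_iff.2 hb'
  refine ⟨⟨fun t ht => ⟨⟨_, hf t ht⟩, (hb' t ht).trans_lt ENNReal.ofReal_lt_top⟩,
    fun t₀ ht₀ => ?_, hk.trans_lt ENNReal.ofReal_lt_top⟩, hk⟩
  have h0 : Tendsto (fun t => ENNReal.ofReal (m t₀ t)) (𝓝 t₀) (𝓝 0) := by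
    simpa using ENNReal.tendsto_ofReal (hm t₀ ht₀)
  refine tendsto_of_tendsto_of_tendsto_of_le_of_le' tendsto_const_nhds h0
    (Eventually.of_forall fun _ => zero_le) ?_
  filter_upwards [lt_mem_nhds ht₀] with t ht
  rw [pmNorm_congr ((hf t ht).sub (hf t₀ ht₀)).hat_ae_eq]
  exact hc t₀ ht₀ t ht

/-- Membership in a ball of `X_∞` bounds the Fourier profile in the norm of the triple. -/
lemma hasTripleBound_of_xNorm_le (hd : 0 < d) {R : ℝ} (hR : 0 ≤ R) {a : ℝ → 𝓢'(Space d, ℂ)}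
    {u : ℝ → Fin d → 𝓢'(Space d, ℂ)} (hx : xNorm p a u ≤ ENNReal.ofReal R) {t : ℝ} (ht : 0 < t) :
    HasTripleBound 0 ((d : ℝ) - 1 + 2 / p) (3 * R * t ^ (-(1 / p))) (hatPair (a t) (u t)) := by
  have hRt : 0 ≤ R * t ^ (-(1 / p)) := by positivity
  have h1 := (pmNorm_le_iff_le_rpow hd hRt).1 (katoNorm_le_iff.1
    (((le_max_left _ _).trans le_self_add).trans hx) t ht)
  have h2 := (pmNorm_le_iff_le_rpow hd hRt).1 (katoNorm_le_iff.1
    (((le_max_right _ _).trans le_self_add).trans hx) t ht)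
  have h3 := (pmNorm_le_iff_le_rpow hd hRt).1 (katoNorm_le_iff.1 (le_add_self.trans hx) t ht)
  refine hasTripleBound_zero_iff.2 ?_
  filter_upwards [h1, h2, h3, ae_ne_zero hd] with ξ e1 e2 e3 hξ
  have hr : 0 < ‖ξ‖ := norm_pos_iff.2 hξ
  have e2' : ‖ξ‖ * ‖hat (a t) ξ‖ ≤ R * t ^ (-(1 / p)) * ‖ξ‖ ^ (-((d : ℝ) - 1 + 2 / p)) := by
    refine (mul_le_mul_of_nonneg_left e2 hr.le).trans (le_of_eq ?_)
    rw [show -((d : ℝ) - 1 + 2 / p) = 1 + -(d + 2 / p) by ring, Real.rpow_add hr, Real.rpow_one]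
    ring
  refine (tripleNorm_le_add ξ _).trans ?_
  calc _ ≤ R * t ^ (-(1 / p)) * ‖ξ‖ ^ (-((d : ℝ) - 1 + 2 / p)) +
        R * t ^ (-(1 / p)) * ‖ξ‖ ^ (-((d : ℝ) - 1 + 2 / p)) +
        R * t ^ (-(1 / p)) * ‖ξ‖ ^ (-((d : ℝ) - 1 + 2 / p)) := add_le_add (add_le_add e1 e2') e3
    _ = _ := by ring

/-- Two solutions in a small ball of `X_∞` with the same data coincide. -/
theorem IsSolutionInBall.unique (hd : 0 < d)
    (hLip : DuhamelLipschitz d μ ν κ α (1 / p) ((d : ℝ) - 1 + 2 / p) 0 L) {R : ℝ} (hR : 0 ≤ R)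
    (hLR : L * (3 * R) ≤ 1 / 4) {a₀ : 𝓢'(Space d, ℂ)} {u₀ : Fin d → 𝓢'(Space d, ℂ)}
    {a b : ℝ → 𝓢'(Space d, ℂ)} {u v : ℝ → Fin d → 𝓢'(Space d, ℂ)}
    (h : IsSolutionInBall μ ν κ α p R a₀ u₀ a u) (h' : IsSolutionInBall μ ν κ α p R a₀ u₀ b v)
    {t : ℝ} (ht : 0 < t) : a t = b t ∧ u t = v t := by
  have hP : ∀ s, 0 < s → IsPairDensity (a s) (u s) (hatPair (a s) (u s)) := fun s hs =>
    isPairDensity_hatPair (h.1.1.1 s hs) fun k => (h.1.2.2 k).1 s hs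
  have hP' : ∀ s, 0 < s → IsPairDensity (b s) (v s) (hatPair (b s) (v s)) := fun s hs =>
    isPairDensity_hatPair (h'.1.1.1 s hs) fun k => (h'.1.2.2 k).1 s hs
  exact (hP t ht).unique (hP' t ht) (profile_unique hLip hd (by positivity) hLR
    (φ := fun s => hatPair (a s) (u s)) (ψ := fun s => hatPair (b s) (v s))
    (fun s hs => (hP s hs).aestronglyMeasurable) (fun s hs => (hP' s hs).aestronglyMeasurable)
    (fun s hs => hasTripleBound_of_xNorm_le hd hR h.2.1 hs)
    (fun s hs => hasTripleBound_of_xNorm_le hd hR h'.2.1 hs)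
    (isMildSolution_iff.1 h.2.2) (isMildSolution_iff.1 h'.2.2) ht)

/-- A solution of the integral equation for profiles is norm continuous in time. -/
lemma exists_modulus {q C : ℝ} (hLip : DuhamelLipschitz d μ ν κ α q β θ L) (hd : 0 < d)
    (hθ : 0 < θ) (hC : 0 ≤ C) (hq : 0 < q)
    (hW : ∀ h, 0 ≤ h → ∀ (ξ : Space d) w, tripleNorm ξ (semigroup μ ν κ α h ξ *ᵥ w - w) ≤
      C * (h * (‖ξ‖ + ‖ξ‖ ^ 2)) * tripleNorm ξ w) (hL : 0 ≤ L)
    (hK : 0 ≤ K) {w₀ : Space d → Unit ⊕ Fin d → ℂ} {φ : ℝ → Space d → Unit ⊕ Fin d → ℂ}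
    (hφm : Measurable fun z : ℝ × Space d => φ z.1 z.2) (hφ : ProfileBound q β θ K φ)
    (he : ∀ t, 0 < t → ∀ ξ : Space d, ξ ≠ 0 → φ t ξ = picardMap μ ν κ α w₀ φ t ξ) :
    ∃ m : ℝ → ℝ → ℝ, (∀ t₀, 0 < t₀ → Tendsto (m t₀) (𝓝 t₀) (𝓝 0)) ∧
      ∀ t₀, 0 < t₀ → ∀ t, 0 < t →
        0 ≤ m t₀ t ∧ HasTripleBound 0 β (m t₀ t) fun ξ => φ t ξ - φ t₀ ξ := by
  refine ⟨_, fun t₀ ht₀ => tendsto_modulus hq hθ (C * K) (L * (K * K)) ht₀,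
    fun t₀ ht₀ t ht => ?_⟩
  have hmin : 0 < min t t₀ := lt_min ht ht₀
  refine ⟨by positivity, hasTripleBound_zero_iff.2 ?_⟩
  filter_upwards [ae_ne_zero hd] with ξ hξ
  rcases lt_trichotomy t t₀ with h | rfl | h
  · rw [min_eq_left h.le, abs_sub_comm, abs_of_pos (sub_pos.2 h), ← norm_tripleMap, map_sub,
      norm_sub_rev, ← map_sub, norm_tripleMap]
    exact profile_sub_le hd hLip hθ hC hW hK hφm hφ he ht h hξ
  · rw [sub_self, tripleNorm_zero]
    positivity
  · rw [min_eq_right h.le, abs_of_pos (sub_pos.2 h)]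
    exact profile_sub_le hd hLip hθ hC hW hK hφm hφ he ht₀ h hξ

/-- Small data launch a solution in a ball of `X_∞` whose Fourier profile decays like
`e^{-θ√t‖ξ‖}`. -/
theorem exists_isSolutionInBall {C C' : ℝ} (hd : 0 < d)
    (hdL : ∀ ρ t : ℝ, 0 ≤ ρ → 0 < t → ∀ ξ : Space d, ξ ≠ 0 →
      ∀ w, tripleNorm ξ w ≤ ρ * ‖ξ‖ ^ (-((d : ℝ) - 1)) →
        tripleNorm ξ (semigroup μ ν κ α t ξ *ᵥ w) ≤
          C' * ρ * weight (1 / p) ((d : ℝ) - 1 + 2 / p) θ t ξ)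
    (hLip : DuhamelLipschitz d μ ν κ α (1 / p) ((d : ℝ) - 1 + 2 / p) θ L) (hL : 0 ≤ L)
    (hp : 2 < p) (hβ0 : 0 ≤ (d : ℝ) - 1 + 2 / p) (hθ : 0 < θ) (hC : 0 ≤ C)
    (hW : ∀ h, 0 ≤ h → ∀ (ξ : Space d) w, tripleNorm ξ (semigroup μ ν κ α h ξ *ᵥ w - w) ≤
      C * (h * (‖ξ‖ + ‖ξ‖ ^ 2)) * tripleNorm ξ w)
    (hK : 0 ≤ K) (hLK : L * K ≤ 1 / 4) {ρ : ℝ} (hρ : 0 ≤ ρ) (hρK : C' * ρ ≤ K / 2)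
    {a₀ : 𝓢'(Space d, ℂ)} {u₀ : Fin d → 𝓢'(Space d, ℂ)} (hdata : IsData a₀ u₀)
    (hn : dataNorm a₀ u₀ ≤ ENNReal.ofReal ρ) :
    ∃ (a : ℝ → 𝓢'(Space d, ℂ)) (u : ℝ → Fin d → 𝓢'(Space d, ℂ)),
      IsSolutionInBall μ ν κ α p (2 * K) a₀ u₀ a u ∧ ∀ t, 0 < t → ∃ w,
        IsPairDensity (a t) (u t) w ∧
          HasTripleBound (θ * Real.sqrt t) ((d : ℝ) - 1 + 2 / p) (K * t ^ (-(1 / p))) w := by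
  have hq : 0 < 1 / p := by positivity
  have hβd : (d : ℝ) - 1 + 2 / p < d := by
    have : 2 / p < 1 := (div_lt_one (by linarith)).2 hp
    linarith
  obtain ⟨w₀, mw₀, ew₀, hw₀⟩ := exists_measurable_profile hd hρ hdata hn
  obtain ⟨φ, mφ, hφ, eφ⟩ := exists_profile hd hLip hK hLK mw₀ fun t ht ξ hξ =>
    (hdL ρ t hρ ht ξ hξ _ (hw₀ ξ hξ)).trans
      (mul_le_mul_of_nonneg_right hρK (weight_nonneg ht.le ξ))
  have hφ0 : ∀ t, 0 < t → HasTripleBound 0 ((d : ℝ) - 1 + 2 / p) (K * t ^ (-(1 / p))) (φ t) :=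
    fun t ht => (hφ.hasTripleBound hd ht).to_zero (by positivity) (by positivity)
  have hex : ∀ t, ∃ (a : 𝓢'(Space d, ℂ)) (u : Fin d → 𝓢'(Space d, ℂ)),
      0 < t → IsPairDensity a u (φ t) := by
    intro t
    by_cases ht : 0 < t
    · obtain ⟨a, u, h⟩ := exists_isPairDensity hβ0 hβd (aestronglyMeasurable_apply mφ t) (hφ0 t ht)
      exact ⟨a, u, fun _ => h⟩
    · exact ⟨0, 0, fun h => absurd h ht⟩
  choose a u hau using hex
  obtain ⟨m, hm, hφm⟩ := exists_modulus hLip hd hθ hC hq hW hL hK mφ hφ eφ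
  have hp' : (d : ℝ) + 2 / p = (d : ℝ) - 1 + 2 / p + 1 := by ring
  have k1 := memKato_of_density (p := p) (r := (d : ℝ) - 1) (K := K) (fun t ht => (hau t ht).1)
    (fun t ht => (hφ0 t ht).pmNorm_apply_le hd (by positivity) _) hm
    (fun t₀ ht₀ t ht => (hφm t₀ ht₀ t ht).2.pmNorm_apply_le hd (hφm t₀ ht₀ t ht).1 (Sum.inl ()))
  have k2 := memKato_of_density (p := p) (r := (d : ℝ)) (K := K) (fun t ht => (hau t ht).1)
    (fun t ht => by
      rw [hp']
      exact (hφ0 t ht).pmNorm_inl_le hd (by positivity)) hm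
    (fun t₀ ht₀ t ht => by
      rw [hp']
      exact (hφm t₀ ht₀ t ht).2.pmNorm_inl_le hd (hφm t₀ ht₀ t ht).1)
  have k3 := fun k => memKato_of_density (p := p) (r := (d : ℝ) - 1) (K := K)
    (fun t ht => (hau t ht).2 k)
    (fun t ht => (hφ0 t ht).pmNorm_apply_le hd (by positivity) _) hm
    (fun t₀ ht₀ t ht => (hφm t₀ ht₀ t ht).2.pmNorm_apply_le hd (hφm t₀ ht₀ t ht).1 (Sum.inr k))
  have k4 : katoNorm p ((d : ℝ) - 1) (fun t => hatVec (u t)) ≤ ENNReal.ofReal K := by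
    refine katoNorm_le_iff.2 fun t ht => ?_
    have e : hatVec (u t) =ᵐ[volume] fun ξ =>
        (WithLp.toLp 2 fun k => φ t ξ (Sum.inr k) : EuclideanSpace ℂ (Fin d)) := by
      filter_upwards [ae_all_iff.2 fun k => ((hau t ht).2 k).hat_ae_eq] with ξ hξ
      simp only [hatVec, hξ]
    rw [pmNorm_congr e]
    exact (hφ0 t ht).pmNorm_inr_le hd (by positivity)
  refine ⟨a, u, ⟨⟨k1.1, k2.1, fun k => (k3 k).1⟩, ?_, isMildSolution_iff.2 fun t ht => ?_⟩,
    fun t ht => ⟨φ t, hau t ht, hφ.hasTripleBound hd ht⟩⟩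
  · rw [two_mul, ENNReal.ofReal_add hK hK]
    exact add_le_add (max_le k1.2 k2.2) k4
  · have hF : ∀ ξ, Set.EqOn
        (fun s => semigroup μ ν κ α (t - s) ξ *ᵥ nonlin μ ν κ (hatPair (a s) (u s)) ξ)
        (fun s => semigroup μ ν κ α (t - s) ξ *ᵥ nonlin μ ν κ (φ s) ξ) (Set.Ioo 0 t) := by
      intro ξ s hs
      simp only [nonlin_congr μ ν κ (hau s hs.1).hatPair_ae_eq]
    filter_upwards [ew₀, (hau t ht).hatPair_ae_eq, ae_ne_zero hd] with ξ h1 h2 hξ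
    rw [integrableOn_congr_fun (hF ξ) measurableSet_Ioo,
      setIntegral_congr_fun measurableSet_Ioo (hF ξ), h1, h2]
    exact ⟨integrableOn_duhamel hd hLip hK mφ hφ ht hξ,
      (eφ t ht ξ hξ).trans (picardMap_of_pos ht hξ)⟩

end Solutions

end NSK

theorem mainTheorem2 (μ ν κ α : ℝ) (hμ : 0 < μ) (hμν : 0 < μ + ν) (hκ : 0 < κ) (hα : 0 < α) :
    ∃ c₀ : ℝ, 0 < c₀ ∧ (∀ d : ℕ, 2 ≤ d → NSK.IsDecayRate d μ ν κ α c₀) ∧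
      ∀ (d : ℕ) (p : ℝ), 2 ≤ d → 2 < p → 0 < (d : ℝ) - 3 + 4 / p →
        ∃ ρ R : ℝ, 0 < ρ ∧ 0 < R ∧
          (∀ (a₀ : 𝓢'(NSK.Space d, ℂ)) (u₀ : Fin d → 𝓢'(NSK.Space d, ℂ)),
            NSK.IsData a₀ u₀ → NSK.dataNorm a₀ u₀ ≤ ENNReal.ofReal ρ →
              ∃ (a : ℝ → 𝓢'(NSK.Space d, ℂ)) (u : ℝ → Fin d → 𝓢'(NSK.Space d, ℂ)),
                NSK.IsSolutionInBall μ ν κ α p R a₀ u₀ a u ∧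
                  ∀ (b : ℝ → 𝓢'(NSK.Space d, ℂ)) (v : ℝ → Fin d → 𝓢'(NSK.Space d, ℂ)),
                    NSK.IsSolutionInBall μ ν κ α p R a₀ u₀ b v →
                      ∀ t : ℝ, 0 < t → b t = a t ∧ v t = u t) ∧
          (∀ (a₀ : 𝓢'(NSK.Space d, ℂ)) (u₀ : Fin d → 𝓢'(NSK.Space d, ℂ)),
            NSK.IsData a₀ u₀ →
            NSK.dataNorm a₀ u₀ ≤ ENNReal.ofReal (ρ / (2 * Real.exp (2 * c₀))) →
              ∀ (a : ℝ → 𝓢'(NSK.Space d, ℂ)) (u : ℝ → Fin d → 𝓢'(NSK.Space d, ℂ)),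
                NSK.IsSolutionInBall μ ν κ α p R a₀ u₀ a u →
                  ∀ t : ℝ, 0 < t →
                    NSK.IsRealAnalytic (a t) ∧ (∀ k, NSK.IsRealAnalytic (u t k)) ∧
                      ENNReal.ofReal (c₀ * Real.sqrt t) ≤
                        NSK.radPair ((d : ℝ) - 1 + 2 / p) (a t) (u t)) := by
  obtain ⟨c₁, C, hc₁, hC, hdecay⟩ := NSK.exists_semigroup_decay hμ hμν hκ hα
  refine ⟨c₁ / 2, half_pos hc₁, fun d _ => ⟨C, hC, fun t ht ξ w => ?_⟩,
    fun d p hd2 hp hdp => ?_⟩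
  · refine (hdecay d t ht ξ w).trans ?_
    have hw := NSK.tripleNorm_nonneg ξ w
    have : 0 ≤ c₁ * (t * ‖ξ‖ ^ 2) := by positivity
    gcongr ?_ * Real.exp ?_ * ?_
    linarith
  have hd : 0 < d := by omega
  have hdR : (2 : ℝ) ≤ d := by exact_mod_cast hd2
  have hp0 : 0 < p := by linarith
  have hc : 0 < c₁ / 2 := half_pos hc₁
  -- Half of the linear decay rate is spent on the exponential weight.
  have hdec : NSK.SemigroupDecay d μ ν κ α (c₁ / 2) C := fun t ht ξ w => by
    rw [mul_div_cancel₀ c₁ (two_ne_zero)]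
    exact hdecay d t ht ξ w
  have hq : 0 < 1 / p := by positivity
  have hq1 : 1 / p < 1 / 2 := one_div_lt_one_div_of_lt two_pos hp
  have hβ : (d : ℝ) - 1 + 2 / p = d - 1 + 2 * (1 / p) := by ring
  have hβ0 : 0 ≤ (d : ℝ) - 1 + 2 / p := by
    rw [hβ]
    linarith
  have hβ2 : (d : ℝ) + 1 < 2 * ((d : ℝ) - 1 + 2 / p) := by
    have : 4 / p = 2 * (2 / p) := by ring
    linarith
  obtain ⟨C', hC', hdL⟩ := NSK.exists_semigroup_data_le hC hdec hc hq hq1 hβ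
  obtain ⟨L, hL, hLip⟩ := NSK.exists_duhamelLipschitz hd hC hdec hc hq hq1 hβ hβ2
  obtain ⟨C₂, hC₂, hW⟩ := NSK.exists_semigroup_sub_one_le d hμ hμν hκ hα
  set K : ℝ := 1 / (24 * L) with hKdef
  have hK : 0 < K := by positivity
  have hLK : L * K = 1 / 24 := by
    rw [hKdef]
    field_simp
  -- A ball of radius `2K` in `X_∞` lies in a ball of radius `6K` for the norm of the triple.
  have hLR : L * (3 * (2 * K)) ≤ 1 / 4 := by linarith
  have hsol : ∀ (a₀ : 𝓢'(NSK.Space d, ℂ)) (u₀ : Fin d → 𝓢'(NSK.Space d, ℂ)), NSK.IsData a₀ u₀ →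
      NSK.dataNorm a₀ u₀ ≤ ENNReal.ofReal (K / (2 * C')) → _ := fun a₀ u₀ h h' =>
    NSK.exists_isSolutionInBall hd (fun ρ t hρ ht => hdL _ ρ t hc.le le_rfl hρ ht)
      (hLip _ hc.le le_rfl) hL.le hp hβ0 hc hC₂ hW hK.le (by linarith) (by positivity)
      (le_of_eq (by field_simp)) h h'
  refine ⟨K / (2 * C'), 2 * K, by positivity, by positivity, fun a₀ u₀ hdata hn => ?_,
    fun a₀ u₀ hdata hn a u hau t ht => ?_⟩
  · obtain ⟨a, u, hau, -⟩ := hsol a₀ u₀ hdata hn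
    exact ⟨a, u, hau, fun b v hbv t ht =>
      hbv.unique hd (hLip 0 le_rfl hc.le) (by positivity) hLR hau ht⟩
  · have hρ : K / (2 * C') / (2 * Real.exp (2 * (c₁ / 2))) ≤ K / (2 * C') :=
      div_le_self (by positivity) (by
        have := Real.one_le_exp (by positivity : 0 ≤ 2 * (c₁ / 2))
        linarith)
    obtain ⟨b, v, hbv, hw⟩ := hsol a₀ u₀ hdata (hn.trans (ENNReal.ofReal_le_ofReal hρ))
    obtain ⟨w, hw, hwb⟩ := hw t ht
    obtain ⟨e1, e2⟩ := hau.unique hd (hLip 0 le_rfl hc.le) (by positivity) hLR hbv ht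
    rw [e1, e2]
    refine NSK.isRealAnalytic_and_le_radPair hd hβ0 ?_
      (mul_pos hc (Real.sqrt_pos.2 ht)) (by positivity) hw hwb
    have : 2 / p < 1 := (div_lt_one hp0).2 hp
    linarith
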